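/- Let $Q$ be a smooth $n$-dimensional manifold, $L\colon TQ\to\mathbb R$ a Lagrangian of class $C^1$ (in particular, any smooth one), and let $C\subset TQ$ be an integrable smooth subbundle of rank $k$, i.e. through every point of $Q$ there passes an integral submanifold of $C$ (an injectively immersed $k$-dimensional manifold $\iota\colon P\to Q$, with $P$ Hausdorff and second countable, such that $T_qP=C_q$ at each point $q$ of $P$). Fix an interval $[a,b]$ with $a<b$. Terminology. A variational problem on a manifold consists of a Lagrangian, a constraint subset of the tangent bundle, and, for each path $\gamma$ on $[a,b]$, a set $\mathcal W_\gamma$ of admissible variation fields. A path $\gamma$ is admissible if it is $C^2$ and $\dot\gamma(t)$ lies in the constraint subset for all $t\in[a,b]$. A variation field along $\gamma$ is a $C^1$ vector field $\mathbf w$ along $\gamma$ with $\mathbf w(a)=0$, $\mathbf w(b)=0$. A variation of $\gamma$ is a $C^2$ map $\Gamma\colon(-\delta,\delta)\times[a,b]\to Q$ with fixed end-points and $\Gamma(0,\cdot)=\gamma$; it is admissible if its field $\mathbf w(t)=\partial_\varepsilon\Gamma(0,t)$ is in $\mathcal W_\gamma$. An admissible path $\gamma$ is critical if $\frac{d}{d\varepsilon}\big|_{\varepsilon=0}\int_a^b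 L(\dot\Gamma_\varepsilon(t))\,dt=0$ for each admissible variation $\Gamma$ of $\gamma$. Consider the following problems. * Vakonomic: constraint $C$; a variation field $\mathbf w$ is admissible if $s(\dot{\mathbf w}(t))\in T_{\dot\gamma(t)}C$ for all $t$, where $s\colon TTQ\to TTQ$ is the canonical involution. * Nonholonomic: constraint $C$; $\mathbf w$ is admissible if $\mathrm{vl}(\dot\gamma(t),\mathbf w(t))\in T_{\dot\gamma(t)}C$ for all $t$, where $\mathrm{vl}\colon TQ\times_QTQ\to TTQ$ is the vertical lift. * Holonomic, for a submanifold $P$ of $Q$: constraint $TP\subset TQ$; $\mathbf w$ is admissible if it is tangent to $P$. * Unconstrained, on $P$: the Lagrangian is $L|_{TP}$ and all $C^2$ paths and all variation fields in $P$ are admissible. Theorem. 1. The vakonomic and the nonholonomic problem coincide: they have the same admissible paths, the same admissible variation fields along each admissible path, and the same critical paths. 2. Every admissible path of these problems is contained in an integral submanifold of $C$ (which may even be chosen embedded). 3. Let $P$ be any integral submanifold of $C$. The admissible paths of the holonomic problem on $P$ are exactly the $C^2$ paths of $Q$ contained in $P$. Among the paths contained in $P$, the vakonomic, the nonholonomic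 and the holonomic problem on $P$ have the same admissible paths, the same admissible variation fields along each admissible path, and the same critical paths. 4. Moreover, the holonomic problem on $P$ is equivalent to the unconstrained problem on $P$: composition with the immersion $\iota$ carries the admissible (i.e. $C^2$) paths $c$ in $P$ onto the admissible paths of the holonomic problem; $T\iota$ carries the variation fields along $c$ onto the admissible variation fields along $\iota\circ c$; and $c$ is critical if and only if $\iota\circ c$ is critical. -/

import Mathlib

open Set Topology
open scoped Manifold ContDiff

universe u v

noncomputable section

namespace VarMech

section General

variable {F : Type*} [NormedAddCommGroup F] [NormedSpace ℝ F] {H : Type*} [TopologicalSpace H]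
  {N : Type*} [TopologicalSpace N] [ChartedSpace H N]

/-- The velocity at time `t` of a curve `c` defined on the set of times `s`, as a point of the
tangent bundle. -/
def velocity (J : ModelWithCorners ℝ F H) (s : Set ℝ) (c : ℝ → N) (t : ℝ) : TangentBundle J N :=
  ⟨c t, mfderivWithin 𝓘(ℝ, ℝ) J c s t (1 : ℝ)⟩

/-- The tangent vectors to a submanifold `S` of `N`: the velocities at time `0` of the smooth
curves `(-δ, δ) → N` with values in `S`. -/
def tangentVectors (J : ModelWithCorners ℝ F H) (S : Set N) : Set (TangentBundle J N) :=
  {ξ | ∃ (δ : ℝ) (c : ℝ → N), 0 < δ ∧ ContMDiffOn 𝓘(ℝ, ℝ) J ∞ c (Ioo (-δ) δ) ∧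
    (∀ s ∈ Ioo (-δ) δ, c s ∈ S) ∧ velocity J (Ioo (-δ) δ) c 0 = ξ}

end General

section Mechanics

variable {E : Type*} [NormedAddCommGroup E] [NormedSpace ℝ E]
  {M : Type*} [TopologicalSpace M] [ChartedSpace E M] [IsManifold 𝓘(ℝ, E) ∞ M]

/-- The canonical involution of `T(TM)`, `(q, v; u, a) ↦ (q, u; v, a)`. The fibre of `T(TM)` over
`v ∈ T_q M` is described by Mathlib in the coordinates of `TM` induced by the preferred chart at
`q`; these are the same coordinates for all points of `T_q M`, so that the formula applies. -/
def canonicalInvolution (ξ : TangentBundle 𝓘(ℝ, E).tangent (TangentBundle 𝓘(ℝ, E) M)) :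
    TangentBundle 𝓘(ℝ, E).tangent (TangentBundle 𝓘(ℝ, E) M) :=
  ⟨⟨ξ.1.1, (show E × E from ξ.2).1⟩, (show E × E from (ξ.1.2, (show E × E from ξ.2).2))⟩

/-- The vertical lift `TM ×_M TM → T(TM)`, `(q, v, u) ↦ (q, v; 0, u)`. -/
def verticalLift (q : M) (v u : TangentSpace 𝓘(ℝ, E) q) :
    TangentBundle 𝓘(ℝ, E).tangent (TangentBundle 𝓘(ℝ, E) M) :=
  ⟨⟨q, v⟩, (show E × E from (0, u))⟩

/-- The action `∫ₐᵇ L(γ̇(t)) dt`. -/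
def action (L : TangentBundle 𝓘(ℝ, E) M → ℝ) (a b : ℝ) (γ : ℝ → M) : ℝ :=
  ∫ t in a..b, L (velocity 𝓘(ℝ, E) (Icc a b) γ t)

/-- `Γ : (-δ, δ) × [a, b] → M` is a variation of the path `γ : [a, b] → M`: it is of class `C²`,
it fixes the end-points and `Γ(0, t) = γ(t)`. -/
structure IsVariation (a b : ℝ) (γ : ℝ → M) (δ : ℝ) (Γ : ℝ × ℝ → M) : Prop where
  pos : 0 < δ
  contMDiffOn : ContMDiffOn 𝓘(ℝ, ℝ × ℝ) 𝓘(ℝ, E) 2 Γ (Ioo (-δ) δ ×ˢ Icc a b)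
  left : ∀ ε ∈ Ioo (-δ) δ, Γ (ε, a) = γ a
  right : ∀ ε ∈ Ioo (-δ) δ, Γ (ε, b) = γ b
  zero : ∀ t ∈ Icc a b, Γ (0, t) = γ t

/-- `w` is the field `t ↦ Γ'(0, t)` of the variation `Γ : (-δ, δ) × [a, b] → M` of `γ`. -/
def IsFieldOf (a b : ℝ) (γ : ℝ → M) (δ : ℝ) (Γ : ℝ × ℝ → M)
    (w : ∀ t, TangentSpace 𝓘(ℝ, E) (γ t)) : Prop :=
  ∀ t ∈ Icc a b, velocity 𝓘(ℝ, E) (Ioo (-δ) δ) (fun ε => Γ (ε, t)) 0 =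
    (⟨γ t, w t⟩ : TangentBundle 𝓘(ℝ, E) M)

/-- The variation fields along `γ : [a, b] → M`: vector fields along `γ` of class `C¹` that vanish
at the end-points. -/
structure IsVariationField (a b : ℝ) (γ : ℝ → M) (w : ∀ t, TangentSpace 𝓘(ℝ, E) (γ t)) : Prop where
  contMDiffOn : ContMDiffOn 𝓘(ℝ, ℝ) 𝓘(ℝ, E).tangent 1
    (fun t => (⟨γ t, w t⟩ : TangentBundle 𝓘(ℝ, E) M)) (Icc a b)
  left : w a = 0
  right : w b = 0

variable (E M) in
/-- A variational problem on `M`: a Lagrangian, a constraint set `C ⊆ TM`, and, for every path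
`γ : [a, b] → M`, a set of admissible variation fields along `γ`. -/
structure VariationalProblem where
  L : TangentBundle 𝓘(ℝ, E) M → ℝ
  C : Set (TangentBundle 𝓘(ℝ, E) M)
  W : (a b : ℝ) → (γ : ℝ → M) → Set (∀ t, TangentSpace 𝓘(ℝ, E) (γ t))

namespace VariationalProblem

/-- Admissible paths `γ : [a, b] → M` (from `γ a` to `γ b`): they are of class `C²` and satisfy the
constraint. -/
structure IsAdmissible (V : VariationalProblem E M) (a b : ℝ) (γ : ℝ → M) : Prop where
  contMDiffOn : ContMDiffOn 𝓘(ℝ, ℝ) 𝓘(ℝ, E) 2 γ (Icc a b)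
  velocity_mem : ∀ t ∈ Icc a b, velocity 𝓘(ℝ, E) (Icc a b) γ t ∈ V.C

/-- Critical paths: admissible paths `γ` such that `d/dε S[Γ_ε] = 0` at `ε = 0` for every admissible
variation `Γ` of `γ`, that is, every variation whose field is admissible. -/
structure IsCritical (V : VariationalProblem E M) (a b : ℝ) (γ : ℝ → M) : Prop where
  admissible : V.IsAdmissible a b γ
  stationary : ∀ (δ : ℝ) (Γ : ℝ × ℝ → M) (w : ∀ t, TangentSpace 𝓘(ℝ, E) (γ t)),
    IsVariation (E := E) a b γ δ Γ → IsFieldOf a b γ δ Γ w → w ∈ V.W a b γ →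
    HasDerivAt (fun ε => action V.L a b (fun t => Γ (ε, t))) 0 0

end VariationalProblem

/-- Vakonomic mechanics: a variation field `w` is admissible if `s(ẇ(t))` is tangent to `C` for all
`t`, where `s` is the canonical involution. -/
def vakonomic (L : TangentBundle 𝓘(ℝ, E) M → ℝ) (C : Set (TangentBundle 𝓘(ℝ, E) M)) :
    VariationalProblem E M where
  L := L
  C := C
  W a b γ := {w | IsVariationField a b γ w ∧ ∀ t ∈ Icc a b,
    canonicalInvolution (velocity 𝓘(ℝ, E).tangent (Icc a b)
      (fun s => (⟨γ s, w s⟩ : TangentBundle 𝓘(ℝ, E) M)) t) ∈ tangentVectors 𝓘(ℝ, E).tangent C}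

/-- Nonholonomic mechanics: a variation field `w` is admissible if `vl(γ̇(t), w(t))` is tangent to
`C` for all `t`. -/
def nonholonomic (L : TangentBundle 𝓘(ℝ, E) M → ℝ) (C : Set (TangentBundle 𝓘(ℝ, E) M)) :
    VariationalProblem E M where
  L := L
  C := C
  W a b γ := {w | IsVariationField a b γ w ∧ ∀ t ∈ Icc a b,
    verticalLift (γ t) (mfderivWithin 𝓘(ℝ, ℝ) 𝓘(ℝ, E) γ (Icc a b) t (1 : ℝ)) (w t) ∈
      tangentVectors 𝓘(ℝ, E).tangent C}

/-- The unconstrained problem: all paths and all variation fields are admissible. -/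
def unconstrained (L : TangentBundle 𝓘(ℝ, E) M → ℝ) : VariationalProblem E M where
  L := L
  C := univ
  W a b γ := {w | IsVariationField a b γ w}

/-- The holonomic problem in `M` defined by the (immersed) submanifold `ι : P → M`: the constraint
set is `TP ⊆ TM`, and a variation field is admissible if it is tangent to `P`. -/
def holonomic (G : Type*) [NormedAddCommGroup G] [NormedSpace ℝ G]
    {P : Type*} [TopologicalSpace P] [ChartedSpace G P]
    (L : TangentBundle 𝓘(ℝ, E) M → ℝ) (ι : P → M) : VariationalProblem E M where
  L := L
  C := range (tangentMap 𝓘(ℝ, G) 𝓘(ℝ, E) ι)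
  W a b γ := {w | IsVariationField a b γ w ∧ ∀ t ∈ Icc a b,
    (⟨γ t, w t⟩ : TangentBundle 𝓘(ℝ, E) M) ∈ range (tangentMap 𝓘(ℝ, G) 𝓘(ℝ, E) ι)}

end Mechanics

section Distributions

variable {n : ℕ} {Q : Type u} [TopologicalSpace Q] [ChartedSpace (EuclideanSpace ℝ (Fin n)) Q]
  [IsManifold (𝓡 n) ∞ Q]

/-- The total space of a distribution, as a subset of the tangent bundle. -/
def totalSet (D : ∀ q : Q, Submodule ℝ (TangentSpace (𝓡 n) q)) : Set (TangentBundle (𝓡 n) Q) :=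
  {v | v.2 ∈ D v.1}

/-- `D` is a smooth subbundle of rank `k` of `TQ`: it has smooth local frames of `k` fields. -/
def IsSmoothSubbundle (k : ℕ) (D : ∀ q : Q, Submodule ℝ (TangentSpace (𝓡 n) q)) : Prop :=
  ∀ q₀ : Q, ∃ (U : Set Q) (X : Fin k → ∀ q : Q, TangentSpace (𝓡 n) q), IsOpen U ∧ q₀ ∈ U ∧
    (∀ i, ContMDiffOn (𝓡 n) (𝓡 n).tangent ∞
      (fun q => (⟨q, X i q⟩ : TangentBundle (𝓡 n) Q)) U) ∧
    ∀ q ∈ U, LinearIndependent ℝ (fun i => X i q) ∧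
      Submodule.span ℝ (range fun i => X i q) = D q

/-- `ι : P → Q` is an (immersed) integral submanifold of the distribution `D` of rank `k`: an
injective immersion of a `k`-dimensional manifold such that the tangent space of `P` at each of its
points `q` is `D q`. -/
structure IsIntegralSubmanifold (k : ℕ) (D : ∀ q : Q, Submodule ℝ (TangentSpace (𝓡 n) q))
    {P : Type v} [TopologicalSpace P] [ChartedSpace (EuclideanSpace ℝ (Fin k)) P]
    [IsManifold (𝓡 k) ∞ P] (ι : P → Q) : Prop where
  t2Space : T2Space P
  secondCountable : SecondCountableTopology P
  injective : Function.Injective ι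
  isImmersion : Manifold.IsImmersion (𝓡 k) (𝓡 n) ∞ ι
  range_mfderiv : ∀ p : P, ((mfderiv (𝓡 k) (𝓡 n) ι p).range : Set (TangentSpace (𝓡 n) (ι p))) =
    (D (ι p) : Set (TangentSpace (𝓡 n) (ι p)))

/-- A distribution of rank `k` is integrable if through every point of `Q` there passes an integral
submanifold. -/
def IsIntegrable (k : ℕ) (D : ∀ q : Q, Submodule ℝ (TangentSpace (𝓡 n) q)) : Prop :=
  ∀ q : Q, ∃ (P : Type u) (_ : TopologicalSpace P)
    (_ : ChartedSpace (EuclideanSpace ℝ (Fin k)) P) (_ : IsManifold (𝓡 k) ∞ P) (ι : P → Q),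
    IsIntegralSubmanifold k D ι ∧ q ∈ range ι

end Distributions

end VarMech

end

open VarMech

noncomputable section

namespace VarMech

/-! ### Coordinates on the first and second tangent bundles -/

section Coordinates

/-! In a chart, `C` is the range of a smooth field of projections `π` (`IsLocalProjector`). Hence `C
⊂ TQ` is cut out by `π(z)v = v`, and `(c₁, c₂)` is tangent to it at one of its points `(z, v)`
exactly when `π'(c₁)v + π c₂ = c₂`. For a vertical lift `c₁ = 0`, so the nonholonomic fields are
those with values in `C`. With `u` the velocity of the path, the vakonomic condition reads `π'(w)u +
π ẇ = ẇ`, whereas differentiating `π w = w` along the path gives `π'(u)w + π ẇ = ẇ`. Integrability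
makes `π'(a)b` symmetric for `a, b ∈ C` (`IsLocalProjector.fderiv_comm`), so fields with values in
`C` are vakonomic. Conversely, for a vakonomic `w` the defect `y = w - π w` solves the linear
equation `y' = π'(y)u - π'(u)y` and vanishes at `a`, hence everywhere by Grönwall. Equal fields,
constraint and Lagrangian give equal critical paths.

Grönwall also compares paths with integral submanifolds: a path tangent to `C` that meets a small
slice cannot leave it while it stays in a suitable open set (`Slice.exists_isOpen_path`). For a `C²`
path that merely has values in an immersed `P`, tangency to `C` is not evident, since the path might
switch between sheets of `P`; Baire's theorem gives it on a dense set of times, and `C` is closed.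
The slice property then shows that the lift to `P` is `C²`.

The equivalence with the unconstrained problem is delicate because a variation in `Q` whose field is
tangent to `P` may leave `P`. The derivative of the action depends only, and linearly, on the field
(`IsVariation.hasDerivAt_action`, `firstVariation_eq_sum`). A partition of unity therefore reduces
the question to short time intervals, where retracting the variation onto a slice yields a variation
inside `P` with the field cut off (`IsIntegralSubmanifold.exists_isVariation`).

For an embedded integral submanifold containing a path, compactness covers the path by finitely many
relatively compact pieces of plaques. Integral submanifolds through a common point agree near it, so
the union of the pieces is locally a single slice, and the slices provide charts for the subspace
topology. -/

theorem two_le_infty : (2 : WithTop ℕ∞) ≤ ∞ := WithTop.coe_le_coe.2 (le_top (a := (2 : ℕ∞)))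

open Filter
variable {E : Type*} [NormedAddCommGroup E] [NormedSpace ℝ E] {H : Type*} [TopologicalSpace H]
  {I : ModelWithCorners ℝ E H} {M : Type*} [TopologicalSpace M] [ChartedSpace H M]

variable (I) in
/-- The coordinates of the tangent vectors at `q` in the preferred chart at `x₀`. -/
def chartDeriv (x₀ q : M) : TangentSpace I q →L[ℝ] E :=
  mfderiv I 𝓘(ℝ, E) (extChartAt I x₀) q

theorem hasDerivWithinAt_extChartAt_comp [IsManifold I 1 M] {x₀ : M} {s : Set ℝ} {γ : ℝ → M} {t : ℝ}
    (hγ : MDifferentiableWithinAt 𝓘(ℝ, ℝ) I γ s t) (hx : γ t ∈ (chartAt H x₀).source) :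
    HasDerivWithinAt (fun τ => extChartAt I x₀ (γ τ))
      (chartDeriv I x₀ (γ t) (mfderivWithin 𝓘(ℝ, ℝ) I γ s t (1 : ℝ))) s t := by
  have h1 := (mdifferentiableAt_extChartAt (I := I) hx).hasMFDerivAt
  have h2 : HasFDerivWithinAt (fun τ => extChartAt I x₀ (γ τ)) ((chartDeriv I x₀ (γ t)).comp
      (mfderivWithin 𝓘(ℝ, ℝ) I γ s t) : ℝ →L[ℝ] E) s t :=
    hasMFDerivWithinAt_iff_hasFDerivWithinAt.1
      (h1.comp_hasMFDerivWithinAt t hγ.hasMFDerivWithinAt)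
  exact h2.hasDerivWithinAt

/-- The fibre over `q` is by construction the model space read in the preferred chart at `q`. This
is what allows bare model vectors to stand for tangent vectors. -/
theorem chartDeriv_self [IsManifold I 1 M] (q : M) (v : TangentSpace I q) :
    chartDeriv I q q v = v := by
  simp only [chartDeriv]; rw [mfderiv_extChartAt_self]; rfl

theorem chartDeriv_injective [IsManifold I 1 M] {x₀ q : M} (hx : q ∈ (chartAt H x₀).source) :
    Function.Injective (chartDeriv I x₀ q) :=
  (isInvertible_mfderiv_extChartAt (I := I) (by simpa using hx)).injective

theorem chartDeriv_surjective [IsManifold I 1 M] {x₀ q : M} (hx : q ∈ (chartAt H x₀).source) :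
    Function.Surjective (chartDeriv I x₀ q) :=
  (isInvertible_mfderiv_extChartAt (I := I) (by simpa using hx)).surjective

theorem chartDeriv_eq_fderivWithin [IsManifold I 1 M] {x₀ q : M} (hx : q ∈ (chartAt H x₀).source)
    (v : TangentSpace I q) :
    chartDeriv I x₀ q v = fderivWithin ℝ (extChartAt I x₀ ∘ (extChartAt I q).symm) (range I)
      (extChartAt I q q) v := by
  simp only [chartDeriv]
  rw [MDifferentiableAt.mfderiv (mdifferentiableAt_extChartAt hx)]; rfl

/-- The preferred chart of `TM` at `p` depends only on the foot of `p`; hence an arbitrary vector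
over `x₀` can be used to name it. -/
theorem extChartAt_tangent_apply [IsManifold I 1 M] (p ξ : TangentBundle I M)
    (hx : ξ.1 ∈ (chartAt H p.1).source) :
    extChartAt I.tangent p ξ = (extChartAt I p.1 ξ.1, chartDeriv I p.1 ξ.1 ξ.2) := by
  rw [chartDeriv_eq_fderivWithin hx]
  rfl

variable {E : Type*} [NormedAddCommGroup E] [NormedSpace ℝ E]
  {M : Type*} [TopologicalSpace M] [ChartedSpace E M] [IsManifold 𝓘(ℝ, E) ∞ M]

omit [IsManifold 𝓘(ℝ, E) ∞ M] in
theorem extChartAt_tangent_target [IsManifold 𝓘(ℝ, E) 1 M] (p : TangentBundle 𝓘(ℝ, E) M) :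
    (extChartAt 𝓘(ℝ, E).tangent p).target = (extChartAt 𝓘(ℝ, E) p.1).target ×ˢ univ := by
  ext z
  have := TangentBundle.mem_chart_target_iff (I := 𝓘(ℝ, E)) z p
  simp [extChartAt]
  exact this

theorem contDiffOn_chartChange (x₀ q : M) : ContDiffOn ℝ ∞ (extChartAt 𝓘(ℝ, E) x₀ ∘ (extChartAt 𝓘(ℝ, E) q).symm)
    ((extChartAt 𝓘(ℝ, E) q).target ∩ (extChartAt 𝓘(ℝ, E) q).symm ⁻¹' (chartAt E x₀).source) := by
  refine contMDiffOn_iff_contDiffOn.1 ?_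
  exact (contMDiffOn_extChartAt (n := ∞) (I := 𝓘(ℝ, E))).comp ((contMDiffOn_extChartAt_symm q).mono inter_subset_left)
    fun z hz => hz.2

omit [IsManifold 𝓘(ℝ, E) ∞ M] in
theorem isOpen_chartChange_source (x₀ q : M) : IsOpen
    ((extChartAt 𝓘(ℝ, E) q).target ∩ (extChartAt 𝓘(ℝ, E) q).symm ⁻¹' (chartAt E x₀).source) :=
  (continuousOn_extChartAt_symm q).isOpen_inter_preimage (isOpen_extChartAt_target q)
    (chartAt E x₀).open_source

theorem chartDeriv_eq_fderiv_chartChange {x₀ q y : M} (hx : y ∈ (chartAt E x₀).source)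
    (hq : y ∈ (chartAt E q).source) (v : TangentSpace 𝓘(ℝ, E) y) :
    chartDeriv 𝓘(ℝ, E) x₀ y v = fderiv ℝ (extChartAt 𝓘(ℝ, E) x₀ ∘ (extChartAt 𝓘(ℝ, E) q).symm)
      (extChartAt 𝓘(ℝ, E) q y) (chartDeriv 𝓘(ℝ, E) q y v) := by
  have : IsManifold 𝓘(ℝ, E) 1 M := .of_le (n := ∞) (by norm_num)
  have hy : extChartAt 𝓘(ℝ, E) q y ∈ ((extChartAt 𝓘(ℝ, E) q).target ∩
      (extChartAt 𝓘(ℝ, E) q).symm ⁻¹' (chartAt E x₀).source) := by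
    have hq' : y ∈ (extChartAt 𝓘(ℝ, E) q).source := by simpa using hq
    exact ⟨(extChartAt 𝓘(ℝ, E) q).map_source hq', by
      simpa only [mem_preimage, (extChartAt 𝓘(ℝ, E) q).left_inv hq'] using hx⟩
  have h1 := (mdifferentiableAt_extChartAt (I := 𝓘(ℝ, E)) hq).hasMFDerivAt
  have h2 := (((contDiffOn_chartChange x₀ q).contDiffAt
    ((isOpen_chartChange_source x₀ q).mem_nhds hy)).differentiableAt (by simp)).hasFDerivAt
  have h3 := (hasMFDerivAt_iff_hasFDerivAt.2 h2).comp y h1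
  have h4 := (mdifferentiableAt_extChartAt (I := 𝓘(ℝ, E)) hx).hasMFDerivAt
  have h5 : extChartAt 𝓘(ℝ, E) x₀ =ᶠ[𝓝 y] (extChartAt 𝓘(ℝ, E) x₀ ∘ (extChartAt 𝓘(ℝ, E) q).symm) ∘
      extChartAt 𝓘(ℝ, E) q := by
    filter_upwards [(chartAt E q).open_source.mem_nhds hq] with y' hy'
    have hq' : y' ∈ (extChartAt 𝓘(ℝ, E) q).source := by simpa using hy'
    simp only [Function.comp_apply, (extChartAt 𝓘(ℝ, E) q).left_inv hq']
  exact congrArg (fun f : E →L[ℝ] E => f v) (hasMFDerivAt_unique h4 (h3.congr_of_eventuallyEq h5))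

omit [IsManifold 𝓘(ℝ, E) ∞ M] in
theorem chartDeriv_extChartAt_symm [IsManifold 𝓘(ℝ, E) 1 M] (p : TangentBundle 𝓘(ℝ, E) M)
    {z : E × E} (hz : z.1 ∈ (extChartAt 𝓘(ℝ, E) p.1).target) :
    chartDeriv 𝓘(ℝ, E) p.1 ((extChartAt 𝓘(ℝ, E).tangent p).symm z).1
      ((extChartAt 𝓘(ℝ, E).tangent p).symm z).2 = z.2 := by
  have hz' : z ∈ (extChartAt 𝓘(ℝ, E).tangent p).target := by
    rw [extChartAt_tangent_target]; exact ⟨hz, mem_univ _⟩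
  have h := (extChartAt 𝓘(ℝ, E).tangent p).right_inv hz'
  rw [extChartAt_tangent_apply] at h
  · exact congrArg Prod.snd h
  · have := (extChartAt 𝓘(ℝ, E) p.1).map_target hz
    rwa [extChartAt_source] at this

/-- With `τ` the change of charts, the change of the induced charts of `TM` is `(z, v) ↦ (τ z, τ'(z)
v)`. Its derivative contains the quadratic term `τ''(u, v)`, so the components `(u, a)` are not
tensorial. -/
theorem chartDeriv_tangent {x₀ q : M} (hx : q ∈ (chartAt E x₀).source) (v u a w : E) :
    chartDeriv 𝓘(ℝ, E).tangent (⟨x₀, w⟩ : TangentBundle 𝓘(ℝ, E) M) ⟨q, v⟩ (u, a) =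
      (chartDeriv 𝓘(ℝ, E) x₀ q u,
        fderiv ℝ (fderiv ℝ (extChartAt 𝓘(ℝ, E) x₀ ∘ (extChartAt 𝓘(ℝ, E) q).symm))
          (extChartAt 𝓘(ℝ, E) q q) u v + chartDeriv 𝓘(ℝ, E) x₀ q a) := by
  have : IsManifold 𝓘(ℝ, E) 1 M := .of_le (n := ∞) (by norm_num)
  set z := extChartAt 𝓘(ℝ, E) q q with hz
  set τ := extChartAt 𝓘(ℝ, E) x₀ ∘ (extChartAt 𝓘(ℝ, E) q).symm with hτ
  set p₀ : TangentBundle 𝓘(ℝ, E) M := ⟨x₀, w⟩ with hp₀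
  set p : TangentBundle 𝓘(ℝ, E) M := ⟨q, v⟩ with hp
  have hqT : p ∈ (chartAt (ModelProd E E) p₀).source := by simpa [hp, hp₀] using hx
  have key := chartDeriv_eq_fderivWithin (I := 𝓘(ℝ, E).tangent) (M := TangentBundle 𝓘(ℝ, E) M) hqT
    (u, a)
  have hr : range 𝓘(ℝ, E).tangent = univ := 𝓘(ℝ, E).tangent.range_eq_univ
  rw [hr, fderivWithin_univ] at key
  refine key.trans ?_
  have hzt : z ∈ ((extChartAt 𝓘(ℝ, E) q).target ∩
      (extChartAt 𝓘(ℝ, E) q).symm ⁻¹' (chartAt E x₀).source) :=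
    ⟨mem_extChartAt_target q, by simpa [hz] using hx⟩
  have hopen := (isOpen_chartChange_source x₀ q).mem_nhds hzt
  have hev : (extChartAt 𝓘(ℝ, E).tangent p₀ ∘ (extChartAt 𝓘(ℝ, E).tangent p).symm)
      =ᶠ[𝓝 (z, v)] fun p => (τ p.1, fderiv ℝ τ p.1 p.2) := by
    filter_upwards [(continuous_fst.tendsto (z, v)) hopen] with y hy
    simp only [Function.comp_apply]
    rw [extChartAt_tangent_apply _ _ (by exact hy.2)]
    refine Prod.ext rfl ?_
    have hy1 := (extChartAt 𝓘(ℝ, E) q).map_target hy.1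
    rw [extChartAt_source] at hy1
    have h6 := chartDeriv_eq_fderiv_chartChange (x₀ := x₀) (q := q) (y := (extChartAt 𝓘(ℝ, E) q).symm y.1)
      hy.2 hy1 ((extChartAt 𝓘(ℝ, E).tangent p).symm y).2
    rw [(extChartAt 𝓘(ℝ, E) q).right_inv hy.1] at h6
    refine h6.trans (congrArg (fderiv ℝ τ y.1) ?_)
    exact chartDeriv_extChartAt_symm p hy.1
  have hpt : extChartAt 𝓘(ℝ, E).tangent p p = (z, v) := by
    rw [extChartAt_tangent_apply _ _ (by simp)]
    exact Prod.ext rfl (chartDeriv_self (I := 𝓘(ℝ, E)) q v)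
  rw [hpt, hev.fderiv_eq]
  have hτs : ContDiffAt ℝ ∞ τ z := (contDiffOn_chartChange x₀ q).contDiffAt hopen
  have h1 : HasFDerivAt τ (fderiv ℝ τ z) z := (hτs.differentiableAt (by simp)).hasFDerivAt
  have h2 : HasFDerivAt (fderiv ℝ τ) (fderiv ℝ (fderiv ℝ τ) z) z :=
    ((hτs.fderiv_right (m := ∞) le_rfl).differentiableAt (by simp)).hasFDerivAt
  have h3 : HasFDerivAt (fun p : E × E => p.1) (ContinuousLinearMap.fst ℝ E E) (z, v) := hasFDerivAt_fst
  have h4 := (h1.comp (z, v) h3).prodMk ((h2.comp (z, v) h3).clm_apply hasFDerivAt_snd)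
  have h5 := h4.fderiv
  simp only [Function.comp_def] at h5
  rw [h5]
  have h7 : ∀ b : E, fderiv ℝ τ z b = chartDeriv 𝓘(ℝ, E) x₀ q b := fun b => by
    have := chartDeriv_eq_fderiv_chartChange (x₀ := x₀) (q := q) (y := q) hx (mem_chart_source E q) b
    refine (this.trans (congrArg _ ?_)).symm
    exact chartDeriv_self (I := 𝓘(ℝ, E)) q b
  simp [h7, add_comm]

/-- Exchanging `u` and `v` leaves the quadratic term `τ''(u, v)` unchanged, by symmetry of second
derivatives. So the formula defining the involution in one chart is valid in all of them. -/
theorem chartDeriv_canonicalInvolution {x₀ : M} (w : E)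
    {ξ : TangentBundle 𝓘(ℝ, E).tangent (TangentBundle 𝓘(ℝ, E) M)}
    (hx : ξ.1.1 ∈ (chartAt E x₀).source) :
    chartDeriv 𝓘(ℝ, E) x₀ (canonicalInvolution ξ).1.1 (canonicalInvolution ξ).1.2 =
      (chartDeriv 𝓘(ℝ, E).tangent (⟨x₀, w⟩ : TangentBundle 𝓘(ℝ, E) M) ξ.1 ξ.2).1 ∧
    chartDeriv 𝓘(ℝ, E).tangent (⟨x₀, w⟩ : TangentBundle 𝓘(ℝ, E) M)
      (canonicalInvolution ξ).1 (canonicalInvolution ξ).2 =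
      (chartDeriv 𝓘(ℝ, E) x₀ ξ.1.1 ξ.1.2,
        (chartDeriv 𝓘(ℝ, E).tangent (⟨x₀, w⟩ : TangentBundle 𝓘(ℝ, E) M) ξ.1 ξ.2).2) := by
  obtain ⟨⟨q, v⟩, ⟨u, a⟩⟩ := ξ
  replace hx : q ∈ (chartAt E x₀).source := hx
  have h1 := chartDeriv_tangent (x₀ := x₀) hx v u a w
  have h2 := chartDeriv_tangent (x₀ := x₀) hx u v a w
  refine ⟨(congrArg Prod.fst h1).symm, h2.trans (Prod.ext rfl ?_)⟩
  refine Eq.trans ?_ (congrArg Prod.snd h1).symm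
  have hzt : extChartAt 𝓘(ℝ, E) q q ∈ ((extChartAt 𝓘(ℝ, E) q).target ∩
      (extChartAt 𝓘(ℝ, E) q).symm ⁻¹' (chartAt E x₀).source) :=
    ⟨mem_extChartAt_target q, by simpa using hx⟩
  have hs := (((contDiffOn_chartChange x₀ q).contDiffAt
    ((isOpen_chartChange_source x₀ q).mem_nhds hzt)).isSymmSndFDerivAt (by simpa using two_le_infty)).eq u v
  exact congrArg (· + chartDeriv 𝓘(ℝ, E) x₀ q a) hs.symm

theorem chartDeriv_verticalLift {x₀ q : M} (hx : q ∈ (chartAt E x₀).source) (w v u : E) :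
    chartDeriv 𝓘(ℝ, E).tangent (⟨x₀, w⟩ : TangentBundle 𝓘(ℝ, E) M)
      (verticalLift q v u).1 (verticalLift q v u).2 = (0, chartDeriv 𝓘(ℝ, E) x₀ q u) := by
  refine (chartDeriv_tangent (x₀ := x₀) hx v 0 u w).trans ?_
  have h : chartDeriv 𝓘(ℝ, E) x₀ q (0 : E) = 0 := map_zero _
  simp [h]

/-- The derivative of a curve in the tangent bundle, in coordinates. -/
theorem hasDerivWithinAt_chartDeriv {x₀ : M} (w : E) {s : Set ℝ} {σ : ℝ → TangentBundle 𝓘(ℝ, E) M}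
    {t : ℝ} (hσ : MDifferentiableWithinAt 𝓘(ℝ, ℝ) 𝓘(ℝ, E).tangent σ s t)
    (ht : t ∈ s) (hx : (σ t).1 ∈ (chartAt E x₀).source) :
    HasDerivWithinAt (fun τ => (extChartAt 𝓘(ℝ, E) x₀ (σ τ).1, chartDeriv 𝓘(ℝ, E) x₀ (σ τ).1 (σ τ).2))
      (chartDeriv 𝓘(ℝ, E).tangent (⟨x₀, w⟩ : TangentBundle 𝓘(ℝ, E) M) (σ t)
        (velocity 𝓘(ℝ, E).tangent s σ t).2) s t := by
  have : IsManifold 𝓘(ℝ, E) 1 M := .of_le (n := ∞) (by norm_num)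
  have hx' : σ t ∈ (chartAt (ModelProd E E) (⟨x₀, w⟩ : TangentBundle 𝓘(ℝ, E) M)).source := by
    simpa using hx
  refine (hasDerivWithinAt_extChartAt_comp hσ hx').congr_of_eventuallyEq_of_mem ?_ ht
  filter_upwards [hσ.continuousWithinAt ((chartAt (ModelProd E E)
    (⟨x₀, w⟩ : TangentBundle 𝓘(ℝ, E) M)).open_source.mem_nhds hx')] with τ hτ
  rw [extChartAt_tangent_apply]
  exact (TangentBundle.mem_chart_source_iff _ _).1 hτ

/-- The foot of `s(ẇ)` is the base component of `ẇ`. Knowing that it is the velocity of the path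
makes the foot condition in the vakonomic tangency automatic for admissible paths. -/
theorem velocity_section_fst {s : Set ℝ} {γ : ℝ → M} {w : ∀ t, TangentSpace 𝓘(ℝ, E) (γ t)} {t : ℝ}
    (hσ : MDifferentiableWithinAt 𝓘(ℝ, ℝ) 𝓘(ℝ, E).tangent
      (fun t => (⟨γ t, w t⟩ : TangentBundle 𝓘(ℝ, E) M)) s t)
    (ht : t ∈ s) (hu : UniqueDiffWithinAt ℝ s t) :
    (show E × E from (velocity 𝓘(ℝ, E).tangent s
      (fun t => (⟨γ t, w t⟩ : TangentBundle 𝓘(ℝ, E) M)) t).2).1 =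
      mfderivWithin 𝓘(ℝ, ℝ) 𝓘(ℝ, E) γ s t (1 : ℝ) := by
  have : IsManifold 𝓘(ℝ, E) 1 M := .of_le (n := ∞) (by norm_num)
  have hγ : MDifferentiableWithinAt 𝓘(ℝ, ℝ) 𝓘(ℝ, E) γ s t :=
    ((Bundle.contMDiff_proj (TangentSpace 𝓘(ℝ, E) : M → Type _) (n := 1)).mdifferentiable
      (by simp) _).comp_mdifferentiableWithinAt t hσ
  have h1 := hasDerivWithinAt_extChartAt_comp (x₀ := γ t) hγ (by simp)
  have h2 := (hasDerivWithinAt_chartDeriv (x₀ := γ t) (show E from w t) hσ ht (mem_chart_source E (γ t))).fst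
  have h3 := hu.eq_deriv _ h2 h1
  rw [chartDeriv_self] at h3
  refine Eq.trans ?_ h3
  exact congrArg Prod.fst (chartDeriv_self (I := 𝓘(ℝ, E).tangent) (M := TangentBundle 𝓘(ℝ, E) M)
    _ _).symm

theorem velocity_section_snd {s : Set ℝ} {γ : ℝ → M} {w : ∀ t, TangentSpace 𝓘(ℝ, E) (γ t)} {t : ℝ}
    (hσ : MDifferentiableWithinAt 𝓘(ℝ, ℝ) 𝓘(ℝ, E).tangent
      (fun t => (⟨γ t, w t⟩ : TangentBundle 𝓘(ℝ, E) M)) s t) (ht : t ∈ s) :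
    HasDerivWithinAt (fun τ => chartDeriv 𝓘(ℝ, E) (γ t) (γ τ) (w τ))
      (show E × E from (velocity 𝓘(ℝ, E).tangent s
      (fun t => (⟨γ t, w t⟩ : TangentBundle 𝓘(ℝ, E) M)) t).2).2 s t := by
  have : IsManifold 𝓘(ℝ, E) 1 M := .of_le (n := ∞) (by norm_num)
  have h2 := (hasDerivWithinAt_chartDeriv (x₀ := γ t) (show E from w t) hσ ht (mem_chart_source E (γ t))).snd
  refine (HasFDerivWithinAt.hasDerivWithinAt h2).congr_deriv ?_
  refine Eq.trans ?_ (congrArg Prod.snd (chartDeriv_self (I := 𝓘(ℝ, E).tangent)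
    (M := TangentBundle 𝓘(ℝ, E) M) _ (velocity 𝓘(ℝ, E).tangent s
      (fun t => (⟨γ t, w t⟩ : TangentBundle 𝓘(ℝ, E) M)) t).2))
  simp only [ContinuousLinearMap.comp_apply, ContinuousLinearMap.toSpanSingleton_apply, one_smul]
  rfl

end Coordinates

/-! ### Grönwall uniqueness and local projections onto the distribution -/

section Projection
open Filter

/-- Grönwall's inequality on both sides of `t₀`: forwards directly, backwards after the reversal of
time `s ↦ -s`. -/
theorem eqOn_zero_of_norm_deriv_le {F : Type*} [NormedAddCommGroup F] [NormedSpace ℝ F]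
    {y y' : ℝ → F} {α β C t₀ : ℝ} (hy : ∀ t ∈ Icc α β, HasDerivWithinAt y (y' t) (Icc α β) t)
    (hC : ∀ t ∈ Icc α β, ‖y' t‖ ≤ C * ‖y t‖) (ht₀ : t₀ ∈ Icc α β) (h₀ : y t₀ = 0) :
    ∀ t ∈ Icc α β, y t = 0 := by
  have hc : ContinuousOn y (Icc α β) := fun t ht => (hy t ht).continuousWithinAt
  intro t ht
  rcases le_total t₀ t with h | h
  · refine eq_zero_of_abs_deriv_le_mul_abs_self_of_eq_zero_right (f' := y') (K := C)
      (hc.mono (Icc_subset_Icc ht₀.1 le_rfl)) (fun x hx => ?_) h₀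
      (fun x hx => hC x ⟨ht₀.1.trans hx.1, hx.2.le⟩) t ⟨h, ht.2⟩
    exact ((hy x ⟨ht₀.1.trans hx.1, hx.2.le⟩).mono
      (Icc_subset_Icc (ht₀.1.trans hx.1) le_rfl)).mono_of_mem_nhdsWithin (Icc_mem_nhdsGE hx.2)
  · have key := eq_zero_of_abs_deriv_le_mul_abs_self_of_eq_zero_right (f := fun s => y (-s))
      (f' := fun s => -(y' (-s))) (K := C) (a := -t₀) (b := -α) ?_ ?_ (by simpa using h₀) ?_ (-t)
      ⟨neg_le_neg h, neg_le_neg ht.1⟩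
    · simpa using key
    · refine hc.comp continuous_neg.continuousOn fun s hs => ?_
      exact ⟨by linarith [hs.2], by linarith [hs.1, ht₀.2]⟩
    · intro s hs
      have hs' : -s ∈ Icc α β := ⟨by linarith [hs.2], by linarith [hs.1, ht₀.2]⟩
      have h1 := (hy (-s) hs').scomp s (s := Icc s (-α)) (hasDerivAt_neg s).hasDerivWithinAt
        (fun r hr => ⟨by linarith [hr.2], by linarith [hr.1, hs'.2]⟩)
      simp only [neg_smul, one_smul] at h1
      exact h1.mono_of_mem_nhdsWithin (Icc_mem_nhdsGE hs.2)
    · intro s hs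
      simpa using hC (-s) ⟨by linarith [hs.2], by linarith [hs.1, ht₀.2]⟩

/-- The span of linearly independent smooth fields is locally the range of a smooth field of
projections. -/
theorem exists_contDiffOn_projection {E : Type*} [NormedAddCommGroup E] [NormedSpace ℝ E]
    [FiniteDimensional ℝ E] {k : ℕ} {V₀ : Set E} (hV₀ : IsOpen V₀) {X : Fin k → E → E}
    (hX : ∀ i, ContDiffOn ℝ ∞ (X i) V₀) {z₀ : E} (hz₀ : z₀ ∈ V₀)
    (hli : LinearIndependent ℝ fun i => X i z₀) :
    ∃ (V : Set E) (π : E → E →L[ℝ] E), IsOpen V ∧ z₀ ∈ V ∧ V ⊆ V₀ ∧ ContDiffOn ℝ ∞ π V ∧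
      (∀ z ∈ V, ∀ v, π z (π z v) = π z v) ∧
      ∀ z ∈ V, ∀ v, π z v = v ↔ v ∈ Submodule.span ℝ (range fun i => X i z) := by
  let A : E → (Fin k → ℝ) →L[ℝ] E := fun z =>
    ∑ i, (ContinuousLinearMap.proj (R := ℝ) (φ := fun _ : Fin k => ℝ) i).smulRight (X i z)
  have hA : ∀ z c, A z c = ∑ i, c i • X i z := fun z c => by
    simp [A]
  have hAs : ContDiffOn ℝ ∞ A V₀ := by
    refine ContDiffOn.sum fun i _ => ?_
    exact contDiffOn_const.smulRight (hX i)
  have hinj : LinearMap.ker (A z₀ : (Fin k → ℝ) →ₗ[ℝ] E) = ⊥ := by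
    rw [LinearMap.ker_eq_bot']
    intro c hc
    have := Fintype.linearIndependent_iff.1 hli c (by simpa [hA] using hc)
    exact funext this
  obtain ⟨B', hB'⟩ := LinearMap.exists_leftInverse_of_injective _ hinj
  let B : E →L[ℝ] (Fin k → ℝ) := LinearMap.toContinuousLinearMap B'
  have hB : B ∘L A z₀ = 1 := by
    ext1 c
    exact congrArg (fun f : (Fin k → ℝ) →ₗ[ℝ] (Fin k → ℝ) => f c) hB'
  let G : E → (Fin k → ℝ) →L[ℝ] (Fin k → ℝ) := fun z => B ∘L A z
  have hGs : ContDiffOn ℝ ∞ G V₀ := contDiffOn_const.clm_comp hAs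
  let V : Set E := V₀ ∩ G ⁻¹' {g | IsUnit g}
  have hVo : IsOpen V := hGs.continuousOn.isOpen_inter_preimage hV₀ Units.isOpen
  -- `B` is a left inverse of the frame map `A z₀`, so `G z = B A(z)` is the identity at `z₀` and
  -- invertible nearby. Then `A G⁻¹ B` is the projection onto the range of `A z` along the kernel of
  -- `B`, smooth in `z` because inversion is.
  let π : E → E →L[ℝ] E := fun z => A z ∘L (Ring.inverse (G z) ∘L B)
  have hπA : ∀ z ∈ V, ∀ c, π z (A z c) = A z c := fun z hz c => by
    have := Ring.inverse_mul_cancel (G z) hz.2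
    exact congrArg (A z) (congrArg (fun f : (Fin k → ℝ) →L[ℝ] (Fin k → ℝ) => f c) this)
  refine ⟨V, π, hVo, ⟨hz₀, ?_⟩, inter_subset_left, ?_, fun z hz v => hπA z hz _,
    fun z hz v => ?_⟩
  · change IsUnit (G z₀)
    simp only [G, hB, isUnit_one]
  · refine (hAs.mono inter_subset_left).clm_comp (ContDiffOn.clm_comp ?_ contDiffOn_const)
    intro z hz
    obtain ⟨g, hg⟩ := hz.2
    have h1 : ContDiffAt ℝ ∞ Ring.inverse (G z) := hg ▸ contDiffAt_ringInverse ℝ g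
    exact h1.comp_contDiffWithinAt z ((hGs z hz.1).mono inter_subset_left)
  · rw [Submodule.mem_span_range_iff_exists_fun]
    constructor
    · intro h
      exact ⟨Ring.inverse (G z) (B v), (hA z _).symm.trans h⟩
    · rintro ⟨c, rfl⟩
      rw [← hA]
      exact hπA z hz c

variable {n : ℕ} {Q : Type u} [TopologicalSpace Q] [ChartedSpace (EuclideanSpace ℝ (Fin n)) Q]

/-- A smooth field of projections onto the distribution `D`, in the preferred chart at `x₀`. -/
structure IsLocalProjector (D : ∀ q : Q, Submodule ℝ (TangentSpace (𝓡 n) q)) (x₀ : Q)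
    (V : Set (EuclideanSpace ℝ (Fin n)))
    (π : EuclideanSpace ℝ (Fin n) → EuclideanSpace ℝ (Fin n) →L[ℝ] EuclideanSpace ℝ (Fin n)) :
    Prop where
  isOpen : IsOpen V
  mem : extChartAt (𝓡 n) x₀ x₀ ∈ V
  subset : V ⊆ (extChartAt (𝓡 n) x₀).target
  contDiffOn : ContDiffOn ℝ ∞ π V
  idem : ∀ z ∈ V, ∀ v, π z (π z v) = π z v
  mem_iff : ∀ q ∈ (chartAt (EuclideanSpace ℝ (Fin n)) x₀).source, extChartAt (𝓡 n) x₀ q ∈ V →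
    ∀ v : TangentSpace (𝓡 n) q, v ∈ D q ↔
      π (extChartAt (𝓡 n) x₀ q) (chartDeriv (𝓡 n) x₀ q v) = chartDeriv (𝓡 n) x₀ q v

variable [IsManifold (𝓡 n) ∞ Q] {k : ℕ} {D : ∀ q : Q, Submodule ℝ (TangentSpace (𝓡 n) q)}

theorem IsSmoothSubbundle.exists_isLocalProjector (hD : IsSmoothSubbundle k D) (x₀ : Q) :
    ∃ V π, IsLocalProjector D x₀ V π := by
  have hM : IsManifold (𝓡 n) 1 Q := .of_le (n := ∞) (by norm_num)
  obtain ⟨U, X, hU, hx₀, hX, hXD⟩ := hD x₀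
  set e := extChartAt (𝓡 n) x₀ with he
  set V₀ := e.target ∩ e.symm ⁻¹' U with hV₀
  have hV₀o : IsOpen V₀ := (continuousOn_extChartAt_symm x₀).isOpen_inter_preimage
    (isOpen_extChartAt_target x₀) hU
  let Y : Fin k → EuclideanSpace ℝ (Fin n) → EuclideanSpace ℝ (Fin n) := fun i z =>
    chartDeriv (𝓡 n) x₀ (e.symm z) (X i (e.symm z))
  have hsrc : ∀ z ∈ V₀, e.symm z ∈ (chartAt (EuclideanSpace ℝ (Fin n)) x₀).source := fun z hz => by
    have := e.map_target hz.1
    rwa [he, extChartAt_source] at this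
  have hY : ∀ i, ContDiffOn ℝ ∞ (Y i) V₀ := fun i => by
    have h1 : ContMDiffOn (𝓡 n) 𝓘(ℝ, EuclideanSpace ℝ (Fin n) × EuclideanSpace ℝ (Fin n)) ∞
        (fun z => extChartAt (𝓡 n).tangent (⟨x₀, 0⟩ : TangentBundle (𝓡 n) Q)
          ⟨e.symm z, X i (e.symm z)⟩) V₀ := by
      refine (contMDiffOn_extChartAt (n := ∞) (I := (𝓡 n).tangent)
        (x := (⟨x₀, 0⟩ : TangentBundle (𝓡 n) Q))).comp ((hX i).comp
        ((contMDiffOn_extChartAt_symm x₀).mono inter_subset_left) fun z hz => hz.2) ?_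
      intro z hz
      exact (TangentBundle.mem_chart_source_iff _ _).2 (hsrc z hz)
    refine (contMDiffOn_iff_contDiffOn.1 h1).snd.congr fun z hz => ?_
    rw [extChartAt_tangent_apply _ _ (hsrc z hz)]
  have hz₀ : e x₀ ∈ V₀ := ⟨mem_extChartAt_target x₀, by
    simpa only [mem_preimage, he, extChartAt_to_inv] using hx₀⟩
  have hli : ∀ z ∈ V₀, LinearIndependent ℝ fun i => Y i z := fun z hz =>
    (hXD (e.symm z) hz.2).1.map' (chartDeriv (𝓡 n) x₀ (e.symm z)).toLinearMap
      (LinearMap.ker_eq_bot.2 (chartDeriv_injective (hsrc z hz)))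
  obtain ⟨V, π, hVo, hzV, hVV₀, hπ, hidem, hiff⟩ :=
    exists_contDiffOn_projection hV₀o hY hz₀ (hli _ hz₀)
  refine ⟨V, π, hVo, hzV, fun z hz => (hVV₀ hz).1, hπ, hidem, fun q hq hqV v => ?_⟩
  rw [hiff _ hqV]
  have hleft : e.symm (e q) = q := e.left_inv (by simpa [he] using hq)
  have hYq : (fun i => Y i (e q)) = fun i => chartDeriv (𝓡 n) x₀ q (X i q) := by
    funext i
    exact congrArg (fun q' => chartDeriv (𝓡 n) x₀ q' (X i q')) hleft
  have hq2 : q ∈ U := hleft ▸ (hVV₀ hqV).2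
  rw [hYq, ← (hXD q hq2).2]
  have : (range fun i => chartDeriv (𝓡 n) x₀ q (X i q)) =
      (chartDeriv (𝓡 n) x₀ q).toLinearMap '' range fun i => X i q := by
    rw [← range_comp]; rfl
  rw [this, ← Submodule.map_span]
  constructor
  · intro h
    exact Submodule.mem_map_of_mem h
  · intro h
    obtain ⟨v', hv', hvv⟩ := Submodule.mem_map.1 h
    rwa [← chartDeriv_injective (I := 𝓡 n) hq hvv]

end Projection

/-! ### Tangent vectors to the total space of the distribution -/

section Tangency
open Filter

theorem tangentBundle_ext_of_chartDeriv {E : Type*} [NormedAddCommGroup E] [NormedSpace ℝ E]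
    {H : Type*} [TopologicalSpace H] {I : ModelWithCorners ℝ E H} {M : Type*} [TopologicalSpace M]
    [ChartedSpace H M] [IsManifold I 1 M] {x₀ : M} {ξ η : TangentBundle I M}
    (hξ : ξ.1 ∈ (chartAt H x₀).source) (hη : η.1 ∈ (chartAt H x₀).source)
    (h₁ : extChartAt I x₀ ξ.1 = extChartAt I x₀ η.1)
    (h₂ : chartDeriv I x₀ ξ.1 ξ.2 = chartDeriv I x₀ η.1 η.2) : ξ = η := by
  refine (extChartAt I.tangent (⟨x₀, 0⟩ : TangentBundle I M)).injOn ?_ ?_ ?_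
  · rw [extChartAt_source]; exact (TangentBundle.mem_chart_source_iff _ _).2 hξ
  · rw [extChartAt_source]; exact (TangentBundle.mem_chart_source_iff _ _).2 hη
  · rw [extChartAt_tangent_apply _ _ hξ, extChartAt_tangent_apply _ _ hη, h₁, h₂]

theorem hasDerivWithinAt_clm_comp_apply {E F G : Type*} [NormedAddCommGroup E] [NormedSpace ℝ E]
    [NormedAddCommGroup F] [NormedSpace ℝ F] [NormedAddCommGroup G] [NormedSpace ℝ G]
    {π : E → F →L[ℝ] G} {π' : E →L[ℝ] F →L[ℝ] G} {z : ℝ → E} {v : ℝ → F} {z' : E} {v' : F}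
    {s : Set ℝ} {t : ℝ} (hπ : HasFDerivAt π π' (z t)) (hz : HasDerivWithinAt z z' s t)
    (hv : HasDerivWithinAt v v' s t) :
    HasDerivWithinAt (fun τ => π (z τ) (v τ)) (π' z' (v t) + π (z t) v') s t :=
  (hπ.comp_hasDerivWithinAt t hz).clm_apply hv

theorem contMDiffOn_velocity {E : Type*} [NormedAddCommGroup E] [NormedSpace ℝ E]
    {M : Type*} [TopologicalSpace M] [ChartedSpace E M] [IsManifold 𝓘(ℝ, E) ∞ M]
    {a b : ℝ} (hab : a < b) {γ : ℝ → M} (hγ : ContMDiffOn 𝓘(ℝ, ℝ) 𝓘(ℝ, E) 2 γ (Icc a b)) :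
    ContMDiffOn 𝓘(ℝ, ℝ) 𝓘(ℝ, E).tangent 1 (velocity 𝓘(ℝ, E) (Icc a b) γ) (Icc a b) := by
  have hM : IsManifold 𝓘(ℝ, E) (1 + 1) M := .of_le (n := ∞) (by
    rw [one_add_one_eq_two]; exact two_le_infty)
  have hM2 : IsManifold 𝓘(ℝ, E) 2 M := .of_le (n := ∞) two_le_infty
  have h1 := hγ.contMDiffOn_tangentMapWithin (m := 1) (by norm_num)
    (uniqueDiffOn_Icc hab).uniqueMDiffOn
  have h2 : ContMDiff 𝓘(ℝ, ℝ) 𝓘(ℝ, ℝ).tangent 1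
      (fun t : ℝ => (⟨t, (1 : ℝ)⟩ : TangentBundle 𝓘(ℝ, ℝ) ℝ)) :=
    contMDiff_vectorSpace_iff_contDiff.2 contDiff_const
  exact h1.comp h2.contMDiffOn (fun t ht => ht)

variable {n : ℕ} {Q : Type u} [TopologicalSpace Q] [ChartedSpace (EuclideanSpace ℝ (Fin n)) Q]
  [IsManifold (𝓡 n) ∞ Q] {k : ℕ} {D : ∀ q : Q, Submodule ℝ (TangentSpace (𝓡 n) q)}
  {x₀ : Q} {V : Set (EuclideanSpace ℝ (Fin n))}
  {π : EuclideanSpace ℝ (Fin n) → EuclideanSpace ℝ (Fin n) →L[ℝ] EuclideanSpace ℝ (Fin n)}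

omit [IsManifold (𝓡 n) ∞ Q] in
theorem IsLocalProjector.hasFDerivAt (h : IsLocalProjector D x₀ V π) {z : EuclideanSpace ℝ (Fin n)}
    (hz : z ∈ V) : HasFDerivAt π (fderiv ℝ π z) z :=
  ((h.contDiffOn.contDiffAt (h.isOpen.mem_nhds hz)).differentiableAt (by simp)).hasFDerivAt

/-- Differentiate the identity `π(z)v = v` along a curve `(z, v)` in the total space. -/
theorem IsLocalProjector.deriv_eq_of_curve (h : IsLocalProjector D x₀ V π) {δ : ℝ}
    {σ : ℝ → TangentBundle (𝓡 n) Q} (hδ : 0 < δ)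
    (hσ : MDifferentiableAt 𝓘(ℝ, ℝ) (𝓡 n).tangent σ 0) (hσD : ∀ s ∈ Ioo (-δ) δ, σ s ∈ totalSet D)
    (hx : (σ 0).1 ∈ (chartAt (EuclideanSpace ℝ (Fin n)) x₀).source)
    (hV : extChartAt (𝓡 n) x₀ (σ 0).1 ∈ V) {c : EuclideanSpace ℝ (Fin n) × EuclideanSpace ℝ (Fin n)}
    (hd : HasDerivAt (fun t => (extChartAt (𝓡 n) x₀ (σ t).1,
      chartDeriv (𝓡 n) x₀ (σ t).1 (σ t).2)) c 0) :
    fderiv ℝ π (extChartAt (𝓡 n) x₀ (σ 0).1) c.1 (chartDeriv (𝓡 n) x₀ (σ 0).1 (σ 0).2) +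
        π (extChartAt (𝓡 n) x₀ (σ 0).1) c.2 = c.2 := by
  have h0 : (0 : ℝ) ∈ Ioo (-δ) δ := ⟨by linarith, hδ⟩
  have hz : HasDerivAt (fun t => extChartAt (𝓡 n) x₀ (σ t).1) c.1 0 :=
    HasFDerivAt.hasDerivAt hd.hasFDerivAt.fst |>.congr_deriv (by simp)
  have hv : HasDerivAt (fun t => chartDeriv (𝓡 n) x₀ (σ t).1 (σ t).2) c.2 0 :=
    HasFDerivAt.hasDerivAt hd.hasFDerivAt.snd |>.congr_deriv (by simp)
  have hπ := hasDerivWithinAt_clm_comp_apply (s := univ) (h.hasFDerivAt hV) hz.hasDerivWithinAt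
    hv.hasDerivWithinAt
  rw [hasDerivWithinAt_univ] at hπ
  have hσc : ContinuousAt (fun t => (σ t).1) 0 :=
    (FiberBundle.continuous_proj (EuclideanSpace ℝ (Fin n))
      (TangentSpace (𝓡 n) : Q → Type _)).continuousAt.comp hσ.continuousAt
  have hev : (fun t => π (extChartAt (𝓡 n) x₀ (σ t).1) (chartDeriv (𝓡 n) x₀ (σ t).1 (σ t).2))
      =ᶠ[𝓝 0] fun t => chartDeriv (𝓡 n) x₀ (σ t).1 (σ t).2 := by
    have e1 := hσc.preimage_mem_nhds
      ((chartAt (EuclideanSpace ℝ (Fin n)) x₀).open_source.mem_nhds hx)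
    have e2 := hz.continuousAt.preimage_mem_nhds (h.isOpen.mem_nhds hV)
    filter_upwards [Ioo_mem_nhds h0.1 h0.2, e1, e2] with t ht ht1 ht2
    exact (h.mem_iff (σ t).1 ht1 ht2 (σ t).2).1 (hσD t ht)
  exact hπ.unique (hv.congr_of_eventuallyEq hev)

/-- The tangent space of the total space of a distribution, in coordinates. -/
theorem IsLocalProjector.mem_tangentVectors_iff (h : IsLocalProjector D x₀ V π)
    {ξ : TangentBundle (𝓡 n).tangent (TangentBundle (𝓡 n) Q)}
    (hx : ξ.1.1 ∈ (chartAt (EuclideanSpace ℝ (Fin n)) x₀).source)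
    (hV : extChartAt (𝓡 n) x₀ ξ.1.1 ∈ V) {c : EuclideanSpace ℝ (Fin n) × EuclideanSpace ℝ (Fin n)}
    (hc : chartDeriv (𝓡 n).tangent (⟨x₀, 0⟩ : TangentBundle (𝓡 n) Q) ξ.1 ξ.2 = c) :
    ξ ∈ tangentVectors (𝓡 n).tangent (totalSet D) ↔ ξ.1.2 ∈ D ξ.1.1 ∧
      fderiv ℝ π (extChartAt (𝓡 n) x₀ ξ.1.1) c.1 (chartDeriv (𝓡 n) x₀ ξ.1.1 ξ.1.2) +
        π (extChartAt (𝓡 n) x₀ ξ.1.1) c.2 = c.2 := by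
  have hM : IsManifold (𝓡 n) 1 Q := .of_le (n := ∞) (by norm_num)
  constructor
  · rintro ⟨δ, σ, hδ, hσ, hσD, rfl⟩
    have h0 : (0 : ℝ) ∈ Ioo (-δ) δ := ⟨by linarith, hδ⟩
    have hσ0 := hσ.contMDiffAt (Ioo_mem_nhds h0.1 h0.2) |>.mdifferentiableAt (by simp)
    refine ⟨hσD 0 h0, h.deriv_eq_of_curve hδ hσ0 hσD hx hV ?_⟩
    have hd := (hasDerivWithinAt_chartDeriv (x₀ := x₀) 0 ((hσ 0 h0).mdifferentiableWithinAt (by simp))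
      h0 hx).hasDerivAt (Ioo_mem_nhds h0.1 h0.2)
    exact hd.congr_deriv hc
  · rintro ⟨hξD, heq⟩
    set z := extChartAt (𝓡 n) x₀ ξ.1.1 with hz
    set v := chartDeriv (𝓡 n) x₀ ξ.1.1 ξ.1.2 with hv
    set p₀ : TangentBundle (𝓡 n) Q := ⟨x₀, 0⟩ with hp₀
    have hπv : π z v = v := (h.mem_iff _ hx hV _).1 hξD
    -- Projecting a straight line of vectors keeps the curve in the total space. At `s = 0` its
    -- velocity is `(c₁, π'(c₁)v + π c₂)`, which is `c` precisely by the hypothesis `heq`.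
    let f : ℝ → EuclideanSpace ℝ (Fin n) × EuclideanSpace ℝ (Fin n) := fun s =>
      (z + s • c.1, π (z + s • c.1) (v + s • c.2))
    have hcont : Continuous fun s : ℝ => z + s • c.1 := by fun_prop
    have hS : (fun s : ℝ => z + s • c.1) ⁻¹' V ∈ 𝓝 (0 : ℝ) :=
      (h.isOpen.preimage hcont).mem_nhds (by simpa using hV)
    obtain ⟨δ, hδ, hδV⟩ := Metric.mem_nhds_iff.1 hS
    rw [Real.ball_eq_Ioo, zero_sub, zero_add] at hδV
    have h0 : (0 : ℝ) ∈ Ioo (-δ) δ := ⟨by linarith, hδ⟩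
    have hf : ContDiffOn ℝ ∞ f (Ioo (-δ) δ) := by
      have h1 : ContDiffOn ℝ ∞ (fun s : ℝ => z + s • c.1) (Ioo (-δ) δ) := by fun_prop
      exact h1.prodMk ((h.contDiffOn.comp h1 hδV).clm_apply (by fun_prop))
    have hft : ∀ s ∈ Ioo (-δ) δ, f s ∈ (extChartAt (𝓡 n).tangent p₀).target := fun s hs => by
      rw [extChartAt_tangent_target]; exact ⟨h.subset (hδV hs), mem_univ _⟩
    let σ : ℝ → TangentBundle (𝓡 n) Q := fun s => (extChartAt (𝓡 n).tangent p₀).symm (f s)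
    have hσ : ContMDiffOn 𝓘(ℝ, ℝ) (𝓡 n).tangent ∞ σ (Ioo (-δ) δ) :=
      (contMDiffOn_extChartAt_symm p₀).comp hf.contMDiffOn hft
    have hf0 : f 0 = (z, v) := by simp [f, hπv]
    have hξs : ξ.1 ∈ (extChartAt (𝓡 n).tangent p₀).source := by
      rw [extChartAt_source]; exact (TangentBundle.mem_chart_source_iff _ _).2 hx
    have hξf : extChartAt (𝓡 n).tangent p₀ ξ.1 = (z, v) := extChartAt_tangent_apply _ _ hx
    have hσ0 : σ 0 = ξ.1 := by
      change (extChartAt (𝓡 n).tangent p₀).symm (f 0) = ξ.1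
      rw [hf0, ← hξf, (extChartAt (𝓡 n).tangent p₀).left_inv hξs]
    refine ⟨δ, σ, hδ, hσ, fun s hs => ?_, ?_⟩
    · have hs1 : (extChartAt (𝓡 n) x₀).symm (f s).1 ∈ (extChartAt (𝓡 n) x₀).source :=
        (extChartAt (𝓡 n) x₀).map_target (h.subset (hδV hs))
      have hs2 := (extChartAt (𝓡 n) x₀).right_inv (h.subset (hδV hs))
      have hs3 : extChartAt (𝓡 n) x₀ (σ s).1 = z + s • c.1 := hs2
      have hs4 : chartDeriv (𝓡 n) x₀ (σ s).1 (σ s).2 = (f s).2 :=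
        chartDeriv_extChartAt_symm p₀ (h.subset (hδV hs))
      refine (h.mem_iff (σ s).1 ?_ ?_ _).2 ?_
      · rwa [extChartAt_source] at hs1
      · rw [hs3]; exact hδV hs
      · rw [hs3, hs4]; exact h.idem _ (hδV hs) _
    · have hσs : σ 0 ∈ (chartAt (ModelProd (EuclideanSpace ℝ (Fin n)) (EuclideanSpace ℝ (Fin n))) p₀).source := by
        rw [hσ0]; exact (TangentBundle.mem_chart_source_iff _ _).2 hx
      refine tangentBundle_ext_of_chartDeriv (x₀ := p₀) hσs (hσ0 ▸ hσs) (congrArg _ hσ0) ?_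
      rw [hc]
      have hd := (hasDerivWithinAt_extChartAt_comp ((hσ 0 h0).mdifferentiableWithinAt (by simp))
        hσs).hasDerivAt (Ioo_mem_nhds h0.1 h0.2)
      have hev : (fun s => extChartAt (𝓡 n).tangent p₀ (σ s)) =ᶠ[𝓝 0] f := by
        filter_upwards [Ioo_mem_nhds h0.1 h0.2] with s hs
        exact (extChartAt (𝓡 n).tangent p₀).right_inv (hft s hs)
      have hz1 : HasDerivAt (fun s : ℝ => z + s • c.1) c.1 0 := by
        simpa using ((hasDerivAt_id (0 : ℝ)).smul_const c.1).const_add z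
      have hz2 : HasDerivAt (fun s : ℝ => v + s • c.2) c.2 0 := by
        simpa using ((hasDerivAt_id (0 : ℝ)).smul_const c.2).const_add v
      have hz3 : HasFDerivAt π (fderiv ℝ π z) (z + (0 : ℝ) • c.1) := by
        simpa using h.hasFDerivAt hV
      have hf' : HasDerivAt f c 0 := by
        have hπ := hasDerivWithinAt_clm_comp_apply (s := univ) hz3 hz1.hasDerivWithinAt
          hz2.hasDerivWithinAt
        rw [hasDerivWithinAt_univ, zero_smul, zero_smul, add_zero, add_zero, heq] at hπ
        exact hz1.prodMk hπ
      exact hd.unique (hf'.congr_of_eventuallyEq hev)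

/-- The lift has coordinates `(0, u)`, so the derivative of `π` drops out of the tangency equation
and only `π u = u` remains. -/
theorem IsLocalProjector.verticalLift_mem_iff (h : IsLocalProjector D x₀ V π) {q : Q}
    (hx : q ∈ (chartAt (EuclideanSpace ℝ (Fin n)) x₀).source) (hV : extChartAt (𝓡 n) x₀ q ∈ V)
    {v u : TangentSpace (𝓡 n) q} (hv : v ∈ D q) :
    verticalLift q v u ∈ tangentVectors (𝓡 n).tangent (totalSet D) ↔ u ∈ D q := by
  rw [h.mem_tangentVectors_iff (ξ := verticalLift q v u) hx hV (chartDeriv_verticalLift hx _ v u),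
    h.mem_iff q hx hV u]
  refine (and_iff_right hv).trans ?_
  simp only [map_zero, zero_apply, zero_add]
  rfl

end Tangency

/-! ### Integrability implies involutivity -/

section Involutive
open Filter

variable {n : ℕ} {Q : Type u} [TopologicalSpace Q] [ChartedSpace (EuclideanSpace ℝ (Fin n)) Q]
  [IsManifold (𝓡 n) ∞ Q] {k : ℕ} {D : ∀ q : Q, Submodule ℝ (TangentSpace (𝓡 n) q)}
  {x₀ : Q} {V : Set (EuclideanSpace ℝ (Fin n))}
  {π : EuclideanSpace ℝ (Fin n) → EuclideanSpace ℝ (Fin n) →L[ℝ] EuclideanSpace ℝ (Fin n)}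
  {P : Type v} [TopologicalSpace P] [ChartedSpace (EuclideanSpace ℝ (Fin k)) P]
  [IsManifold (𝓡 k) ∞ P] {ι : P → Q}

theorem hasFDerivAt_chart_comp {p p' : P} (hι : MDifferentiableAt (𝓡 k) (𝓡 n) ι p')
    (hp : p' ∈ (chartAt (EuclideanSpace ℝ (Fin k)) p).source)
    (hx : ι p' ∈ (chartAt (EuclideanSpace ℝ (Fin n)) x₀).source) :
    HasFDerivAt (fun y => extChartAt (𝓡 n) x₀ (ι ((extChartAt (𝓡 k) p).symm y)))
      ((chartDeriv (𝓡 n) x₀ (ι p')).comp ((mfderiv (𝓡 k) (𝓡 n) ι p').comp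
        (mfderiv 𝓘(ℝ, EuclideanSpace ℝ (Fin k)) (𝓡 k) (extChartAt (𝓡 k) p).symm
          (extChartAt (𝓡 k) p p'))) : EuclideanSpace ℝ (Fin k) →L[ℝ] EuclideanSpace ℝ (Fin n))
      (extChartAt (𝓡 k) p p') := by
  have hM : IsManifold (𝓡 n) 1 Q := .of_le (n := ∞) (by norm_num)
  have hM : IsManifold (𝓡 k) 1 P := .of_le (n := ∞) (by norm_num)
  have hp' : p' ∈ (extChartAt (𝓡 k) p).source := by simpa using hp
  have hleft := (extChartAt (𝓡 k) p).left_inv hp'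
  have h1 : MDifferentiableAt 𝓘(ℝ, EuclideanSpace ℝ (Fin k)) (𝓡 k) (extChartAt (𝓡 k) p).symm
      (extChartAt (𝓡 k) p p') := by
    have := mdifferentiableWithinAt_extChartAt_symm (I := 𝓡 k) (x := p)
      ((extChartAt (𝓡 k) p).map_source hp')
    rwa [ModelWithCorners.range_eq_univ, mdifferentiableWithinAt_univ] at this
  have h2 : HasMFDerivAt (𝓡 k) (𝓡 n) ι ((extChartAt (𝓡 k) p).symm (extChartAt (𝓡 k) p p'))
      (mfderiv (𝓡 k) (𝓡 n) ι p') := by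
    rw [hleft]; exact hι.hasMFDerivAt
  have h3 : HasMFDerivAt (𝓡 n) 𝓘(ℝ, EuclideanSpace ℝ (Fin n)) (extChartAt (𝓡 n) x₀)
      (ι ((extChartAt (𝓡 k) p).symm (extChartAt (𝓡 k) p p'))) (chartDeriv (𝓡 n) x₀ (ι p')) := by
    rw [hleft]; exact (mdifferentiableAt_extChartAt hx).hasMFDerivAt
  have h4 := h2.comp (extChartAt (𝓡 k) p p') h1.hasMFDerivAt
  have h5 := HasMFDerivAt.comp (f := ι ∘ (extChartAt (𝓡 k) p).symm) (extChartAt (𝓡 k) p p') h3 h4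
  exact hasMFDerivAt_iff_hasFDerivAt.1 h5

theorem fderiv_chart_comp_self {p : P} (hι : MDifferentiableAt (𝓡 k) (𝓡 n) ι p)
    (hx : ι p ∈ (chartAt (EuclideanSpace ℝ (Fin n)) x₀).source) (c : TangentSpace (𝓡 k) p) :
    fderiv ℝ (fun y => extChartAt (𝓡 n) x₀ (ι ((extChartAt (𝓡 k) p).symm y)))
      (extChartAt (𝓡 k) p p) c = chartDeriv (𝓡 n) x₀ (ι p) (mfderiv (𝓡 k) (𝓡 n) ι p c) := by
  have hM : IsManifold (𝓡 k) 1 P := .of_le (n := ∞) (by norm_num)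
  rw [(hasFDerivAt_chart_comp hι (by simp) hx).fderiv]
  have h := mfderivWithin_range_extChartAt_symm (I := 𝓡 k) (x := p)
  rw [ModelWithCorners.range_eq_univ, mfderivWithin_univ] at h
  erw [h]
  rfl

theorem contDiffAt_chart_comp {p : P} (hι : ContMDiff (𝓡 k) (𝓡 n) ∞ ι)
    (hx : ι p ∈ (chartAt (EuclideanSpace ℝ (Fin n)) x₀).source) :
    ContDiffAt ℝ ∞ (fun y => extChartAt (𝓡 n) x₀ (ι ((extChartAt (𝓡 k) p).symm y)))
      (extChartAt (𝓡 k) p p) := by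
  refine contMDiffAt_iff_contDiffAt.1 ?_
  have h1 := (contMDiffOn_extChartAt_symm (I := 𝓡 k) (n := ∞) p).contMDiffAt
    (extChartAt_target_mem_nhds p)
  have h2 : ContMDiffAt (𝓡 n) 𝓘(ℝ, EuclideanSpace ℝ (Fin n)) ∞ (extChartAt (𝓡 n) x₀)
      (ι ((extChartAt (𝓡 k) p).symm (extChartAt (𝓡 k) p p))) := by
    rw [extChartAt_to_inv]; exact contMDiffAt_extChartAt' hx
  have h3 := ContMDiffAt.comp (f := (extChartAt (𝓡 k) p).symm) (extChartAt (𝓡 k) p p)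
    (hι.contMDiffAt (x := (extChartAt (𝓡 k) p).symm (extChartAt (𝓡 k) p p))) h1
  exact ContMDiffAt.comp (f := ι ∘ (extChartAt (𝓡 k) p).symm) (extChartAt (𝓡 k) p p) h2 h3

theorem IsLocalProjector.apply_fderiv_chart_comp (h : IsLocalProjector D x₀ V π)
    (hι : IsIntegralSubmanifold k D ι) {p p' : P}
    (hp : p' ∈ (chartAt (EuclideanSpace ℝ (Fin k)) p).source)
    (hx : ι p' ∈ (chartAt (EuclideanSpace ℝ (Fin n)) x₀).source)
    (hV : extChartAt (𝓡 n) x₀ (ι p') ∈ V) (c : EuclideanSpace ℝ (Fin k)) :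
    π (extChartAt (𝓡 n) x₀ (ι p'))
      (fderiv ℝ (fun y => extChartAt (𝓡 n) x₀ (ι ((extChartAt (𝓡 k) p).symm y)))
        (extChartAt (𝓡 k) p p') c) =
      fderiv ℝ (fun y => extChartAt (𝓡 n) x₀ (ι ((extChartAt (𝓡 k) p).symm y)))
        (extChartAt (𝓡 k) p p') c := by
  rw [(hasFDerivAt_chart_comp (hι.isImmersion.contMDiff.mdifferentiable (by simp) p') hp hx).fderiv]
  refine (h.mem_iff (ι p') hx hV _).1 ?_
  rw [← SetLike.mem_coe, ← hι.range_mfderiv p']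
  exact ⟨_, rfl⟩

/-- Differentiating `π(f) f'(d) = f'(d)` in the direction `c` gives `π'(f' c)(f' d) = (1 - π) f''(c,
d)`, whose right side is symmetric in `c` and `d`. -/
theorem fderiv_fderiv_eq_of_apply_fderiv {E F : Type*} [NormedAddCommGroup E] [NormedSpace ℝ E]
    [NormedAddCommGroup F] [NormedSpace ℝ F] {π : E → E →L[ℝ] E} {f : F → E} {y₀ : F}
    {π' : E →L[ℝ] E →L[ℝ] E} (hπ : HasFDerivAt π π' (f y₀)) (hf : ContDiffAt ℝ ∞ f y₀)
    (h : ∀ᶠ y in 𝓝 y₀, ∀ c, π (f y) (fderiv ℝ f y c) = fderiv ℝ f y c) (c d : F) :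
    π' (fderiv ℝ f y₀ c) (fderiv ℝ f y₀ d) = π' (fderiv ℝ f y₀ d) (fderiv ℝ f y₀ c) := by
  have hf1 : HasFDerivAt f (fderiv ℝ f y₀) y₀ := (hf.differentiableAt (by simp)).hasFDerivAt
  have hf2 : HasFDerivAt (fderiv ℝ f) (fderiv ℝ (fderiv ℝ f) y₀) y₀ :=
    ((hf.fderiv_right (m := ∞) le_rfl).differentiableAt (by simp)).hasFDerivAt
  have key : ∀ c d : F, π' (fderiv ℝ f y₀ c) (fderiv ℝ f y₀ d) +
      π (f y₀) (fderiv ℝ (fderiv ℝ f) y₀ c d) = fderiv ℝ (fderiv ℝ f) y₀ c d := fun c d => by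
    have h1 : HasDerivAt (fun s : ℝ => y₀ + s • c) c 0 := by
      simpa using ((hasDerivAt_id (0 : ℝ)).smul_const c).const_add y₀
    have h0 : y₀ + (0 : ℝ) • c = y₀ := by simp
    have h2 : HasDerivAt (fun s : ℝ => f (y₀ + s • c)) (fderiv ℝ f y₀ c) 0 :=
      HasFDerivAt.comp_hasDerivAt 0 (by rwa [h0]) h1
    have h3 : HasDerivAt (fun s : ℝ => fderiv ℝ f (y₀ + s • c)) (fderiv ℝ (fderiv ℝ f) y₀ c) 0 :=
      HasFDerivAt.comp_hasDerivAt 0 (by rwa [h0]) h1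
    have h4 : HasDerivAt (fun s : ℝ => fderiv ℝ f (y₀ + s • c) d)
        (fderiv ℝ (fderiv ℝ f) y₀ c d) 0 := by
      simpa using h3.clm_apply (hasDerivAt_const 0 d)
    have hπ0 : HasFDerivAt π π' (f (y₀ + (0 : ℝ) • c)) := by rwa [h0]
    have h5 := hasDerivWithinAt_clm_comp_apply (s := univ) hπ0 h2.hasDerivWithinAt
      h4.hasDerivWithinAt
    rw [hasDerivWithinAt_univ, h0] at h5
    have hc : ContinuousAt (fun s : ℝ => y₀ + s • c) 0 := h1.continuousAt
    have h6 : ∀ᶠ s in 𝓝 (0 : ℝ), ∀ c', π (f (y₀ + s • c)) (fderiv ℝ f (y₀ + s • c) c') =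
        fderiv ℝ f (y₀ + s • c) c' := hc.eventually (by simpa only [h0] using h)
    exact h5.unique (h4.congr_of_eventuallyEq (h6.mono fun s hs => hs d))
  have hsym := (hf.isSymmSndFDerivAt (by simpa using two_le_infty)).eq c d
  have k1 := key c d
  have k2 := key d c
  rw [hsym] at k1
  rw [← sub_eq_iff_eq_add.2 k2.symm, ← sub_eq_iff_eq_add.2 k1.symm]

/-- An integrable distribution is involutive. -/
theorem IsLocalProjector.fderiv_comm (h : IsLocalProjector D x₀ V π) (hint : IsIntegrable k D)
    {z a b : EuclideanSpace ℝ (Fin n)} (hz : z ∈ V) (ha : π z a = a) (hb : π z b = b) :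
    fderiv ℝ π z a b = fderiv ℝ π z b a := by
  have hM : IsManifold (𝓡 n) 1 Q := .of_le (n := ∞) (by norm_num)
  have hx : (extChartAt (𝓡 n) x₀).symm z ∈ (chartAt (EuclideanSpace ℝ (Fin n)) x₀).source := by
    have := (extChartAt (𝓡 n) x₀).map_target (h.subset hz)
    rwa [extChartAt_source] at this
  have hzz := (extChartAt (𝓡 n) x₀).right_inv (h.subset hz)
  -- An integral submanifold through the point with coordinates `z` has the whole of `D` as its
  -- tangent space there. So `a` and `b` are values of the derivative of a parametrization.
  obtain ⟨P, _, _, _, ι, hι, p, hp⟩ := hint ((extChartAt (𝓡 n) x₀).symm z)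
  rw [← hp] at hx hzz
  have hsm := hι.isImmersion.contMDiff
  have hrange : ∀ a, π z a = a → ∃ c : TangentSpace (𝓡 k) p,
      fderiv ℝ (fun y => extChartAt (𝓡 n) x₀ (ι ((extChartAt (𝓡 k) p).symm y)))
      (extChartAt (𝓡 k) p p) c = a := fun a ha => by
    obtain ⟨a', rfl⟩ := chartDeriv_surjective (I := 𝓡 n) hx a
    rw [← hzz, ← h.mem_iff _ hx (hzz ▸ hz), ← SetLike.mem_coe, ← hι.range_mfderiv p] at ha
    obtain ⟨c, rfl⟩ := ha
    exact ⟨c, fderiv_chart_comp_self (hsm.mdifferentiable (by simp) p) hx c⟩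
  obtain ⟨c, rfl⟩ := hrange a ha
  obtain ⟨d, rfl⟩ := hrange b hb
  have hfp : extChartAt (𝓡 n) x₀ (ι ((extChartAt (𝓡 k) p).symm (extChartAt (𝓡 k) p p))) = z := by
    rw [extChartAt_to_inv]; exact hzz
  refine fderiv_fderiv_eq_of_apply_fderiv (π := π) (by rw [hfp]; exact h.hasFDerivAt hz)
    (contDiffAt_chart_comp hsm hx) ?_ c d
  have hcs : ContinuousAt (fun y => ι ((extChartAt (𝓡 k) p).symm y)) (extChartAt (𝓡 k) p p) :=
    ContinuousAt.comp' hsm.continuous.continuousAt (continuousAt_extChartAt_symm p)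
  have e0 := extChartAt_to_inv (I := 𝓡 k) p
  have e1 := hcs.preimage_mem_nhds
    ((chartAt (EuclideanSpace ℝ (Fin n)) x₀).open_source.mem_nhds (by rw [e0]; exact hx))
  have e2 := (contDiffAt_chart_comp hsm hx).continuousAt.preimage_mem_nhds
    (h.isOpen.mem_nhds (by rw [hfp]; exact hz))
  filter_upwards [e1, e2, extChartAt_target_mem_nhds (I := 𝓡 k) p] with y hy1 hy2 hy3 c'
  have hy4 := (extChartAt (𝓡 k) p).map_target hy3
  rw [extChartAt_source] at hy4
  have := h.apply_fderiv_chart_comp hι hy4 hy1 hy2 c'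
  rwa [(extChartAt (𝓡 k) p).right_inv hy3] at this

end Involutive

/-! ### Vakonomic and nonholonomic fields are the fields with values in the distribution -/

section AdmissibleFields
open Filter

/-- Neighbourhoods are taken within `[a, b]` because `t₀` may be an end-point, where `[α, β]` is
one-sided. -/
theorem exists_Icc_subset_mem_nhdsWithin {a b t₀ : ℝ} (ht₀ : t₀ ∈ Icc a b) {S : Set ℝ}
    (hS : S ∈ 𝓝[Icc a b] t₀) : ∃ α β, t₀ ∈ Icc α β ∧ Icc α β ⊆ S ∧ Icc α β ⊆ Icc a b ∧
      Icc α β ∈ 𝓝[Icc a b] t₀ := by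
  obtain ⟨ε, hε, hεS⟩ := Metric.mem_nhdsWithin_iff.1 hS
  have hI : Icc (max a (t₀ - ε / 2)) (min b (t₀ + ε / 2)) = Icc a b ∩ Icc (t₀ - ε / 2) (t₀ + ε / 2) :=
    Icc_inter_Icc.symm
  refine ⟨max a (t₀ - ε / 2), min b (t₀ + ε / 2), ?_, ?_, ?_, ?_⟩
  · rw [hI]; exact ⟨ht₀, by linarith, by linarith⟩
  · rw [hI]
    rintro t ⟨h1, h2⟩
    refine hεS ⟨?_, h1⟩
    rw [Metric.mem_ball, Real.dist_eq, abs_lt]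
    constructor <;> linarith [h2.1, h2.2]
  · rw [hI]; exact inter_subset_left
  · rw [hI]
    exact inter_mem self_mem_nhdsWithin (mem_nhdsWithin_of_mem_nhds
      (Icc_mem_nhds (by linarith) (by linarith)))

variable {n : ℕ} {Q : Type u} [TopologicalSpace Q] [ChartedSpace (EuclideanSpace ℝ (Fin n)) Q]
  [IsManifold (𝓡 n) ∞ Q] {k : ℕ} {D : ∀ q : Q, Submodule ℝ (TangentSpace (𝓡 n) q)}
  {x₀ : Q} {V : Set (EuclideanSpace ℝ (Fin n))}
  {π : EuclideanSpace ℝ (Fin n) → EuclideanSpace ℝ (Fin n) →L[ℝ] EuclideanSpace ℝ (Fin n)}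
  {a b : ℝ} {γ : ℝ → Q} {w : ∀ t, TangentSpace (𝓡 n) (γ t)}

/-- With `u` the velocity of the path, `s(ẇ)` has foot `(z, u)` and components `(w, c)`, where `c`
is the derivative of the coordinates of `w`. Compared with the derivative of `π w = w` along the
path, `u` and `w` have exchanged their places in `π'`. -/
theorem IsVariationField.exists_hasDerivWithinAt (hab : a < b)
    (hγ : ContMDiffOn 𝓘(ℝ, ℝ) (𝓡 n) 2 γ (Icc a b)) (hw : IsVariationField a b γ w)
    (h : IsLocalProjector D x₀ V π) {t : ℝ} (ht : t ∈ Icc a b)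
    (hx : γ t ∈ (chartAt (EuclideanSpace ℝ (Fin n)) x₀).source) (hV : extChartAt (𝓡 n) x₀ (γ t) ∈ V)
    (hγD : mfderivWithin 𝓘(ℝ, ℝ) (𝓡 n) γ (Icc a b) t (1 : ℝ) ∈ D (γ t)) :
    ∃ c : EuclideanSpace ℝ (Fin n),
      HasDerivWithinAt (fun τ => chartDeriv (𝓡 n) x₀ (γ τ) (w τ)) c (Icc a b) t ∧
      (canonicalInvolution (velocity (𝓡 n).tangent (Icc a b)
        (fun s => (⟨γ s, w s⟩ : TangentBundle (𝓡 n) Q)) t) ∈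
          tangentVectors (𝓡 n).tangent (totalSet D) ↔
        fderiv ℝ π (extChartAt (𝓡 n) x₀ (γ t)) (chartDeriv (𝓡 n) x₀ (γ t) (w t))
          (chartDeriv (𝓡 n) x₀ (γ t) (mfderivWithin 𝓘(ℝ, ℝ) (𝓡 n) γ (Icc a b) t (1 : ℝ))) +
          π (extChartAt (𝓡 n) x₀ (γ t)) c = c) := by
  have hM : IsManifold (𝓡 n) 1 Q := .of_le (n := ∞) (by norm_num)
  have hσ := (hw.contMDiffOn t ht).mdifferentiableWithinAt (by simp)
  have hu := uniqueDiffOn_Icc hab t ht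
  set ξ := velocity (𝓡 n).tangent (Icc a b)
    (fun s => (⟨γ s, w s⟩ : TangentBundle (𝓡 n) Q)) t with hξ
  have hd := hasDerivWithinAt_chartDeriv (x₀ := x₀) 0 hσ ht hx
  set c := chartDeriv (𝓡 n).tangent (⟨x₀, 0⟩ : TangentBundle (𝓡 n) Q) ξ.1 ξ.2 with hc
  have hd1 : HasDerivWithinAt (fun τ => extChartAt (𝓡 n) x₀ (γ τ)) c.1 (Icc a b) t :=
    HasFDerivWithinAt.hasDerivWithinAt hd.hasFDerivWithinAt.fst |>.congr_deriv (by simp [hc]; rfl)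
  have hd2 : HasDerivWithinAt (fun τ => chartDeriv (𝓡 n) x₀ (γ τ) (w τ)) c.2 (Icc a b) t :=
    HasFDerivWithinAt.hasDerivWithinAt hd.hasFDerivWithinAt.snd |>.congr_deriv (by simp [hc]; rfl)
  have hd3 := hasDerivWithinAt_extChartAt_comp (x₀ := x₀)
    ((hγ t ht).mdifferentiableWithinAt (by simp)) hx
  have hc1 : c.1 = chartDeriv (𝓡 n) x₀ (γ t)
    (mfderivWithin 𝓘(ℝ, ℝ) (𝓡 n) γ (Icc a b) t (1 : ℝ)) := hu.eq_deriv _ hd1 hd3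
  refine ⟨c.2, hd2, ?_⟩
  obtain ⟨h1, h2⟩ := chartDeriv_canonicalInvolution (x₀ := x₀) 0 (ξ := ξ) hx
  have h3 := h.mem_tangentVectors_iff (ξ := canonicalInvolution ξ) hx hV h2
  have h4 : chartDeriv (𝓡 n) x₀ (canonicalInvolution ξ).1.1 (canonicalInvolution ξ).1.2 =
    chartDeriv (𝓡 n) x₀ (γ t) (mfderivWithin 𝓘(ℝ, ℝ) (𝓡 n) γ (Icc a b) t (1 : ℝ)) := h1.trans hc1
  refine (h3.trans (and_iff_right ?_)).trans (iff_of_eq ?_)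
  swap
  · exact congrArg (fun x : EuclideanSpace ℝ (Fin n) => fderiv ℝ π (extChartAt (𝓡 n) x₀ (γ t))
      (chartDeriv (𝓡 n) x₀ (γ t) (w t)) x + π (extChartAt (𝓡 n) x₀ (γ t)) c.2 = c.2) h4
  have hfst := velocity_section_fst (E := EuclideanSpace ℝ (Fin n)) hσ ht hu
  exact (congrArg (fun v : TangentSpace (𝓡 n) (γ t) => v ∈ D (γ t)) hfst).mpr hγD

/-- A field `v` along a curve `z` tangent to an involutive distribution stays in the distribution
if the variation of velocities that it induces is tangent to the distribution. -/
theorem forall_apply_eq_of_deriv {E : Type*} [NormedAddCommGroup E] [NormedSpace ℝ E]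
    {π : E → E →L[ℝ] E} {V : Set E} (hπ : ∀ x ∈ V, HasFDerivAt π (fderiv ℝ π x) x)
    (hidem : ∀ x ∈ V, ∀ v, π x (π x v) = π x v)
    (hcomm : ∀ x ∈ V, ∀ a b, π x a = a → π x b = b → fderiv ℝ π x a b = fderiv ℝ π x b a)
    {z u v c : ℝ → E} {α β C t₀ : ℝ} (hzV : ∀ t ∈ Icc α β, z t ∈ V)
    (hz : ∀ t ∈ Icc α β, HasDerivWithinAt z (u t) (Icc α β) t)
    (hv : ∀ t ∈ Icc α β, HasDerivWithinAt v (c t) (Icc α β) t)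
    (hu : ∀ t ∈ Icc α β, π (z t) (u t) = u t)
    (hc : ∀ t ∈ Icc α β, fderiv ℝ π (z t) (v t) (u t) + π (z t) (c t) = c t)
    (hC : ∀ t ∈ Icc α β, 2 * ‖fderiv ℝ π (z t)‖ * ‖u t‖ ≤ C) (ht₀ : t₀ ∈ Icc α β)
    (h₀ : π (z t₀) (v t₀) = v t₀) : ∀ t ∈ Icc α β, π (z t) (v t) = v t := by
  -- The defect of `v` from being in the range. The tangency hypothesis gives `y' = π'(v)u -
  -- π'(u)v`; the contribution of `π v` cancels by `hcomm`, and what is left is linear in `y`.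
  set y : ℝ → E := fun t => v t - π (z t) (v t) with hy
  set y' : ℝ → E := fun t =>
    fderiv ℝ π (z t) (y t) (u t) - fderiv ℝ π (z t) (u t) (y t) with hy'
  have hder : ∀ t ∈ Icc α β, HasDerivWithinAt y (y' t) (Icc α β) t := fun t ht => by
    have h1 := hasDerivWithinAt_clm_comp_apply (hπ _ (hzV t ht)) (hz t ht) (hv t ht)
    refine ((hv t ht).sub h1).congr_deriv ?_
    have h2 := hcomm _ (hzV t ht) _ _ (hidem _ (hzV t ht) (v t)) (hu t ht)
    have h3 : c t - π (z t) (c t) = fderiv ℝ π (z t) (v t) (u t) :=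
      sub_eq_iff_eq_add.2 (hc t ht).symm
    simp only [hy', hy, map_sub, sub_apply, h2]
    rw [add_comm, ← sub_sub, h3]
    abel
  have hbound : ∀ t ∈ Icc α β, ‖y' t‖ ≤ C * ‖y t‖ := fun t ht => by
    have h1 : ‖fderiv ℝ π (z t) (y t) (u t)‖ ≤ ‖fderiv ℝ π (z t)‖ * ‖y t‖ * ‖u t‖ :=
      ContinuousLinearMap.le_opNorm₂ _ _ _
    have h2 : ‖fderiv ℝ π (z t) (u t) (y t)‖ ≤ ‖fderiv ℝ π (z t)‖ * ‖u t‖ * ‖y t‖ :=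
      ContinuousLinearMap.le_opNorm₂ _ _ _
    calc ‖y' t‖ ≤ _ := norm_sub_le _ _
      _ ≤ 2 * ‖fderiv ℝ π (z t)‖ * ‖u t‖ * ‖y t‖ := by nlinarith
      _ ≤ _ := mul_le_mul_of_nonneg_right (hC t ht) (norm_nonneg _)
  intro t ht
  have := eqOn_zero_of_norm_deriv_le hder hbound ht₀ (by simp [hy, h₀]) t ht
  exact (sub_eq_zero.1 this).symm

theorem continuousWithinAt_chartDeriv_velocity (hab : a < b)
    (hγ : ContMDiffOn 𝓘(ℝ, ℝ) (𝓡 n) 2 γ (Icc a b)) {t₀ : ℝ} (ht₀ : t₀ ∈ Icc a b)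
    (hsrc : γ t₀ ∈ (chartAt (EuclideanSpace ℝ (Fin n)) x₀).source) :
    ContinuousWithinAt (fun t => chartDeriv (𝓡 n) x₀ (γ t)
      (mfderivWithin 𝓘(ℝ, ℝ) (𝓡 n) γ (Icc a b) t (1 : ℝ))) (Icc a b) t₀ := by
  have hM : IsManifold (𝓡 n) 1 Q := .of_le (n := ∞) (by norm_num)
  have h1 := (contMDiffOn_velocity hab hγ).continuousOn t₀ ht₀
  have h2 : ContinuousWithinAt (fun t => extChartAt (𝓡 n).tangent
      (⟨x₀, 0⟩ : TangentBundle (𝓡 n) Q) (velocity (𝓡 n) (Icc a b) γ t)) (Icc a b) t₀ :=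
    ContinuousAt.comp_continuousWithinAt (f := velocity (𝓡 n) (Icc a b) γ)
      (continuousAt_extChartAt' (by
        rw [extChartAt_source]; exact (TangentBundle.mem_chart_source_iff _ _).2 hsrc)) h1
  refine h2.snd.congr_of_eventuallyEq_of_mem ?_ ht₀
  filter_upwards [(hγ.continuousOn t₀ ht₀).preimage_mem_nhdsWithin
    ((chartAt (EuclideanSpace ℝ (Fin n)) x₀).open_source.mem_nhds hsrc)] with t ht
  exact (congrArg Prod.snd (extChartAt_tangent_apply (⟨x₀, 0⟩ : TangentBundle (𝓡 n) Q)
    (velocity (𝓡 n) (Icc a b) γ t) ht)).symm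

/-- The field vanishes at `a`, so it starts in `D`, and the local uniqueness statement
`forall_apply_eq_of_deriv` propagates membership along the connected interval. -/
theorem IsVariationField.forall_mem_of_canonicalInvolution (hD : IsSmoothSubbundle k D)
    (hint : IsIntegrable k D) (hab : a < b) (hγ : ContMDiffOn 𝓘(ℝ, ℝ) (𝓡 n) 2 γ (Icc a b))
    (hγD : ∀ t ∈ Icc a b, mfderivWithin 𝓘(ℝ, ℝ) (𝓡 n) γ (Icc a b) t (1 : ℝ) ∈ D (γ t))
    (hw : IsVariationField a b γ w)
    (hs : ∀ t ∈ Icc a b, canonicalInvolution (velocity (𝓡 n).tangent (Icc a b)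
        (fun s => (⟨γ s, w s⟩ : TangentBundle (𝓡 n) Q)) t) ∈
          tangentVectors (𝓡 n).tangent (totalSet D)) :
    ∀ t ∈ Icc a b, w t ∈ D (γ t) := by
  have hM : IsManifold (𝓡 n) 1 Q := .of_le (n := ∞) (by norm_num)
  intro t₁ ht₁
  -- The implication between times `s` and `t` is transitive, and near each time it holds in both
  -- directions because Grönwall works forwards and backwards.
  refine isPreconnected_Icc.induction₂' (s := Icc a b) (fun s t => w s ∈ D (γ s) → w t ∈ D (γ t))
    ?_ (fun _ _ _ _ _ _ h1 h2 h3 => h2 (h1 h3)) (left_mem_Icc.2 hab.le) ht₁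
    (by rw [hw.left]; exact zero_mem _)
  intro t₀ ht₀
  obtain ⟨V, π, h⟩ := hD.exists_isLocalProjector (γ t₀)
  set e := extChartAt (𝓡 n) (γ t₀) with he
  have hsrc : γ t₀ ∈ (chartAt (EuclideanSpace ℝ (Fin n)) (γ t₀)).source := mem_chart_source _ _
  have hγc := hγ.continuousOn t₀ ht₀
  have hzc : ContinuousWithinAt (fun t => e (γ t)) (Icc a b) t₀ :=
    (continuousAt_extChartAt (γ t₀)).comp_continuousWithinAt hγc
  set u : ℝ → EuclideanSpace ℝ (Fin n) := fun t => chartDeriv (𝓡 n) (γ t₀) (γ t)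
      (mfderivWithin 𝓘(ℝ, ℝ) (𝓡 n) γ (Icc a b) t (1 : ℝ)) with hu
  have huc : ContinuousWithinAt u (Icc a b) t₀ :=
    continuousWithinAt_chartDeriv_velocity hab hγ ht₀ hsrc
  have hπc : ContinuousWithinAt (fun t => ‖fderiv ℝ π (e (γ t))‖) (Icc a b) t₀ :=
    ContinuousAt.comp_continuousWithinAt (f := fun t => e (γ t)) (g := fun x => ‖fderiv ℝ π x‖)
      ((h.contDiffOn.contDiffAt (h.isOpen.mem_nhds h.mem)).continuousAt_fderiv (by simp)).norm hzc
  obtain ⟨C, hC⟩ : ∃ C : ℝ, ∀ᶠ t in 𝓝[Icc a b] t₀, 2 * ‖fderiv ℝ π (e (γ t))‖ * ‖u t‖ ≤ C := by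
    have := (continuousWithinAt_const (b := (2 : ℝ))).mul hπc |>.mul huc.norm
    exact ⟨_ + 1, (this.eventually_lt_const (lt_add_one _)).mono fun t ht => ht.le⟩
  have hsrc' := hγc.preimage_mem_nhdsWithin
    ((chartAt (EuclideanSpace ℝ (Fin n)) (γ t₀)).open_source.mem_nhds hsrc)
  have hV' := hzc.preimage_mem_nhdsWithin (h.isOpen.mem_nhds h.mem)
  obtain ⟨α, β, ht₀', hS, hsub, hnhds⟩ := exists_Icc_subset_mem_nhdsWithin ht₀
    (inter_mem hC (inter_mem hsrc' hV'))
  choose! c hc using fun t (ht : t ∈ Icc α β) =>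
    hw.exists_hasDerivWithinAt hab hγ h (hsub ht) (hS ht).2.1 (hS ht).2.2 (hγD t (hsub ht))
  have hiff : ∀ s ∈ Icc α β, ∀ t ∈ Icc α β, w s ∈ D (γ s) → w t ∈ D (γ t) := by
    intro s hsm t ht hws
    refine (h.mem_iff (γ t) (hS ht).2.1 (hS ht).2.2 (w t)).2 ?_
    exact forall_apply_eq_of_deriv (V := V) (z := fun t => e (γ t)) (u := u)
      (v := fun t => chartDeriv (𝓡 n) (γ t₀) (γ t) (w t)) (c := c) (t₀ := s)
      (fun x hx => h.hasFDerivAt hx) h.idem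
      (fun x hx a b => h.fderiv_comm hint hx) (fun t ht => (hS ht).2.2)
      (fun t ht => (hasDerivWithinAt_extChartAt_comp
        ((hγ t (hsub ht)).mdifferentiableWithinAt (by simp)) (hS ht).2.1).mono hsub)
      (fun t ht => (hc t ht).1.mono hsub)
      (fun t ht => (h.mem_iff (γ t) (hS ht).2.1 (hS ht).2.2 _).1 (hγD t (hsub ht)))
      (fun t ht => (hc t ht).2.1 (hs t (hsub ht))) (fun t ht => (hS ht).1) hsm
      ((h.mem_iff (γ s) (hS hsm).2.1 (hS hsm).2.2 (w s)).1 hws) t ht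
  filter_upwards [hnhds] with t ht
  exact ⟨hiff t₀ ht₀' t ht, hiff t ht t₀ ht₀'⟩

/-- Differentiating `π w = w` along the path gives `π'(u)w + π c = c`, with `u` the velocity and `c`
the derivative of `w`; involutivity replaces `π'(u)w` by `π'(w)u`. -/
theorem IsVariationField.canonicalInvolution_mem (hD : IsSmoothSubbundle k D)
    (hint : IsIntegrable k D) (hab : a < b) (hγ : ContMDiffOn 𝓘(ℝ, ℝ) (𝓡 n) 2 γ (Icc a b))
    (hγD : ∀ t ∈ Icc a b, mfderivWithin 𝓘(ℝ, ℝ) (𝓡 n) γ (Icc a b) t (1 : ℝ) ∈ D (γ t))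
    (hw : IsVariationField a b γ w) (hwD : ∀ t ∈ Icc a b, w t ∈ D (γ t)) {t₀ : ℝ}
    (ht₀ : t₀ ∈ Icc a b) : canonicalInvolution (velocity (𝓡 n).tangent (Icc a b)
        (fun s => (⟨γ s, w s⟩ : TangentBundle (𝓡 n) Q)) t₀) ∈
          tangentVectors (𝓡 n).tangent (totalSet D) := by
  have hM : IsManifold (𝓡 n) 1 Q := .of_le (n := ∞) (by norm_num)
  obtain ⟨V, π, h⟩ := hD.exists_isLocalProjector (γ t₀)
  have hsrc : γ t₀ ∈ (chartAt (EuclideanSpace ℝ (Fin n)) (γ t₀)).source := mem_chart_source _ _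
  have hγc := hγ.continuousOn t₀ ht₀
  have hz := hasDerivWithinAt_extChartAt_comp ((hγ t₀ ht₀).mdifferentiableWithinAt (by simp)) hsrc
  obtain ⟨c, hc, hiff⟩ := hw.exists_hasDerivWithinAt hab hγ h ht₀ hsrc h.mem (hγD t₀ ht₀)
  have hπ := hasDerivWithinAt_clm_comp_apply (h.hasFDerivAt h.mem) hz hc
  have heq : (fun t => π (extChartAt (𝓡 n) (γ t₀) (γ t)) (chartDeriv (𝓡 n) (γ t₀) (γ t) (w t)))
      =ᶠ[𝓝[Icc a b] t₀] fun t => chartDeriv (𝓡 n) (γ t₀) (γ t) (w t) := by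
    filter_upwards [hγc.preimage_mem_nhdsWithin
      ((chartAt (EuclideanSpace ℝ (Fin n)) (γ t₀)).open_source.mem_nhds hsrc),
      hz.continuousWithinAt.preimage_mem_nhdsWithin (h.isOpen.mem_nhds h.mem),
      self_mem_nhdsWithin] with t h1 h2 h3
    exact (h.mem_iff (γ t) h1 h2 (w t)).1 (hwD t h3)
  have h1 := (uniqueDiffOn_Icc hab t₀ ht₀).eq_deriv _ hπ (hc.congr_of_eventuallyEq_of_mem heq ht₀)
  refine hiff.2 (Eq.trans ?_ h1)
  congr 1
  exact h.fderiv_comm hint h.mem ((h.mem_iff (γ t₀) hsrc h.mem _).1 (hwD t₀ ht₀))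
    ((h.mem_iff (γ t₀) hsrc h.mem _).1 (hγD t₀ ht₀))

theorem mem_vakonomic_W_iff (L : TangentBundle (𝓡 n) Q → ℝ) (hD : IsSmoothSubbundle k D)
    (hint : IsIntegrable k D) (hab : a < b) (hγ : ContMDiffOn 𝓘(ℝ, ℝ) (𝓡 n) 2 γ (Icc a b))
    (hγD : ∀ t ∈ Icc a b, velocity (𝓡 n) (Icc a b) γ t ∈ totalSet D) :
    w ∈ (vakonomic L (totalSet D)).W a b γ ↔
      IsVariationField a b γ w ∧ ∀ t ∈ Icc a b, w t ∈ D (γ t) :=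
  ⟨fun h => ⟨h.1, h.1.forall_mem_of_canonicalInvolution hD hint hab hγ hγD h.2⟩,
    fun h => ⟨h.1, fun _ ht => h.1.canonicalInvolution_mem hD hint hab hγ hγD h.2 ht⟩⟩

theorem mem_nonholonomic_W_iff (L : TangentBundle (𝓡 n) Q → ℝ) (hD : IsSmoothSubbundle k D)
    (hγD : ∀ t ∈ Icc a b, velocity (𝓡 n) (Icc a b) γ t ∈ totalSet D) :
    w ∈ (nonholonomic L (totalSet D)).W a b γ ↔
      IsVariationField a b γ w ∧ ∀ t ∈ Icc a b, w t ∈ D (γ t) := by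
  refine and_congr_right fun _ => forall₂_congr fun t ht => ?_
  obtain ⟨V, π, h⟩ := hD.exists_isLocalProjector (γ t)
  exact h.verticalLift_mem_iff (mem_chart_source _ _) h.mem (hγD t ht)

end AdmissibleFields

/-! ### Slices of immersions, and paths tangent to the distribution -/

section Slices
open Filter

variable {n : ℕ} {Q : Type u} [TopologicalSpace Q] [ChartedSpace (EuclideanSpace ℝ (Fin n)) Q]
  {k : ℕ} {P : Type v} [TopologicalSpace P] [ChartedSpace (EuclideanSpace ℝ (Fin k)) P]

/-- A slice of an immersion `ι : P → Q`: a chart `φ` of `P` on the source of which `ι` is the linear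
inclusion with respect to `φ` and a chart `ψ` of `Q`, with a local left inverse `r` of `ι`. -/
structure Slice (n k : ℕ) {Q : Type u} [TopologicalSpace Q]
    [ChartedSpace (EuclideanSpace ℝ (Fin n)) Q] {P : Type v} [TopologicalSpace P]
    [ChartedSpace (EuclideanSpace ℝ (Fin k)) P] (ι : P → Q) where
  φ : OpenPartialHomeomorph P (EuclideanSpace ℝ (Fin k))
  ψ : OpenPartialHomeomorph Q (EuclideanSpace ℝ (Fin n))
  N : Set Q
  r : Q → P
  φ_mem : φ ∈ IsManifold.maximalAtlas (𝓡 k) ∞ P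
  ψ_mem : ψ ∈ IsManifold.maximalAtlas (𝓡 n) ∞ Q
  isOpen : IsOpen N
  mapsTo_r : MapsTo r N φ.source
  mapsTo_ι : MapsTo ι φ.source N
  left_inv : ∀ p ∈ φ.source, r (ι p) = p
  contMDiffOn_r : ContMDiffOn (𝓡 n) (𝓡 k) ∞ r N
  mapsTo_ψ : MapsTo ι φ.source ψ.source
  exists_equiv : ∃ (F : Type) (_ : NormedAddCommGroup F) (_ : NormedSpace ℝ F)
    (equiv : (EuclideanSpace ℝ (Fin k) × F) ≃L[ℝ] EuclideanSpace ℝ (Fin n)),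
    ∀ p ∈ φ.source, ψ (ι p) = equiv (φ p, 0)

/-- In suitable charts an immersion is `x ↦ f (x, 0)` with `f` a linear isomorphism. The left
inverse reads a point of `Q` in the second chart, takes the first component of `f⁻¹`, and returns to
`P` by the first chart. -/
theorem exists_slice {ι : P → Q} (hι : Manifold.IsImmersion (𝓡 k) (𝓡 n) ∞ ι) (p : P) :
    ∃ B : Slice n k ι, p ∈ B.φ.source := by
  have h := hι.isImmersionAt p
  set φ := h.domChart
  set ψ := h.codChart
  set f := h.equiv with hf
  have hwr : ∀ p' ∈ φ.source, ψ (ι p') = f (φ p', 0) := fun p' hp' => by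
    have hmem : φ p' ∈ (h.domChart.extend (𝓡 k)).target := by
      simpa using φ.map_source hp'
    have h1 := h.writtenInCharts hmem
    have h2 : (h.domChart.extend (𝓡 k)).symm (φ p') = p' := φ.left_inv hp'
    simp only [Function.comp_apply, h2] at h1
    exact h1
  let g : Q → EuclideanSpace ℝ (Fin k) := fun x => (f.symm (ψ x)).1
  have hg : ContMDiffOn (𝓡 n) (𝓡 k) ∞ g ψ.source := by
    have h1 : ContDiff ℝ ∞ (fun z => (f.symm z).1) := contDiff_fst.comp f.symm.contDiff
    exact h1.contMDiff.comp_contMDiffOn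
      (contMDiffOn_of_mem_maximalAtlas h.codChart_mem_maximalAtlas)
  have hgι : ∀ p' ∈ φ.source, g (ι p') = φ p' := fun p' hp' => by
    simp only [g, hwr p' hp', ContinuousLinearEquiv.symm_apply_apply]
  refine ⟨⟨φ, ψ, ψ.source ∩ g ⁻¹' φ.target, fun x => φ.symm (g x), h.domChart_mem_maximalAtlas,
    h.codChart_mem_maximalAtlas, hg.continuousOn.isOpen_inter_preimage ψ.open_source φ.open_target,
    fun x hx => φ.map_target hx.2, fun p' hp' => ⟨h.source_subset_preimage_source hp', ?_⟩,
    fun p' hp' => ?_, ?_, h.source_subset_preimage_source,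
    ⟨h.complement, inferInstance, inferInstance, f, hwr⟩⟩, h.mem_domChart_source⟩
  · simpa only [mem_preimage, hgι p' hp'] using φ.map_source hp'
  · simp only [hgι p' hp', φ.left_inv hp']
  · exact (contMDiffOn_symm_of_mem_maximalAtlas h.domChart_mem_maximalAtlas).comp
      (hg.mono inter_subset_left) fun x hx => hx.2

/-- Cutting `φ` down to the preimage of a ball makes its target convex, so that points of the slice
can be joined by segments in the chart. The set `N` shrinks to where `r` lands in the new domain,
while `r` itself is kept. -/
theorem Slice.exists_restrict {ι : P → Q} (hι : Continuous ι) (B : Slice n k ι) {p : P} (hp : p ∈ B.φ.source)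
    {N₁ : Set Q} (hN₁ : IsOpen N₁) (hpN : ι p ∈ N₁) :
    ∃ B' : Slice n k ι, p ∈ B'.φ.source ∧ B'.N ⊆ N₁ ∩ B.N ∧ B'.r = B.r ∧
      B'.φ.source ⊆ B.φ.source ∧ Convex ℝ B'.φ.target := by
  have hopen : IsOpen (B.φ.target ∩ B.φ.symm ⁻¹' (ι ⁻¹' N₁)) :=
    B.φ.isOpen_inter_preimage_symm (hN₁.preimage hι)
  obtain ⟨ε, hε, hball⟩ := Metric.isOpen_iff.1 hopen (B.φ p)
    ⟨B.φ.map_source hp, by simpa only [mem_preimage, B.φ.left_inv hp] using hpN⟩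
  set b := Metric.ball (B.φ p) ε
  set s := B.φ.source ∩ B.φ ⁻¹' b with hs_def
  have hs : IsOpen s := B.φ.isOpen_inter_preimage Metric.isOpen_ball
  have hsrc : (B.φ.restr s).source = s := by
    rw [B.φ.restr_source' s hs, hs_def, ← inter_assoc, inter_self]
  have hsub : s ⊆ B.φ.source := inter_subset_left
  have hsN : ∀ p' ∈ s, ι p' ∈ N₁ := fun p' hp' => by
    have := (hball hp'.2).2
    rwa [mem_preimage, mem_preimage, B.φ.left_inv hp'.1] at this
  have htgt : (B.φ.restr s).target = b := by
    rw [← (B.φ.restr s).image_source_eq_target, hsrc]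
    ext y
    constructor
    · rintro ⟨x, hx, rfl⟩; exact hx.2
    · intro hy
      have hy1 := (hball hy).1
      exact ⟨B.φ.symm y, ⟨B.φ.map_target hy1, by simpa only [mem_preimage, B.φ.right_inv hy1]⟩,
        B.φ.right_inv hy1⟩
  refine ⟨⟨B.φ.restr s, B.ψ, N₁ ∩ (B.N ∩ B.r ⁻¹' s), B.r, restr_mem_maximalAtlas _ B.φ_mem hs,
    B.ψ_mem, hN₁.inter (B.contMDiffOn_r.continuousOn.isOpen_inter_preimage B.isOpen hs),
    fun x hx => by rw [hsrc]; exact hx.2.2, ?_, ?_, B.contMDiffOn_r.mono fun x hx => hx.2.1, ?_, ?_⟩,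
    ?_, fun x hx => ⟨hx.1, hx.2.1⟩, rfl, ?_, ?_⟩
  · rw [hsrc]
    exact fun p' hp' => ⟨hsN p' hp', B.mapsTo_ι (hsub hp'), by
      rwa [mem_preimage, B.left_inv p' (hsub hp')]⟩
  · rw [hsrc]; exact fun p' hp' => B.left_inv p' (hsub hp')
  · rw [hsrc]; exact B.mapsTo_ψ.mono hsub Subset.rfl
  · rw [hsrc]
    obtain ⟨F, i1, i2, f, hf⟩ := B.exists_equiv
    exact ⟨F, i1, i2, f, fun p' hp' => hf p' (hsub hp')⟩
  · rw [hsrc]; exact ⟨hp, Metric.mem_ball_self hε⟩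
  · rw [hsrc]; exact hsub
  · rw [htgt]; exact convex_ball _ _

variable [IsManifold (𝓡 n) ∞ Q] [IsManifold (𝓡 k) ∞ P] {D : ∀ q : Q, Submodule ℝ (TangentSpace (𝓡 n) q)}
  {x₀ : Q} {V : Set (EuclideanSpace ℝ (Fin n))}
  {π : EuclideanSpace ℝ (Fin n) → EuclideanSpace ℝ (Fin n) →L[ℝ] EuclideanSpace ℝ (Fin n)} {ι : P → Q}

theorem IsLocalProjector.exists_fderiv_chart_comp_eq (h : IsLocalProjector D x₀ V π)
    (hι : IsIntegralSubmanifold k D ι) {p : P}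
    (hx : ι p ∈ (chartAt (EuclideanSpace ℝ (Fin n)) x₀).source)
    (hV : extChartAt (𝓡 n) x₀ (ι p) ∈ V) {a : EuclideanSpace ℝ (Fin n)}
    (ha : π (extChartAt (𝓡 n) x₀ (ι p)) a = a) : ∃ c : EuclideanSpace ℝ (Fin k),
      fderiv ℝ (fun y => extChartAt (𝓡 n) x₀ (ι ((extChartAt (𝓡 k) p).symm y)))
      (extChartAt (𝓡 k) p p) c = a := by
  have hM : IsManifold (𝓡 n) 1 Q := .of_le (n := ∞) (by norm_num)
  obtain ⟨a', rfl⟩ := chartDeriv_surjective (I := 𝓡 n) hx a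
  rw [← h.mem_iff _ hx hV, ← SetLike.mem_coe, ← hι.range_mfderiv p] at ha
  obtain ⟨c, rfl⟩ := ha
  exact ⟨c, fderiv_chart_comp_self (hι.isImmersion.contMDiff.mdifferentiable (by simp) p) hx c⟩

/-- The retraction `ι ∘ r` onto a slice of an integral submanifold, in a chart. Its derivative at
the points of the slice is the identity on the distribution. -/
theorem Slice.fderiv_retraction_apply (hι : IsIntegralSubmanifold k D ι) (B : Slice n k ι)
    (h : IsLocalProjector D x₀ V π) {p : P} (hp : p ∈ B.φ.source)
    (hx : ι p ∈ (chartAt (EuclideanSpace ℝ (Fin n)) x₀).source)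
    (hV : extChartAt (𝓡 n) x₀ (ι p) ∈ V) {R : EuclideanSpace ℝ (Fin n) → EuclideanSpace ℝ (Fin n)}
    (hR : R = fun z => extChartAt (𝓡 n) x₀ (ι (B.r ((extChartAt (𝓡 n) x₀).symm z))))
    (hRd : DifferentiableAt ℝ R (extChartAt (𝓡 n) x₀ (ι p))) {v : EuclideanSpace ℝ (Fin n)}
    (hv : π (extChartAt (𝓡 n) x₀ (ι p)) v = v) :
    fderiv ℝ R (extChartAt (𝓡 n) x₀ (ι p)) v = v := by
  obtain ⟨c, rfl⟩ := h.exists_fderiv_chart_comp_eq hι hx hV hv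
  have hsm := hι.isImmersion.contMDiff
  set J := fun y => extChartAt (𝓡 n) x₀ (ι ((extChartAt (𝓡 k) p).symm y)) with hJ
  set y₀ := extChartAt (𝓡 k) p p with hy₀
  have hJy : J y₀ = extChartAt (𝓡 n) x₀ (ι p) := by simp only [hJ, hy₀, extChartAt_to_inv]
  have hJd : HasFDerivAt J (fderiv ℝ J y₀) y₀ :=
    ((contDiffAt_chart_comp hsm hx).differentiableAt (by simp)).hasFDerivAt
  have h1 : HasFDerivAt (R ∘ J) ((fderiv ℝ R (extChartAt (𝓡 n) x₀ (ι p))).comp (fderiv ℝ J y₀)) y₀ := by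
    refine HasFDerivAt.comp y₀ ?_ hJd
    rw [hJy]; exact hRd.hasFDerivAt
  -- The retraction fixes the slice pointwise, hence its derivative fixes the derivatives of the
  -- parametrization `J`, and these fill `D`.
  have hev : R ∘ J =ᶠ[𝓝 y₀] J := by
    have c1 : ContinuousAt (extChartAt (𝓡 k) p).symm y₀ := continuousAt_extChartAt_symm p
    have c2 : ContinuousAt (fun y => ι ((extChartAt (𝓡 k) p).symm y)) y₀ :=
      ContinuousAt.comp' hsm.continuous.continuousAt c1
    have e0 := extChartAt_to_inv (I := 𝓡 k) p
    filter_upwards [c1.preimage_mem_nhds (B.φ.open_source.mem_nhds (by rw [e0]; exact hp)),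
      c2.preimage_mem_nhds ((chartAt (EuclideanSpace ℝ (Fin n)) x₀).open_source.mem_nhds
        (by rw [e0]; exact hx))] with y hy1 hy2
    have hy3 : ι ((extChartAt (𝓡 k) p).symm y) ∈ (extChartAt (𝓡 n) x₀).source := by
      rw [extChartAt_source]; exact hy2
    simp only [Function.comp_apply, hR, hJ, (extChartAt (𝓡 n) x₀).left_inv hy3, B.left_inv _ hy1]
  have h2 := h1.unique (hJd.congr_of_eventuallyEq hev)
  exact congrArg (fun f : EuclideanSpace ℝ (Fin k) →L[ℝ] EuclideanSpace ℝ (Fin n) => f c) h2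

theorem norm_bound_velocity {a b α β : ℝ} {γ : ℝ → Q} (hab : a < b)
    (hγ : ContMDiffOn 𝓘(ℝ, ℝ) (𝓡 n) 2 γ (Icc a b)) (hsub : Icc α β ⊆ Icc a b)
    (hsrc : ∀ t ∈ Icc α β, γ t ∈ (chartAt (EuclideanSpace ℝ (Fin n)) x₀).source) :
    ∃ C, ∀ t ∈ Icc α β, ‖(chartDeriv (𝓡 n) x₀ (γ t)
      (mfderivWithin 𝓘(ℝ, ℝ) (𝓡 n) γ (Icc a b) t (1 : ℝ)) : EuclideanSpace ℝ (Fin n))‖ ≤ C :=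
  isCompact_Icc.exists_bound_of_continuousOn fun t ht =>
    (continuousWithinAt_chartDeriv_velocity hab hγ (hsub ht) (hsrc t ht)).mono hsub

/-- Near a point of a slice of an integral submanifold, the paths tangent to the distribution that
meet the slice stay in it. -/
theorem Slice.exists_isOpen_path (hι : IsIntegralSubmanifold k D ι) (hD : IsSmoothSubbundle k D)
    (B : Slice n k ι) {p : P} (hp : p ∈ B.φ.source) : ∃ N₁ : Set Q, IsOpen N₁ ∧ ι p ∈ N₁ ∧
      ∀ (a b α β : ℝ) (γ : ℝ → Q) (t₀ : ℝ), a < b → ContMDiffOn 𝓘(ℝ, ℝ) (𝓡 n) 2 γ (Icc a b) →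
        Icc α β ⊆ Icc a b →
        (∀ t ∈ Icc α β, mfderivWithin 𝓘(ℝ, ℝ) (𝓡 n) γ (Icc a b) t (1 : ℝ) ∈ D (γ t)) →
        MapsTo γ (Icc α β) (N₁ ∩ B.N) → t₀ ∈ Icc α β → ι (B.r (γ t₀)) = γ t₀ →
        ∀ t ∈ Icc α β, ι (B.r (γ t)) = γ t := by
  have hM : IsManifold (𝓡 n) 1 Q := .of_le (n := ∞) (by norm_num)
  have hsm := hι.isImmersion.contMDiff
  set x₀ := ι p with hx₀
  obtain ⟨V, π, h⟩ := hD.exists_isLocalProjector x₀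
  set e := extChartAt (𝓡 n) x₀ with he
  have hιr : ContMDiffOn (𝓡 n) (𝓡 n) ∞ (fun x => ι (B.r x)) B.N :=
    hsm.comp_contMDiffOn B.contMDiffOn_r
  set S : Set Q := B.N ∩ (fun x => ι (B.r x)) ⁻¹' (chartAt (EuclideanSpace ℝ (Fin n)) x₀).source with hS
  have hSo : IsOpen S := hιr.continuousOn.isOpen_inter_preimage B.isOpen
    (chartAt (EuclideanSpace ℝ (Fin n)) x₀).open_source
  have hpS : x₀ ∈ S := ⟨B.mapsTo_ι hp, by
    simp only [mem_preimage, hx₀, B.left_inv p hp, mem_chart_source]⟩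
  set W₀ : Set (EuclideanSpace ℝ (Fin n)) := V ∩ (e.target ∩ e.symm ⁻¹' S) with hW₀
  have hW₀o : IsOpen W₀ := h.isOpen.inter ((continuousOn_extChartAt_symm x₀).isOpen_inter_preimage
    (isOpen_extChartAt_target x₀) hSo)
  set z₀ := e x₀ with hz₀
  have hz₀W : z₀ ∈ W₀ := ⟨h.mem, mem_extChartAt_target x₀, by
    simpa only [mem_preimage, hz₀, he, extChartAt_to_inv] using hpS⟩
  set R : EuclideanSpace ℝ (Fin n) → EuclideanSpace ℝ (Fin n) :=
    fun z => e (ι (B.r (e.symm z))) with hR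
  have hRs : ContDiffOn ℝ ∞ R W₀ := by
    refine contMDiffOn_iff_contDiffOn.1 ?_
    exact (contMDiffOn_extChartAt (n := ∞) (I := 𝓡 n) (x := x₀)).comp
      ((hιr.mono inter_subset_left).comp ((contMDiffOn_extChartAt_symm x₀).mono
        fun z hz => hz.2.1) fun z hz => hz.2.2) fun z hz => hz.2.2.2
  have hRd : ∀ z ∈ W₀, DifferentiableAt ℝ R z := fun z hz =>
    (hRs.contDiffAt (hW₀o.mem_nhds hz)).differentiableAt (by simp)
  -- Along a path tangent to `D` with velocity `u`, the gap `y = z - R z` has derivative `(1 -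
  -- R'(z)) u = G(z) u`. Since `G` vanishes on the slice, `‖G(z)‖ = ‖G(z) - G(R z)‖ ≤ K ‖y‖`, which
  -- is the estimate that Grönwall needs.
  set G : EuclideanSpace ℝ (Fin n) → EuclideanSpace ℝ (Fin n) →L[ℝ] EuclideanSpace ℝ (Fin n) :=
    fun z => (1 - fderiv ℝ R z).comp (π z) with hG
  have hGs : ContDiffAt ℝ 1 G z₀ := by
    have h1 := (hRs.contDiffAt (hW₀o.mem_nhds hz₀W)).fderiv_right (m := 1) (by
      rw [one_add_one_eq_two]; exact two_le_infty)
    exact (contDiffAt_const.sub h1).clm_comp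
      ((h.contDiffOn.contDiffAt (h.isOpen.mem_nhds h.mem)).of_le (by norm_num))
  obtain ⟨K, T, hT, hLip⟩ := hGs.exists_lipschitzOnWith
  have hRz₀ : R z₀ = z₀ := by
    simp only [hR, hz₀, he, extChartAt_to_inv]
    rw [hx₀, B.left_inv p hp]
  have hWT : W₀ ∩ T ∈ 𝓝 z₀ := inter_mem (hW₀o.mem_nhds hz₀W) hT
  -- The neighbourhood is small enough for `R z` as well as `z` to lie where `G` is Lipschitz. It
  -- does not depend on the path; only the bound on the velocity will.
  have hWR : W₀ ∩ T ∩ R ⁻¹' (W₀ ∩ T) ∈ 𝓝 z₀ :=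
    inter_mem hWT ((hRd z₀ hz₀W).continuousAt.preimage_mem_nhds (by rwa [hRz₀]))
  obtain ⟨W, hWsub, hWo, hzW⟩ := mem_nhds_iff.1 hWR
  refine ⟨e.source ∩ e ⁻¹' W, (continuousOn_extChartAt x₀).isOpen_inter_preimage
    (isOpen_extChartAt_source x₀) hWo, ⟨mem_extChartAt_source x₀, hzW⟩, ?_⟩
  intro a b α β γ t₀ hab hγ hsub hγD hmaps ht₀ h₀
  have hsrc : ∀ t ∈ Icc α β, γ t ∈ (chartAt (EuclideanSpace ℝ (Fin n)) x₀).source := fun t ht => by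
    have := (hmaps ht).1.1
    rwa [he, extChartAt_source] at this
  obtain ⟨C, hC⟩ := norm_bound_velocity hab hγ hsub hsrc
  have hRγ : ∀ t ∈ Icc α β, R (e (γ t)) = e (ι (B.r (γ t))) := fun t ht => by
    simp only [hR, e.left_inv (hmaps ht).1.1]
  set u : ℝ → EuclideanSpace ℝ (Fin n) := fun t => chartDeriv (𝓡 n) x₀ (γ t)
      (mfderivWithin 𝓘(ℝ, ℝ) (𝓡 n) γ (Icc a b) t (1 : ℝ)) with hu
  set y : ℝ → EuclideanSpace ℝ (Fin n) := fun t => e (γ t) - R (e (γ t)) with hy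
  have hWγ : ∀ t ∈ Icc α β, e (γ t) ∈ W := fun t ht => (hmaps ht).1.2
  have hπu : ∀ t ∈ Icc α β, π (e (γ t)) (u t) = u t := fun t ht =>
    (h.mem_iff (γ t) (hsrc t ht) (hWsub (hWγ t ht)).1.1.1 _).1 (hγD t ht)
  have hder : ∀ t ∈ Icc α β, HasDerivWithinAt y (G (e (γ t)) (u t)) (Icc α β) t := fun t ht => by
    have h1 := (hasDerivWithinAt_extChartAt_comp (x₀ := x₀)
      ((hγ t (hsub ht)).mdifferentiableWithinAt (by simp)) (hsrc t ht)).mono hsub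
    have h2 := (hRd _ (hWsub (hWγ t ht)).1.1).hasFDerivAt.comp_hasDerivWithinAt t h1
    refine (h1.sub h2).congr_deriv ?_
    have h3 := hπu t ht
    simp only [hG, ContinuousLinearMap.comp_apply, h3, sub_apply]
    rfl
  have hGR : ∀ t ∈ Icc α β, ∀ v, G (R (e (γ t))) v = 0 := fun t ht v => by
    have hW' := (hWsub (hWγ t ht)).2.1
    have hp' : B.r (γ t) ∈ B.φ.source := B.mapsTo_r (hmaps ht).2
    have hιs : ι (B.r (γ t)) ∈ (chartAt (EuclideanSpace ℝ (Fin n)) x₀).source := by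
      have := (hWsub (hWγ t ht)).1.1.2.2.2
      simpa only [mem_preimage, e.left_inv (hmaps ht).1.1] using this
    rw [hRγ t ht] at hW' ⊢
    have h4 := B.fderiv_retraction_apply hι h hp' hιs hW'.1 hR (hRd _ hW') (h.idem _ hW'.1 v)
    simp only [hG, ContinuousLinearMap.comp_apply, sub_apply]
    exact sub_eq_zero.2 h4.symm
  have hbound : ∀ t ∈ Icc α β, ‖G (e (γ t)) (u t)‖ ≤ K * C * ‖y t‖ := fun t ht => by
    have h5 : G (e (γ t)) (u t) = (G (e (γ t)) - G (R (e (γ t)))) (u t) := by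
      rw [sub_apply, hGR t ht, sub_zero]
    rw [h5]
    have h6 := hLip.norm_sub_le (hWsub (hWγ t ht)).1.2 (hWsub (hWγ t ht)).2.2
    calc _ ≤ ‖G (e (γ t)) - G (R (e (γ t)))‖ * ‖u t‖ := ContinuousLinearMap.le_opNorm _ _
      _ ≤ (K * ‖y t‖) * C := mul_le_mul h6 (hC t ht) (norm_nonneg _) (by positivity)
      _ = K * C * ‖y t‖ := by ring
  intro t ht
  have hyt := eqOn_zero_of_norm_deriv_le hder hbound ht₀ (by
    simp only [hy, hRγ t₀ ht₀, h₀, sub_self]) t ht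
  simp only [hy, hRγ t ht, sub_eq_zero] at hyt
  refine e.injOn ?_ (hmaps ht).1.1 hyt.symm
  have := (hWsub (hWγ t ht)).1.1.2.2.2
  rw [he, extChartAt_source]
  simpa only [mem_preimage, e.left_inv (hmaps ht).1.1] using this

end Slices

/-! ### Plaques, and paths with values in an integral submanifold -/

section Plaques
open Filter

section Velocity

variable {F : Type*} [NormedAddCommGroup F] [NormedSpace ℝ F] {H : Type*} [TopologicalSpace H]
  {J : ModelWithCorners ℝ F H} {N : Type*} [TopologicalSpace N] [ChartedSpace H N]
  {F' : Type*} [NormedAddCommGroup F'] [NormedSpace ℝ F'] {H' : Type*} [TopologicalSpace H']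
  {J' : ModelWithCorners ℝ F' H'} {N' : Type*} [TopologicalSpace N'] [ChartedSpace H' N']

theorem velocity_congr {s : Set ℝ} {t : ℝ} {c₁ c : ℝ → N} (h : c₁ =ᶠ[𝓝[s] t] c)
    (ht : c₁ t = c t) : velocity J s c₁ t = velocity J s c t := by
  have h1 := h.mfderivWithin_eq (I := 𝓘(ℝ, ℝ)) (I' := J) ht
  unfold velocity
  rw [h1]
  exact congrArg (fun q => (⟨q, (mfderivWithin 𝓘(ℝ, ℝ) J c s t (1 : ℝ) : F)⟩ : TangentBundle J N)) ht

theorem velocity_comp {s : Set ℝ} {t : ℝ} {c : ℝ → N} {f : N → N'}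
    (hf : MDifferentiableAt J J' f (c t)) (hc : MDifferentiableWithinAt 𝓘(ℝ, ℝ) J c s t)
    (hs : UniqueDiffWithinAt ℝ s t) :
    velocity J' s (f ∘ c) t = tangentMap J J' f (velocity J s c t) := by
  unfold velocity tangentMap
  rw [mfderiv_comp_mfderivWithin t hf hc hs.uniqueMDiffWithinAt]
  rfl

theorem tangentMap_eq_self_of_eventuallyEq_id {f : N → N} {ξ : TangentBundle J N}
    (hf : f =ᶠ[𝓝 ξ.1] id) : tangentMap J J f ξ = ξ := by
  have h1 : mfderiv J J f ξ.1 = mfderiv J J id ξ.1 := hf.mfderiv_eq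
  rw [mfderiv_id] at h1
  unfold tangentMap
  rw [h1]
  exact congrArg (fun q => (⟨q, (ξ.2 : F)⟩ : TangentBundle J N)) hf.self_of_nhds

end Velocity

variable {n : ℕ} {Q : Type u} [TopologicalSpace Q] [ChartedSpace (EuclideanSpace ℝ (Fin n)) Q]
  {k : ℕ} {P : Type v} [TopologicalSpace P] [ChartedSpace (EuclideanSpace ℝ (Fin k)) P]
  [IsManifold (𝓡 n) ∞ Q] [IsManifold (𝓡 k) ∞ P] {D : ∀ q : Q, Submodule ℝ (TangentSpace (𝓡 n) q)}
  {ι : P → Q}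

/-- A slice of an integral submanifold such that the paths tangent to the distribution that meet
the slice stay in it as long as they stay in a neighbourhood. -/
structure Plaque (k : ℕ) (D : ∀ q : Q, Submodule ℝ (TangentSpace (𝓡 n) q)) {P : Type v}
    [TopologicalSpace P] [ChartedSpace (EuclideanSpace ℝ (Fin k)) P] (ι : P → Q) extends
    Slice n k ι where
  convex : Convex ℝ φ.target
  path : ∀ (a b α β : ℝ) (γ : ℝ → Q) (t₀ : ℝ), a < b → ContMDiffOn 𝓘(ℝ, ℝ) (𝓡 n) 2 γ (Icc a b) →
    Icc α β ⊆ Icc a b →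
    (∀ t ∈ Icc α β, velocity (𝓡 n) (Icc a b) γ t ∈ totalSet D) →
    MapsTo γ (Icc α β) N → t₀ ∈ Icc α β → ι (r (γ t₀)) = γ t₀ → ∀ t ∈ Icc α β, ι (r (γ t)) = γ t

theorem IsIntegralSubmanifold.exists_plaque (hι : IsIntegralSubmanifold k D ι)
    (hD : IsSmoothSubbundle k D) (p : P) : ∃ B : Plaque k D ι, p ∈ B.φ.source := by
  obtain ⟨B, hp⟩ := exists_slice hι.isImmersion p
  obtain ⟨N₁, hN₁, hpN, hpath⟩ := B.exists_isOpen_path hι hD hp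
  obtain ⟨B', hp', hN, hr, hφ, hconv⟩ := B.exists_restrict hι.isImmersion.contMDiff.continuous hp hN₁ hpN
  refine ⟨⟨B', hconv, fun a b α β γ t₀ hab hγ hsub hγD hmaps ht₀ h₀ => ?_⟩, hp'⟩
  rw [hr] at h₀ ⊢
  exact hpath a b α β γ t₀ hab hγ hsub hγD (hmaps.mono_right hN) ht₀ h₀

omit [IsManifold (𝓡 n) ∞ Q] [IsManifold (𝓡 k) ∞ P] in
theorem Slice.mdifferentiableAt_r (B : Slice n k ι) {x : Q} (hx : x ∈ B.N) :
    MDifferentiableAt (𝓡 n) (𝓡 k) B.r x :=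
  (B.contMDiffOn_r.contMDiffAt (B.isOpen.mem_nhds hx)).mdifferentiableAt (by simp)

omit [IsManifold (𝓡 n) ∞ Q] [IsManifold (𝓡 k) ∞ P] in
theorem Slice.tangentMap_r (hι : ContMDiff (𝓡 k) (𝓡 n) ∞ ι) (B : Slice n k ι)
    {ξ : TangentBundle (𝓡 k) P} (hξ : ξ.1 ∈ B.φ.source) :
    tangentMap (𝓡 n) (𝓡 k) B.r (tangentMap (𝓡 k) (𝓡 n) ι ξ) = ξ := by
  rw [← tangentMap_comp_at ξ (B.mdifferentiableAt_r (B.mapsTo_ι hξ))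
    (hι.mdifferentiable (by simp) ξ.1)]
  refine tangentMap_eq_self_of_eventuallyEq_id ?_
  filter_upwards [B.φ.open_source.mem_nhds hξ] with p hp using B.left_inv p hp

omit [IsManifold (𝓡 n) ∞ Q] in
theorem IsIntegralSubmanifold.mem_range_tangentMap_iff (hι : IsIntegralSubmanifold k D ι)
    {ξ : TangentBundle (𝓡 n) Q} :
    ξ ∈ range (tangentMap (𝓡 k) (𝓡 n) ι) ↔ ξ.1 ∈ range ι ∧ ξ ∈ totalSet D := by
  constructor
  · rintro ⟨η, rfl⟩
    refine ⟨⟨η.1, rfl⟩, ?_⟩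
    change (mfderiv (𝓡 k) (𝓡 n) ι η.1 η.2) ∈ D (ι η.1)
    rw [← SetLike.mem_coe, ← hι.range_mfderiv η.1]
    exact ⟨η.2, rfl⟩
  · obtain ⟨q, v⟩ := ξ
    rintro ⟨⟨p, hp⟩, hv⟩
    change ι p = q at hp
    subst hp
    change v ∈ D (ι p) at hv
    rw [← SetLike.mem_coe, ← hι.range_mfderiv p] at hv
    obtain ⟨c, rfl⟩ := hv
    exact ⟨⟨p, c⟩, rfl⟩

/-- Membership in `D` is the closed condition `π u = u`, and the velocity of a `C²` path is
continuous. -/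
theorem velocity_mem_totalSet_of_frequently (hD : IsSmoothSubbundle k D) {a b : ℝ} (hab : a < b)
    {γ : ℝ → Q} (hγ : ContMDiffOn 𝓘(ℝ, ℝ) (𝓡 n) 2 γ (Icc a b)) {t₀ : ℝ} (ht₀ : t₀ ∈ Icc a b)
    (h : ∃ᶠ t in 𝓝[Icc a b] t₀, velocity (𝓡 n) (Icc a b) γ t ∈ totalSet D) :
    velocity (𝓡 n) (Icc a b) γ t₀ ∈ totalSet D := by
  obtain ⟨V, π, hπ⟩ := hD.exists_isLocalProjector (γ t₀)
  have hsrc := mem_chart_source (EuclideanSpace ℝ (Fin n)) (γ t₀)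
  set u : ℝ → EuclideanSpace ℝ (Fin n) := fun t => chartDeriv (𝓡 n) (γ t₀) (γ t)
      (mfderivWithin 𝓘(ℝ, ℝ) (𝓡 n) γ (Icc a b) t (1 : ℝ)) with hu
  have huc : ContinuousWithinAt u (Icc a b) t₀ :=
    continuousWithinAt_chartDeriv_velocity hab hγ ht₀ hsrc
  have hγc := hγ.continuousOn t₀ ht₀
  have hzc : ContinuousWithinAt (fun t => extChartAt (𝓡 n) (γ t₀) (γ t)) (Icc a b) t₀ :=
    (continuousAt_extChartAt (γ t₀)).comp_continuousWithinAt hγc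
  have hπc : ContinuousWithinAt (fun t => π (extChartAt (𝓡 n) (γ t₀) (γ t))) (Icc a b) t₀ :=
    ContinuousAt.comp_continuousWithinAt (f := fun t => extChartAt (𝓡 n) (γ t₀) (γ t)) (g := π)
      (hπ.contDiffOn.continuousOn.continuousAt (hπ.isOpen.mem_nhds hπ.mem)) hzc
  have hg := (hπc.clm_apply huc).sub huc
  refine (hπ.mem_iff (γ t₀) hsrc hπ.mem _).2 ?_
  by_contra hne
  have hev := hg.eventually_ne (sub_ne_zero.2 hne)
  refine h ?_
  filter_upwards [hev, hγc.preimage_mem_nhdsWithin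
    ((chartAt (EuclideanSpace ℝ (Fin n)) (γ t₀)).open_source.mem_nhds hsrc),
    hzc.preimage_mem_nhdsWithin (hπ.isOpen.mem_nhds hπ.mem)] with t h1 h2 h3 h4
  exact h1 (sub_eq_zero.2 ((hπ.mem_iff (γ t) h2 h3 _).1 h4))

/-- A path that is contained in an integral submanifold is tangent to the distribution. -/
theorem IsIntegralSubmanifold.velocity_mem_totalSet [T2Space Q] (hι : IsIntegralSubmanifold k D ι)
    (hD : IsSmoothSubbundle k D) {a b : ℝ} (hab : a < b) {γ : ℝ → Q}
    (hγ : ContMDiffOn 𝓘(ℝ, ℝ) (𝓡 n) 2 γ (Icc a b)) (hγι : MapsTo γ (Icc a b) (range ι)) :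
    ∀ t ∈ Icc a b, velocity (𝓡 n) (Icc a b) γ t ∈ totalSet D := by
  have := hι.secondCountable
  have hsm := hι.isImmersion.contMDiff
  have : LocallyCompactSpace P := ChartedSpace.locallyCompactSpace (EuclideanSpace ℝ (Fin k)) P
  choose B hB using hι.exists_plaque hD
  choose K hK hKB hKc using fun p => local_compact_nhds ((B p).φ.open_source.mem_nhds (hB p))
  obtain ⟨s, hs, hcover⟩ := TopologicalSpace.countable_cover_nhds hK
  have := hs.to_subtype
  -- The path is continuous in `Q` but not known to be so in the finer topology of `P`. The
  -- countably many compact sets `K p` have closed images, so the sets of times `f p` are closed and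
  -- cover `[a, b]`; by Baire their interiors have dense union.
  let f : s → Set (Icc a b) := fun p => {t | γ t ∈ ι '' K p}
  have hf : ∀ p, IsClosed (f p) := fun p =>
    ((hKc p).image hsm.continuous).isClosed.preimage hγ.continuousOn.domRestrict
  have hfU : ⋃ p, f p = univ := by
    refine eq_univ_of_forall fun t => ?_
    obtain ⟨p, hp⟩ := hγι t.2
    have : p ∈ ⋃ x ∈ s, K x := hcover ▸ mem_univ p
    obtain ⟨x, hx, hpx⟩ := mem_iUnion₂.1 this
    exact mem_iUnion.2 ⟨⟨x, hx⟩, p, hpx, hp⟩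
  have hdense := dense_iUnion_interior_of_closed hf hfU
  intro t₀ ht₀
  refine velocity_mem_totalSet_of_frequently hD hab hγ ht₀ ?_
  have h1 := mem_closure_iff_frequently.1 (hdense ⟨t₀, ht₀⟩)
  rw [nhdsWithin_eq_map_subtype_coe ht₀, frequently_map]
  refine h1.mono fun t ht => ?_
  obtain ⟨p, hp⟩ := mem_iUnion.1 ht
  have hev : ∀ᶠ τ in 𝓝[Icc a b] (t : ℝ), γ τ ∈ ι '' K p := by
    rw [nhdsWithin_eq_map_subtype_coe t.2, eventually_map]
    exact mem_interior_iff_mem_nhds.1 hp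
  have heq : ∀ x ∈ ι '' K p, ι ((B p).r x) = x := by
    rintro _ ⟨y, hy, rfl⟩
    rw [(B p).left_inv y (hKB p hy)]
  have hmem' : t ∈ f p := interior_subset hp
  have hmem : γ t ∈ ι '' K p := hmem'
  have htN : γ t ∈ (B p).N := by
    obtain ⟨y, hy, hyt⟩ := hmem
    exact hyt ▸ (B p).mapsTo_ι (hKB p hy)
  -- In the interior of `f p` the path stays in one slice and equals `ι ∘ r ∘ γ`. Since `r ∘ γ` is
  -- differentiable, its velocity is in the image of `Tι`.
  have hv : velocity (𝓡 n) (Icc a b) (ι ∘ ((B p).r ∘ γ)) t = velocity (𝓡 n) (Icc a b) γ t :=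
    velocity_congr (hev.mono fun τ hτ => heq _ hτ) (heq _ hmem)
  rw [← hv, velocity_comp (J := 𝓡 k) (hsm.mdifferentiable (by simp) _)
    (((B p).mdifferentiableAt_r htN).comp_mdifferentiableWithinAt (t : ℝ)
      ((hγ t t.2).mdifferentiableWithinAt (by simp))) (uniqueDiffOn_Icc hab t t.2)]
  exact (hι.mem_range_tangentMap_iff.1 ⟨_, rfl⟩).2

/-- A path in an integral submanifold that is of class `C²` as a path of the ambient manifold is of
class `C²` as a path of the submanifold. -/
theorem IsIntegralSubmanifold.contMDiffOn_lift [T2Space Q] (hι : IsIntegralSubmanifold k D ι)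
    (hD : IsSmoothSubbundle k D) {a b : ℝ} (hab : a < b) {c : ℝ → P}
    (hγ : ContMDiffOn 𝓘(ℝ, ℝ) (𝓡 n) 2 (ι ∘ c) (Icc a b)) :
    ContMDiffOn 𝓘(ℝ, ℝ) (𝓡 k) 2 c (Icc a b) := by
  have hvel := hι.velocity_mem_totalSet hD hab hγ fun t _ => ⟨c t, rfl⟩
  intro t₀ ht₀
  obtain ⟨B, hB⟩ := hι.exists_plaque hD (c t₀)
  have hN : ι (c t₀) ∈ B.N := B.mapsTo_ι hB
  obtain ⟨α, β, ht₀', hS, hsub, hnhds⟩ := exists_Icc_subset_mem_nhdsWithin ht₀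
    ((hγ.continuousOn t₀ ht₀).preimage_mem_nhdsWithin (B.isOpen.mem_nhds hN))
  -- No continuity of `c` is assumed: it is the plaque property that keeps the path on the sheet of
  -- `c t₀`, so that `c = r ∘ ι ∘ c` near `t₀` by injectivity.
  have hpath := B.path a b α β (ι ∘ c) t₀ hab hγ hsub (fun t ht => hvel t (hsub ht)) hS ht₀'
    (congrArg ι (B.left_inv _ hB))
  have hr : ContMDiffWithinAt 𝓘(ℝ, ℝ) (𝓡 k) 2 (B.r ∘ (ι ∘ c)) (Icc a b) t₀ :=
    ((B.contMDiffOn_r.contMDiffAt (B.isOpen.mem_nhds hN)).of_le two_le_infty).comp_contMDiffWithinAt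
      t₀ (hγ t₀ ht₀)
  refine hr.congr_of_eventuallyEq ?_ (B.left_inv _ hB).symm
  filter_upwards [hnhds] with t ht
  exact hι.injective (hpath t ht).symm

end Plaques

/-! ### Variation fields tangent to an integral submanifold -/

section Fields
open Filter

theorem contMDiffOn_tangentMap {E : Type*} [NormedAddCommGroup E] [NormedSpace ℝ E]
    {M : Type*} [TopologicalSpace M] [ChartedSpace E M] [IsManifold 𝓘(ℝ, E) ∞ M]
    {E' : Type*} [NormedAddCommGroup E'] [NormedSpace ℝ E']
    {M' : Type*} [TopologicalSpace M'] [ChartedSpace E' M'] [IsManifold 𝓘(ℝ, E') ∞ M']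
    {f : M → M'} {U : Set M} (hf : ContMDiffOn 𝓘(ℝ, E) 𝓘(ℝ, E') ∞ f U) (hU : IsOpen U) :
    ContMDiffOn 𝓘(ℝ, E).tangent 𝓘(ℝ, E').tangent ∞ (tangentMap 𝓘(ℝ, E) 𝓘(ℝ, E') f)
      {ξ | ξ.1 ∈ U} := by
  have h1 := hf.contMDiffOn_tangentMapWithin (m := ∞) (by simp) hU.uniqueMDiffOn
  refine h1.congr fun ξ hξ => ?_
  exact (tangentMapWithin_eq_tangentMap (hU.uniqueMDiffOn _ hξ)
    ((hf.contMDiffAt (hU.mem_nhds hξ)).mdifferentiableAt (by simp))).symm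

variable {n : ℕ} {Q : Type u} [TopologicalSpace Q] [ChartedSpace (EuclideanSpace ℝ (Fin n)) Q]
  {k : ℕ} {P : Type v} [TopologicalSpace P] [ChartedSpace (EuclideanSpace ℝ (Fin k)) P]
  [IsManifold (𝓡 n) ∞ Q] [IsManifold (𝓡 k) ∞ P] {D : ∀ q : Q, Submodule ℝ (TangentSpace (𝓡 n) q)}
  {ι : P → Q} {a b : ℝ} {c : ℝ → P} {w : ∀ t, TangentSpace (𝓡 n) ((ι ∘ c) t)}

theorem isVariationField_of_mfderiv (hι : ContMDiff (𝓡 k) (𝓡 n) ∞ ι) (hab : a < b)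
    {u : ∀ t, TangentSpace (𝓡 k) (c t)}
    (hu : IsVariationField a b c u) (hw : ∀ t ∈ Icc a b, w t = mfderiv (𝓡 k) (𝓡 n) ι (c t) (u t)) :
    IsVariationField a b (ι ∘ c) w := by
  refine ⟨?_, ?_, ?_⟩
  · have h1 := ((contMDiffOn_tangentMap hι.contMDiffOn isOpen_univ).of_le
      (m := 1) (by norm_num)).comp hu.contMDiffOn fun t _ => mem_univ (c t)
    refine h1.congr fun t ht => ?_
    exact congrArg (fun v : EuclideanSpace ℝ (Fin n) => (⟨ι (c t), v⟩ : TangentBundle (𝓡 n) Q))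
      (hw t ht)
  · rw [hw a (left_mem_Icc.2 hab.le), hu.left]; exact map_zero _
  · rw [hw b (right_mem_Icc.2 hab.le), hu.right]; exact map_zero _

/-- The lift exists pointwise because the image of `Tι` is `D`. Its regularity comes from `u =
Tr(w)` for the local left inverse `r` of any slice. -/
theorem IsIntegralSubmanifold.exists_isVariationField (hι : IsIntegralSubmanifold k D ι)
    (hab : a < b) (hc : ContinuousOn c (Icc a b)) (hw : IsVariationField a b (ι ∘ c) w)
    (hwι : ∀ t ∈ Icc a b, w t ∈ D (ι (c t))) : ∃ u : ∀ t, TangentSpace (𝓡 k) (c t),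
      IsVariationField a b c u ∧ ∀ t ∈ Icc a b, w t = mfderiv (𝓡 k) (𝓡 n) ι (c t) (u t) := by
  have hsm := hι.isImmersion.contMDiff
  have h1 : ∀ t, ∃ u : TangentSpace (𝓡 k) (c t), t ∈ Icc a b →
      w t = mfderiv (𝓡 k) (𝓡 n) ι (c t) u := fun t => by
    by_cases ht : t ∈ Icc a b
    · have h2 := hwι t ht
      rw [← SetLike.mem_coe, ← hι.range_mfderiv] at h2
      obtain ⟨u, hu⟩ := h2
      exact ⟨u, fun _ => hu.symm⟩
    -- Outside `[a, b]` nothing is required, and `0` is a filler.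
    · exact ⟨0, fun h => absurd h ht⟩
  choose u hu using h1
  have hr : ∀ (B : Slice n k ι) (t : ℝ), t ∈ Icc a b → c t ∈ B.φ.source →
      tangentMap (𝓡 n) (𝓡 k) B.r (⟨ι (c t), w t⟩ : TangentBundle (𝓡 n) Q) = ⟨c t, u t⟩ :=
    fun B t ht hB => by
      rw [hu t ht]
      exact B.tangentMap_r hsm (ξ := ⟨c t, u t⟩) hB
  have h0 : ∀ t ∈ Icc a b, w t = 0 → u t = 0 := fun t ht h => by
    obtain ⟨B, hB⟩ := exists_slice hι.isImmersion (c t)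
    have h2 := hr B t ht hB
    have h3 := B.tangentMap_r hsm (ξ := ⟨c t, 0⟩) hB
    have h4 : tangentMap (𝓡 k) (𝓡 n) ι (⟨c t, 0⟩ : TangentBundle (𝓡 k) P) = ⟨ι (c t), w t⟩ := by
      unfold tangentMap
      rw [h]
      exact congrArg (fun v : EuclideanSpace ℝ (Fin n) => (⟨ι (c t), v⟩ : TangentBundle (𝓡 n) Q))
        (map_zero _)
    rw [h4, h2] at h3
    exact eq_of_heq (Bundle.TotalSpace.mk.inj h3).2
  refine ⟨u, ⟨fun t₀ ht₀ => ?_, h0 a (left_mem_Icc.2 hab.le) hw.left,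
    h0 b (right_mem_Icc.2 hab.le) hw.right⟩, hu⟩
  obtain ⟨B, hB⟩ := exists_slice hι.isImmersion (c t₀)
  have hopen : IsOpen {ξ : TangentBundle (𝓡 n) Q | ξ.1 ∈ B.N} :=
    B.isOpen.preimage (FiberBundle.continuous_proj (EuclideanSpace ℝ (Fin n)) (TangentSpace (𝓡 n)))
  have h2 := ((contMDiffOn_tangentMap B.contMDiffOn_r B.isOpen).contMDiffAt (hopen.mem_nhds
    (show (⟨ι (c t₀), w t₀⟩ : TangentBundle (𝓡 n) Q).1 ∈ B.N from B.mapsTo_ι hB))).of_le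
      (m := 1) (by norm_num)
  have h3 := h2.comp_contMDiffWithinAt (f := fun t => (⟨ι (c t), w t⟩ : TangentBundle (𝓡 n) Q)) t₀
    (hw.contMDiffOn t₀ ht₀)
  refine h3.congr_of_eventuallyEq ?_ (hr B t₀ ht₀ hB).symm
  filter_upwards [(hc t₀ ht₀).preimage_mem_nhdsWithin (B.φ.open_source.mem_nhds hB),
    self_mem_nhdsWithin] with t ht hts
  exact (hr B t hts ht).symm

theorem mem_holonomic_W_iff (L : TangentBundle (𝓡 n) Q → ℝ) (hι : IsIntegralSubmanifold k D ι)
    {γ : ℝ → Q} {w : ∀ t, TangentSpace (𝓡 n) (γ t)} (hγ : MapsTo γ (Icc a b) (range ι)) :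
    w ∈ (holonomic (EuclideanSpace ℝ (Fin k)) L ι).W a b γ ↔
      IsVariationField a b γ w ∧ ∀ t ∈ Icc a b, w t ∈ D (γ t) :=
  and_congr_right fun _ => forall₂_congr fun _ ht =>
    hι.mem_range_tangentMap_iff.trans (and_iff_right (hγ ht))

/-- Only the passage from values in `P` to velocities in `TP` has content; it rests on the Baire
argument of `IsIntegralSubmanifold.velocity_mem_totalSet`. -/
theorem holonomic_isAdmissible_iff [T2Space Q] (L : TangentBundle (𝓡 n) Q → ℝ)
    (hι : IsIntegralSubmanifold k D ι) (hD : IsSmoothSubbundle k D) (hab : a < b) {γ : ℝ → Q} :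
    (holonomic (EuclideanSpace ℝ (Fin k)) L ι).IsAdmissible a b γ ↔
      ContMDiffOn 𝓘(ℝ, ℝ) (𝓡 n) 2 γ (Icc a b) ∧ MapsTo γ (Icc a b) (range ι) :=
  ⟨fun h => ⟨h.1, fun t ht => (hι.mem_range_tangentMap_iff.1 (h.2 t ht)).1⟩,
    fun h => ⟨h.1, fun t ht => hι.mem_range_tangentMap_iff.2
      ⟨h.2 ht, hι.velocity_mem_totalSet hD hab h.1 h.2 t ht⟩⟩⟩

end Fields

/-! ### Comparison of critical paths of two problems -/

section Criticality

variable {E : Type*} [NormedAddCommGroup E] [NormedSpace ℝ E]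
  {M : Type*} [TopologicalSpace M] [ChartedSpace E M] [IsManifold 𝓘(ℝ, E) ∞ M]

omit [IsManifold 𝓘(ℝ, E) ∞ M] in
theorem VariationalProblem.isCritical_congr {V V' : VariationalProblem E M} {a b : ℝ} {γ : ℝ → M}
    (hL : V.L = V'.L) (hadm : V.IsAdmissible a b γ ↔ V'.IsAdmissible a b γ)
    (hW : V.IsAdmissible a b γ → V.W a b γ = V'.W a b γ) :
    V.IsCritical a b γ ↔ V'.IsCritical a b γ := by
  constructor
  · intro h
    refine ⟨hadm.1 h.1, fun δ Γ w hΓ hw hwW => ?_⟩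
    rw [← hL]
    exact h.2 δ Γ w hΓ hw (hW h.1 ▸ hwW)
  · intro h
    have h1 := hadm.2 h.1
    refine ⟨h1, fun δ Γ w hΓ hw hwW => ?_⟩
    rw [hL]
    exact h.2 δ Γ w hΓ hw (hW h1 ▸ hwW)

end Criticality

/-! ### The first variation formula -/

section FirstVariation
open Filter

/-- Equality of the mixed partial derivatives on a strip, including its boundary. -/
theorem exists_hasDerivAt_of_contDiffWithinAt {E : Type*} [NormedAddCommGroup E] [NormedSpace ℝ E]
    {a b δ t : ℝ} (hδ : 0 < δ) (hab : a < b) (ht : t ∈ Icc a b) {z : ℝ × ℝ → E}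
    (hz : ContDiffWithinAt ℝ 2 z (Ioo (-δ) δ ×ˢ Icc a b) (0, t)) {p q : ℝ → E}
    (hp : ∀ᶠ ε in 𝓝 0, HasDerivWithinAt (fun τ => z (ε, τ)) (p ε) (Icc a b) t)
    (hq : ∀ᶠ τ in 𝓝[Icc a b] t, HasDerivAt (fun ε => z (ε, τ)) (q τ) 0) :
    ∃ d, HasDerivAt p d 0 ∧ HasDerivWithinAt q d (Icc a b) t := by
  set S := Ioo (-δ) δ ×ˢ Icc a b with hS
  have h0 : (0 : ℝ) ∈ Ioo (-δ) δ := ⟨by linarith, hδ⟩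
  have hmem : ((0, t) : ℝ × ℝ) ∈ S := ⟨h0, ht⟩
  have hud : UniqueDiffOn ℝ S := (uniqueDiffOn_Ioo _ _).prod (uniqueDiffOn_Icc hab)
  -- For `t = a` or `t = b` the point is on the boundary of the strip; being in the closure of the
  -- interior suffices for the symmetry of the second derivative within `S`.
  have hcl : ((0, t) : ℝ × ℝ) ∈ closure (interior S) := by
    rw [hS, interior_prod_eq, interior_Ioo, interior_Icc, closure_prod_eq, closure_Ioo hab.ne]
    exact ⟨subset_closure h0, ht⟩
  have hsymm := hz.isSymmSndFDerivWithinAt (by simp) hud hcl hmem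
  have hd1 : DifferentiableWithinAt ℝ (fderivWithin ℝ z S) S (0, t) :=
    (hz.fderivWithin_right (m := 1) hud (by norm_num) hmem).differentiableWithinAt (by simp)
  have hdz : ∀ᶠ x in 𝓝[S] ((0, t) : ℝ × ℝ), DifferentiableWithinAt ℝ z S x := by
    have h1 := hz.eventually (by simp)
    rw [insert_eq_of_mem hmem] at h1
    exact h1.mono fun x hx => hx.differentiableWithinAt (by simp)
  have hline1 : Tendsto (fun ε : ℝ => (ε, t)) (𝓝 0) (𝓝[S] (0, t)) :=
    tendsto_nhdsWithin_iff.2 ⟨(by fun_prop : Continuous fun ε : ℝ => (ε, t)).tendsto 0, by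
      filter_upwards [Ioo_mem_nhds h0.1 h0.2] with ε hε using ⟨hε, ht⟩⟩
  have hline2 : Tendsto (fun τ : ℝ => ((0 : ℝ), τ)) (𝓝[Icc a b] t) (𝓝[S] (0, t)) :=
    tendsto_nhdsWithin_iff.2 ⟨((by fun_prop : Continuous fun τ : ℝ => ((0 : ℝ), τ)).tendsto
      t).mono_left nhdsWithin_le_nhds, by
      filter_upwards [self_mem_nhdsWithin] with τ hτ using ⟨h0, hτ⟩⟩
  have hpe : p =ᶠ[𝓝 0] fun ε => fderivWithin ℝ z S (ε, t) (0, 1) := by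
    filter_upwards [hp, hline1.eventually hdz, Ioo_mem_nhds h0.1 h0.2] with ε h1 h2 h3
    have h4 : HasDerivWithinAt (fun τ : ℝ => (ε, τ)) ((0 : ℝ), (1 : ℝ)) (Icc a b) t :=
      (hasDerivWithinAt_const t _ ε).prodMk (hasDerivWithinAt_id t _)
    have h5 : MapsTo (fun τ : ℝ => (ε, τ)) (Icc a b) S := fun τ hτ => ⟨h3, hτ⟩
    exact (uniqueDiffOn_Icc hab t ht).eq_deriv _ h1
      (h2.hasFDerivWithinAt.comp_hasDerivWithinAt t h4 h5)
  have hqe : q =ᶠ[𝓝[Icc a b] t] fun τ => fderivWithin ℝ z S (0, τ) (1, 0) := by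
    filter_upwards [hq, hline2.eventually hdz, self_mem_nhdsWithin] with τ h1 h2 h3
    have h4 : HasDerivWithinAt (fun ε : ℝ => (ε, τ)) ((1 : ℝ), (0 : ℝ)) (Ioo (-δ) δ) 0 :=
      (hasDerivWithinAt_id 0 _).prodMk (hasDerivWithinAt_const _ _ τ)
    have h5 : MapsTo (fun ε : ℝ => (ε, τ)) (Ioo (-δ) δ) S := fun ε hε => ⟨hε, h3⟩
    exact (uniqueDiffOn_Ioo _ _ 0 h0).eq_deriv _ h1.hasDerivWithinAt
      (h2.hasFDerivWithinAt.comp_hasDerivWithinAt 0 h4 h5)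
  set d2 := fderivWithin ℝ (fderivWithin ℝ z S) S (0, t) with hd2
  refine ⟨d2 (1, 0) (0, 1), ?_, ?_⟩
  · refine HasDerivAt.congr_of_eventuallyEq ?_ hpe
    have h4 : HasDerivWithinAt (fun ε : ℝ => (ε, t)) ((1 : ℝ), (0 : ℝ)) (Ioo (-δ) δ) 0 :=
      (hasDerivWithinAt_id 0 _).prodMk (hasDerivWithinAt_const _ _ t)
    have h5 := hd1.hasFDerivWithinAt.comp_hasDerivWithinAt 0 h4
      (show MapsTo _ _ S from fun ε hε => ⟨hε, ht⟩)
    have h6 := (h5.clm_apply (hasDerivWithinAt_const 0 _ ((0 : ℝ), (1 : ℝ)))).hasDerivAt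
      (Ioo_mem_nhds h0.1 h0.2)
    exact h6.congr_deriv (by simp [hd2])
  · have h4 : HasDerivWithinAt (fun τ : ℝ => ((0 : ℝ), τ)) ((0 : ℝ), (1 : ℝ)) (Icc a b) t :=
      (hasDerivWithinAt_const t _ (0 : ℝ)).prodMk (hasDerivWithinAt_id t _)
    have h5 := hd1.hasFDerivWithinAt.comp_hasDerivWithinAt t h4
      (show MapsTo _ _ S from fun τ hτ => ⟨h0, hτ⟩)
    have h6 := h5.clm_apply (hasDerivWithinAt_const t _ ((1 : ℝ), (0 : ℝ)))
    refine HasDerivWithinAt.congr_of_eventuallyEq ?_ hqe (hqe.self_of_nhdsWithin ht)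
    refine h6.congr_deriv ?_
    rw [hsymm (1, 0) (0, 1)]
    simp

variable {E : Type*} [NormedAddCommGroup E] [NormedSpace ℝ E]
  {M : Type*} [TopologicalSpace M] [ChartedSpace E M]

theorem hasDerivAt_comp_of_extChartAt {F : Type*} [NormedAddCommGroup F] [NormedSpace ℝ F]
    {H : Type*} [TopologicalSpace H] {I : ModelWithCorners ℝ F H} {N : Type*} [TopologicalSpace N]
    [ChartedSpace H N] [IsManifold I 1 N] {L : N → ℝ} {g : ℝ → N} {p : N} {t : ℝ} {v : F}
    (hgp : g t = p) (hg : MDifferentiableAt 𝓘(ℝ, ℝ) I g t)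
    (hv : HasDerivAt (fun ε => extChartAt I p (g ε)) v t)
    (hL : MDifferentiableAt I 𝓘(ℝ, ℝ) L p) :
    HasDerivAt (fun ε => L (g ε)) ((mfderiv I 𝓘(ℝ, ℝ) L p : F → ℝ) v) t := by
  subst hgp
  have h1 := (hasDerivWithinAt_extChartAt_comp (s := univ) (mdifferentiableWithinAt_univ.2 hg)
    (mem_chart_source H (g t))).hasDerivAt univ_mem
  have h2 : v = mfderivWithin 𝓘(ℝ, ℝ) I g univ t (1 : ℝ) :=
    (hv.unique h1).trans (chartDeriv_self (I := I) _ _)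
  rw [h2, mfderivWithin_univ]
  let A : F →L[ℝ] ℝ := mfderiv I 𝓘(ℝ, ℝ) L (g t)
  let B : ℝ →L[ℝ] F := mfderiv 𝓘(ℝ, ℝ) I g t
  have h3 : HasFDerivAt (fun ε => L (g ε)) (A.comp B) t :=
    hasMFDerivAt_iff_hasFDerivAt.1 (hL.hasMFDerivAt.comp (f := g) t hg.hasMFDerivAt)
  exact h3.hasDerivAt

theorem hasDerivAt_extChartAt_of_velocity_eq [IsManifold 𝓘(ℝ, E) 1 M] {s : Set ℝ} {t : ℝ}
    (hs : s ∈ 𝓝 t) {g : ℝ → M} (hg : MDifferentiableWithinAt 𝓘(ℝ, ℝ) 𝓘(ℝ, E) g s t) {q : M}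
    {v : TangentSpace 𝓘(ℝ, E) q} (h : velocity 𝓘(ℝ, E) s g t = ⟨q, v⟩) {x₀ : M}
    (hx : q ∈ (chartAt E x₀).source) :
    HasDerivAt (fun ε => extChartAt 𝓘(ℝ, E) x₀ (g ε)) (chartDeriv 𝓘(ℝ, E) x₀ q v) t := by
  obtain rfl : g t = q := congrArg Bundle.TotalSpace.proj h
  have h2 := eq_of_heq (Bundle.TotalSpace.mk.inj h).2
  rw [← h2]
  exact (hasDerivWithinAt_extChartAt_comp hg hx).hasDerivAt hs

variable [IsManifold 𝓘(ℝ, E) ∞ M]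

/-- The integrand `⟨∂L/∂q, w⟩ + ⟨∂L/∂v, ẇ⟩` of the first variation of the action. -/
def firstVariation (L : TangentBundle 𝓘(ℝ, E) M → ℝ) (a b : ℝ) (γ : ℝ → M)
    (w : ∀ t, TangentSpace 𝓘(ℝ, E) (γ t)) (t : ℝ) : ℝ :=
  (mfderiv 𝓘(ℝ, E).tangent 𝓘(ℝ, ℝ) L (velocity 𝓘(ℝ, E) (Icc a b) γ t) : E × E → ℝ)
    (w t, derivWithin (fun τ => (chartDeriv 𝓘(ℝ, E) (γ t) (γ τ) (w τ) : E)) (Icc a b) t)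

variable {a b δ : ℝ} {γ : ℝ → M} {Γ : ℝ × ℝ → M} {w : ∀ t, TangentSpace 𝓘(ℝ, E) (γ t)}

/-- The velocity in `t` is the tangent map of `Γ` applied to the constant field `(0, 1)`, which
costs one derivative. -/
theorem IsVariation.contMDiffOn_velocity (hΓ : IsVariation (E := E) a b γ δ Γ) (hab : a < b) :
    ContMDiffOn 𝓘(ℝ, ℝ × ℝ) 𝓘(ℝ, E).tangent 1
      (fun x => velocity 𝓘(ℝ, E) (Icc a b) (fun t => Γ (x.1, t)) x.2) (Ioo (-δ) δ ×ˢ Icc a b) := by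
  have hM : IsManifold 𝓘(ℝ, E) (1 + 1) M := .of_le (n := ∞) (by
    rw [one_add_one_eq_two]; exact two_le_infty)
  have hM2 : IsManifold 𝓘(ℝ, E) 2 M := .of_le (n := ∞) two_le_infty
  set S := Ioo (-δ) δ ×ˢ Icc a b with hS
  have hud : UniqueDiffOn ℝ S := (uniqueDiffOn_Ioo _ _).prod (uniqueDiffOn_Icc hab)
  have h1 := hΓ.contMDiffOn.contMDiffOn_tangentMapWithin (m := 1) (by norm_num) hud.uniqueMDiffOn
  have h2 : ContMDiff 𝓘(ℝ, ℝ × ℝ) 𝓘(ℝ, ℝ × ℝ).tangent 1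
      (fun x : ℝ × ℝ => (⟨x, ((0 : ℝ), (1 : ℝ))⟩ : TangentBundle 𝓘(ℝ, ℝ × ℝ) (ℝ × ℝ))) :=
    contMDiff_vectorSpace_iff_contDiff.2 contDiff_const
  refine (h1.comp h2.contMDiffOn fun t ht => ht).congr fun x hx => ?_
  have h4 : HasDerivWithinAt (fun τ : ℝ => (x.1, τ)) ((0 : ℝ), (1 : ℝ)) (Icc a b) x.2 :=
    (hasDerivWithinAt_const x.2 _ x.1).prodMk (hasDerivWithinAt_id x.2 _)
  have h5 := mfderivWithin_comp (I := 𝓘(ℝ, ℝ)) (I' := 𝓘(ℝ, ℝ × ℝ)) (I'' := 𝓘(ℝ, E)) (g := Γ)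
    (u := S) (f := fun τ : ℝ => (x.1, τ)) (s := Icc a b)
    x.2 ((hΓ.contMDiffOn x hx).mdifferentiableWithinAt (by simp))
    h4.differentiableWithinAt.mdifferentiableWithinAt (fun τ hτ => ⟨hx.1, hτ⟩)
    (uniqueDiffOn_Icc hab x.2 hx.2).uniqueMDiffWithinAt
  have h6 : (mfderivWithin 𝓘(ℝ, ℝ) 𝓘(ℝ, ℝ × ℝ) (fun τ : ℝ => (x.1, τ)) (Icc a b) x.2 : ℝ →L[ℝ] ℝ × ℝ)
      (1 : ℝ) = (0, 1) := by
    rw [mfderivWithin_eq_fderivWithin]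
    exact h4.derivWithin (uniqueDiffOn_Icc hab x.2 hx.2)
  refine congrArg (fun v : E => (⟨Γ x, v⟩ : TangentBundle 𝓘(ℝ, E) M)) ?_
  refine (congrArg (fun A : ℝ →L[ℝ] E => A 1) h5).trans ?_
  exact congrArg (mfderivWithin 𝓘(ℝ, ℝ × ℝ) 𝓘(ℝ, E) Γ S x : ℝ × ℝ → E) h6

/-- In a chart the velocity is `(z, ∂ₜz)`, and its derivative in `ε` is `(w, ∂ₜw)` by equality of
mixed partials. So the derivative of the Lagrangian depends on `Γ` only through its field. -/
theorem IsVariation.hasDerivAt_lagrangian (hΓ : IsVariation (E := E) a b γ δ Γ) (hab : a < b)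
    (hw : IsFieldOf a b γ δ Γ w) {L : TangentBundle 𝓘(ℝ, E) M → ℝ}
    (hL : ContMDiff 𝓘(ℝ, E).tangent 𝓘(ℝ, ℝ) 1 L) {t : ℝ} (ht : t ∈ Icc a b) :
    HasDerivAt (fun ε => L (velocity 𝓘(ℝ, E) (Icc a b) (fun t => Γ (ε, t)) t))
      (firstVariation L a b γ w t) 0 := by
  have hM : IsManifold 𝓘(ℝ, E) 1 M := .of_le (n := ∞) (by norm_num)
  have hM2 : IsManifold 𝓘(ℝ, E) 2 M := .of_le (n := ∞) two_le_infty
  have hδ := hΓ.pos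
  have h0 : (0 : ℝ) ∈ Ioo (-δ) δ := ⟨by linarith, hδ⟩
  have h0t : ((0, t) : ℝ × ℝ) ∈ Ioo (-δ) δ ×ˢ Icc a b := ⟨h0, ht⟩
  have hsrc : Γ (0, t) ∈ (chartAt E (γ t)).source := by
    rw [hΓ.zero t ht]; exact mem_chart_source E (γ t)
  set σ : ℝ → TangentBundle 𝓘(ℝ, E) M :=
    fun ε => velocity 𝓘(ℝ, E) (Icc a b) (fun t => Γ (ε, t)) t with hσ
  have hσ0 : σ 0 = velocity 𝓘(ℝ, E) (Icc a b) γ t :=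
    velocity_congr (by filter_upwards [self_mem_nhdsWithin] with τ hτ using hΓ.zero τ hτ)
      (hΓ.zero t ht)
  have hline : ContMDiff 𝓘(ℝ, ℝ) 𝓘(ℝ, ℝ × ℝ) 2 (fun ε : ℝ => (ε, t)) :=
    (contDiff_id.prodMk contDiff_const).contMDiff
  have hline' : ContMDiff 𝓘(ℝ, ℝ) 𝓘(ℝ, ℝ × ℝ) 1 (fun ε : ℝ => (ε, t)) :=
    (contDiff_id.prodMk contDiff_const).contMDiff
  have hmaps : MapsTo (fun ε : ℝ => (ε, t)) (Ioo (-δ) δ) (Ioo (-δ) δ ×ˢ Icc a b) :=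
    fun ε hε => ⟨hε, ht⟩
  have hσd : MDifferentiableAt 𝓘(ℝ, ℝ) 𝓘(ℝ, E).tangent σ 0 :=
    (((hΓ.contMDiffOn_velocity hab).comp hline'.contMDiffOn hmaps).contMDiffAt
      (Ioo_mem_nhds h0.1 h0.2)).mdifferentiableAt (by simp)
  have hΓt : ∀ τ ∈ Icc a b, ContMDiffOn 𝓘(ℝ, ℝ) 𝓘(ℝ, E) 2 (fun ε => Γ (ε, τ)) (Ioo (-δ) δ) :=
    fun τ hτ => hΓ.contMDiffOn.comp
      (contDiff_id.prodMk (contDiff_const (c := τ))).contMDiff.contMDiffOn fun ε hε => ⟨hε, hτ⟩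
  have hΓε : ∀ ε ∈ Ioo (-δ) δ, ContMDiffOn 𝓘(ℝ, ℝ) 𝓘(ℝ, E) 2 (fun τ => Γ (ε, τ)) (Icc a b) :=
    fun ε hε => hΓ.contMDiffOn.comp
      ((contDiff_const (c := ε)).prodMk contDiff_id).contMDiff.contMDiffOn fun τ hτ => ⟨hε, hτ⟩
  have hz : ContDiffWithinAt ℝ 2 (fun x => extChartAt 𝓘(ℝ, E) (γ t) (Γ x))
      (Ioo (-δ) δ ×ˢ Icc a b) (0, t) :=
    contMDiffWithinAt_iff_contDiffWithinAt.1
      ((contMDiffAt_extChartAt' hsrc).comp_contMDiffWithinAt (f := Γ) (0, t)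
        (hΓ.contMDiffOn _ h0t))
  have hev : ∀ᶠ ε in 𝓝 (0 : ℝ), Γ (ε, t) ∈ (chartAt E (γ t)).source :=
    ((hΓt t ht).continuousOn.continuousAt (Ioo_mem_nhds h0.1 h0.2)).preimage_mem_nhds
      ((chartAt E (γ t)).open_source.mem_nhds hsrc)
  obtain ⟨d, hd1, hd2⟩ := exists_hasDerivAt_of_contDiffWithinAt (z := fun x =>
    (extChartAt 𝓘(ℝ, E) (γ t) (Γ x) : E)) hδ hab ht hz
    (p := fun ε => (chartDeriv 𝓘(ℝ, E) (γ t) (Γ (ε, t)) (σ ε).2 : E))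
    (q := fun τ => (chartDeriv 𝓘(ℝ, E) (γ t) (γ τ) (w τ) : E)) (by
      filter_upwards [hev, Ioo_mem_nhds h0.1 h0.2] with ε h1 h2
      exact hasDerivWithinAt_extChartAt_comp (((hΓε ε h2) t ht).mdifferentiableWithinAt (by simp)) h1)
    (by
      have h3 : ContinuousWithinAt γ (Icc a b) t :=
        ((hΓε 0 h0).continuousOn t ht).congr (fun τ hτ => (hΓ.zero τ hτ).symm) (hΓ.zero t ht).symm
      filter_upwards [self_mem_nhdsWithin, h3.preimage_mem_nhdsWithin
        ((chartAt E (γ t)).open_source.mem_nhds (mem_chart_source E (γ t)))] with τ h1 h2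
      exact hasDerivAt_extChartAt_of_velocity_eq (Ioo_mem_nhds h0.1 h0.2)
        ((hΓt τ h1 0 h0).mdifferentiableWithinAt (by simp)) (hw τ h1) h2)
  have hfv : firstVariation L a b γ w t =
      (mfderiv 𝓘(ℝ, E).tangent 𝓘(ℝ, ℝ) L (velocity 𝓘(ℝ, E) (Icc a b) γ t) : E × E → ℝ) (w t, d) :=
    congrArg (fun d : E => (mfderiv 𝓘(ℝ, E).tangent 𝓘(ℝ, ℝ) L
      (velocity 𝓘(ℝ, E) (Icc a b) γ t) : E × E → ℝ) (w t, d))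
      (hd2.derivWithin (uniqueDiffOn_Icc hab t ht))
  rw [hfv]
  refine hasDerivAt_comp_of_extChartAt hσ0 hσd ?_ (hL.mdifferentiable (by simp) _)
  have h4 := hasDerivAt_extChartAt_of_velocity_eq (Ioo_mem_nhds h0.1 h0.2)
    ((hΓt t ht 0 h0).mdifferentiableWithinAt (by simp)) (hw t ht) (mem_chart_source E (γ t))
  have h5 : HasDerivAt (fun ε => (extChartAt 𝓘(ℝ, E) (γ t) (Γ (ε, t)) : E)) (w t : E) 0 :=
    h4.congr_deriv (chartDeriv_self (I := 𝓘(ℝ, E)) _ _)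
  refine (h5.prodMk hd1).congr_of_eventuallyEq ?_
  filter_upwards [hev] with ε hε
  exact extChartAt_tangent_apply (velocity 𝓘(ℝ, E) (Icc a b) γ t) (σ ε) hε

theorem IsVariation.hasDerivAt_action (hΓ : IsVariation (E := E) a b γ δ Γ) (hab : a < b)
    (hw : IsFieldOf a b γ δ Γ w) {L : TangentBundle 𝓘(ℝ, E) M → ℝ}
    (hL : ContMDiff 𝓘(ℝ, E).tangent 𝓘(ℝ, ℝ) 1 L) :
    IntervalIntegrable (firstVariation L a b γ w) MeasureTheory.volume a b ∧
      HasDerivAt (fun ε => action L a b (fun t => Γ (ε, t)))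
        (∫ t in a..b, firstVariation L a b γ w t) 0 := by
  have hδ := hΓ.pos
  have h0 : (0 : ℝ) ∈ Ioo (-δ) δ := ⟨by linarith, hδ⟩
  set S := Ioo (-δ) δ ×ˢ Icc a b with hS
  have hud : UniqueDiffOn ℝ S := (uniqueDiffOn_Ioo _ _).prod (uniqueDiffOn_Icc hab)
  set F : ℝ × ℝ → ℝ := fun x => L (velocity 𝓘(ℝ, E) (Icc a b) (fun t => Γ (x.1, t)) x.2) with hF
  have hFC : ContDiffOn ℝ 1 F S :=
    contMDiffOn_iff_contDiffOn.1 (hL.comp_contMDiffOn (hΓ.contMDiffOn_velocity hab))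
  have hFd : ContinuousOn (fun x => fderivWithin ℝ F S x (1, 0)) S :=
    (hFC.continuousOn_fderivWithin hud (by simp)).clm_apply continuousOn_const
  -- Halving the width gives a compact strip inside `S`, on which the continuous derivative in `ε`
  -- has a constant bound that dominates under the integral.
  have hKS : Icc (-(δ / 2)) (δ / 2) ×ˢ Icc a b ⊆ S :=
    prod_mono (fun ε hε => ⟨by linarith [hε.1], by linarith [hε.2]⟩) subset_rfl
  obtain ⟨C, hC⟩ := (isCompact_Icc.prod isCompact_Icc).exists_bound_of_continuousOn (hFd.mono hKS)
  have hIoc : uIoc a b ⊆ Icc a b := by rw [uIoc_of_le hab.le]; exact Ioc_subset_Icc_self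
  have hslice : ∀ ε ∈ Ioo (-δ) δ, ContinuousOn (fun t : ℝ => ((ε, t) : ℝ × ℝ)) (Icc a b) ∧
      MapsTo (fun t : ℝ => ((ε, t) : ℝ × ℝ)) (Icc a b) S :=
    fun ε hε => ⟨by fun_prop, fun t ht => ⟨hε, ht⟩⟩
  have hcont : ∀ ε ∈ Ioo (-δ) δ, ContinuousOn (fun t => F (ε, t)) (Icc a b) := fun ε hε =>
    hFC.continuousOn.comp (hslice ε hε).1 (hslice ε hε).2
  have hderiv : ∀ t ∈ Icc a b, ∀ ε ∈ Ioo (-δ) δ,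
      HasDerivAt (fun ε => F (ε, t)) (fderivWithin ℝ F S (ε, t) (1, 0)) ε := fun t ht ε hε => by
    have h4 : HasDerivWithinAt (fun ε : ℝ => (ε, t)) ((1 : ℝ), (0 : ℝ)) (Ioo (-δ) δ) ε :=
      (hasDerivWithinAt_id ε _).prodMk (hasDerivWithinAt_const _ _ t)
    have h5 : MapsTo (fun ε : ℝ => (ε, t)) (Ioo (-δ) δ) S := fun ε hε => ⟨hε, ht⟩
    exact (((hFC.differentiableOn (by simp)) (ε, t) ⟨hε, ht⟩).hasFDerivWithinAt.comp_hasDerivWithinAt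
      ε h4 h5).hasDerivAt (Ioo_mem_nhds hε.1 hε.2)
  have hmeas : ∀ f : ℝ → ℝ, ContinuousOn f (Icc a b) →
      MeasureTheory.AEStronglyMeasurable f (MeasureTheory.volume.restrict (uIoc a b)) := fun f hf =>
    (hf.mono hIoc).aestronglyMeasurable measurableSet_uIoc
  have hfv : ∀ t ∈ Icc a b, fderivWithin ℝ F S (0, t) (1, 0) = firstVariation L a b γ w t :=
    fun t ht => (hderiv t ht 0 h0).unique (hΓ.hasDerivAt_lagrangian hab hw hL ht)
  have hfvc : ContinuousOn (firstVariation L a b γ w) (Icc a b) :=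
    (hFd.comp (hslice 0 h0).1 (hslice 0 h0).2).congr fun t ht => (hfv t ht).symm
  have hu : uIcc a b = Icc a b := uIcc_of_le hab.le
  have key := intervalIntegral.hasDerivAt_integral_of_dominated_loc_of_deriv_le
    (μ := MeasureTheory.volume) (a := a) (b := b) (F := fun ε t => F (ε, t))
    (F' := fun ε t => fderivWithin ℝ F S (ε, t) (1, 0)) (x₀ := 0) (s := Ioo (-(δ / 2)) (δ / 2))
    (bound := fun _ => C) (Ioo_mem_nhds (by linarith) (by linarith))
    (by filter_upwards [Ioo_mem_nhds h0.1 h0.2] with ε hε using hmeas _ (hcont ε hε))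
    (by refine ContinuousOn.intervalIntegrable ?_; rw [hu]; exact hcont 0 h0)
    (hmeas _ (hFd.comp (hslice 0 h0).1 (hslice 0 h0).2))
    (.of_forall fun t ht ε hε => hC (ε, t) ⟨Ioo_subset_Icc_self hε, hIoc ht⟩)
    intervalIntegrable_const
    (.of_forall fun t ht ε hε => hderiv t (hIoc ht) ε ⟨by linarith [hε.1], by linarith [hε.2]⟩)
  refine ⟨ContinuousOn.intervalIntegrable (by rwa [hu]), ?_⟩
  rw [← intervalIntegral.integral_congr (fun t ht => hfv t (hu ▸ ht))]
  exact key.2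

end FirstVariation

/-! ### Cutting off variation fields -/

section Localization
open Filter

theorem velocity_of_mem_nhds {F : Type*} [NormedAddCommGroup F] [NormedSpace ℝ F] {H : Type*}
    [TopologicalSpace H] {J : ModelWithCorners ℝ F H} {N : Type*} [TopologicalSpace N]
    [ChartedSpace H N] {s s' : Set ℝ} {c : ℝ → N} {t : ℝ} (hs : s ∈ 𝓝 t) (hs' : s' ∈ 𝓝 t) :
    velocity J s c t = velocity J s' c t := by
  unfold velocity
  rw [mfderivWithin_of_mem_nhds hs, mfderivWithin_of_mem_nhds hs']

section Fields

variable {E : Type*} [NormedAddCommGroup E] [NormedSpace ℝ E]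
  {M : Type*} [TopologicalSpace M] [ChartedSpace E M] [IsManifold 𝓘(ℝ, E) ∞ M]
  {a b : ℝ} {γ : ℝ → M}

theorem IsVariationField.smul {u : ∀ t, TangentSpace 𝓘(ℝ, E) (γ t)}
    (hu : IsVariationField a b γ u) {ρ : ℝ → ℝ} (hρ : ContDiff ℝ ∞ ρ) :
    IsVariationField a b γ (fun t => ρ t • u t) := by
  have hM : IsManifold 𝓘(ℝ, E) 1 M := .of_le (n := ∞) (by norm_num)
  refine ⟨fun t₀ ht₀ => ?_, ?_, ?_⟩
  · obtain ⟨h1, h2⟩ := Bundle.contMDiffWithinAt_totalSpace.1 (hu.contMDiffOn t₀ ht₀)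
    refine Bundle.contMDiffWithinAt_totalSpace.2 ⟨h1, ?_⟩
    have hρ' : ContMDiffWithinAt 𝓘(ℝ, ℝ) 𝓘(ℝ, ℝ) 1 ρ (Icc a b) t₀ :=
      (hρ.of_le (by norm_num)).contMDiff.contMDiffAt.contMDiffWithinAt
    refine (hρ'.smul h2).congr_of_eventuallyEq_of_mem ?_ ht₀
    filter_upwards [h1.continuousWithinAt.preimage_mem_nhdsWithin
      ((trivializationAt E (TangentSpace 𝓘(ℝ, E)) (γ t₀)).open_baseSet.mem_nhds
        (FiberBundle.mem_baseSet_trivializationAt E (TangentSpace 𝓘(ℝ, E)) (γ t₀)))] with t ht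
    exact ((trivializationAt E (TangentSpace 𝓘(ℝ, E)) (γ t₀)).linear ℝ ht).map_smul (ρ t) (u t)
  · simp only [hu.left, smul_zero]
  · simp only [hu.right, smul_zero]

/-- The integrand is a linear function of the field and of its derivative in time. This additivity
lets a partition of unity be applied to the field instead of the variation. -/
theorem firstVariation_eq_sum {J : Type*} [Fintype J] (L : TangentBundle 𝓘(ℝ, E) M → ℝ)
    {w : ∀ t, TangentSpace 𝓘(ℝ, E) (γ t)} {w' : J → ∀ t, TangentSpace 𝓘(ℝ, E) (γ t)}
    (hab : a < b) (hw' : ∀ j, IsVariationField a b γ (w' j)) (hw : ∀ t ∈ Icc a b, w t = ∑ j, w' j t)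
    {t : ℝ} (ht : t ∈ Icc a b) :
    firstVariation L a b γ w t = ∑ j, firstVariation L a b γ (w' j) t := by
  have hu := uniqueDiffOn_Icc hab t ht
  have h1 : ∀ j, HasDerivWithinAt (fun τ => (chartDeriv 𝓘(ℝ, E) (γ t) (γ τ) (w' j τ) : E))
      (derivWithin (fun τ => (chartDeriv 𝓘(ℝ, E) (γ t) (γ τ) (w' j τ) : E)) (Icc a b) t)
      (Icc a b) t := fun j =>
    (velocity_section_snd (((hw' j).contMDiffOn t ht).mdifferentiableWithinAt
      (by simp)) ht).differentiableWithinAt.hasDerivWithinAt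
  have h2 := HasDerivWithinAt.fun_sum (u := Finset.univ) fun j _ => h1 j
  have h3 : derivWithin (fun τ => (chartDeriv 𝓘(ℝ, E) (γ t) (γ τ) (w τ) : E)) (Icc a b) t =
      ∑ j, derivWithin (fun τ => (chartDeriv 𝓘(ℝ, E) (γ t) (γ τ) (w' j τ) : E)) (Icc a b) t := by
    have h4 : ∀ τ ∈ Icc a b, (chartDeriv 𝓘(ℝ, E) (γ t) (γ τ) (w τ) : E) =
        ∑ j, (chartDeriv 𝓘(ℝ, E) (γ t) (γ τ) (w' j τ) : E) := fun τ hτ => by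
      rw [hw τ hτ]; exact map_sum _ _ _
    exact (h2.congr h4 (h4 t ht)).derivWithin hu
  let A : E × E →L[ℝ] ℝ := mfderiv 𝓘(ℝ, E).tangent 𝓘(ℝ, ℝ) L (velocity 𝓘(ℝ, E) (Icc a b) γ t)
  have h5 : ((w t : E), derivWithin (fun τ => (chartDeriv 𝓘(ℝ, E) (γ t) (γ τ) (w τ) : E)) (Icc a b) t)
      = ∑ j, ((w' j t : E), derivWithin (fun τ => (chartDeriv 𝓘(ℝ, E) (γ t) (γ τ) (w' j τ) : E))
        (Icc a b) t) := by
    rw [h3, hw t ht, Prod.ext_iff, Prod.fst_sum, Prod.snd_sum]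
    exact ⟨rfl, rfl⟩
  exact (congrArg A h5).trans (map_sum A _ _)

omit [IsManifold 𝓘(ℝ, E) ∞ M] in
-- In the chart `φ` the map is a homothety centred at `φ q`, whose derivative is multiplication by
-- `m`. It rescales the field of a variation by changing the variation itself.
theorem velocity_chart_homothety {φ : OpenPartialHomeomorph M E}
    (hφ : φ ∈ IsManifold.maximalAtlas 𝓘(ℝ, E) ∞ M) {q : M} (hq : q ∈ φ.source) {s : Set ℝ} {t : ℝ}
    (hs : UniqueDiffWithinAt ℝ s t)
    {g : ℝ → M} (hg : MDifferentiableWithinAt 𝓘(ℝ, ℝ) 𝓘(ℝ, E) g s t)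
    {v : TangentSpace 𝓘(ℝ, E) q} (hv : velocity 𝓘(ℝ, E) s g t = ⟨q, v⟩) (m : ℝ) :
    velocity 𝓘(ℝ, E) s (fun ε => φ.symm (φ q + m • (φ (g ε) - φ q))) t =
      (⟨q, m • v⟩ : TangentBundle 𝓘(ℝ, E) M) := by
  have hd : φ.MDifferentiable 𝓘(ℝ, E) 𝓘(ℝ, E) :=
    ⟨(contMDiffOn_of_mem_maximalAtlas hφ).mdifferentiableOn (by simp),
      (contMDiffOn_symm_of_mem_maximalAtlas hφ).mdifferentiableOn (by simp)⟩
  obtain rfl : g t = q := congrArg Bundle.TotalSpace.proj hv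
  set A : E → E := fun x => φ (g t) + m • (x - φ (g t)) with hA
  have hAq : A (φ (g t)) = φ (g t) := by simp [hA]
  have hAd : HasFDerivAt A (m • ContinuousLinearMap.id ℝ E) (φ (g t)) :=
    (((hasFDerivAt_id (φ (g t))).sub_const (φ (g t))).const_smul m).const_add (φ (g t))
  have h1 := (hd.mdifferentiableAt hq).hasMFDerivAt
  have h2 : HasMFDerivAt 𝓘(ℝ, E) 𝓘(ℝ, E) A (φ (g t)) (m • ContinuousLinearMap.id ℝ E) :=
    hAd.hasMFDerivAt
  have hsymm : MDifferentiableAt 𝓘(ℝ, E) 𝓘(ℝ, E) φ.symm (A (φ (g t))) := by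
    rw [hAq]; exact hd.mdifferentiableAt_symm (φ.map_source hq)
  have h3 := (hsymm.hasMFDerivAt.comp (φ (g t)) h2).comp (g t) h1
  have h4 : velocity 𝓘(ℝ, E) s (fun ε => φ.symm (φ (g t) + m • (φ (g ε) - φ (g t)))) t =
      tangentMap 𝓘(ℝ, E) 𝓘(ℝ, E) ((φ.symm ∘ A) ∘ φ) (velocity 𝓘(ℝ, E) s g t) :=
    velocity_comp h3.mdifferentiableAt hg hs
  rw [h4, hv]
  unfold tangentMap
  rw [h3.mfderiv]
  have h5 := hd.symm_comp_deriv hq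
  have h6 : ∀ x, x = φ (g t) → (⟨φ.symm x, (mfderiv 𝓘(ℝ, E) 𝓘(ℝ, E) φ.symm x : E → E)
      (m • (mfderiv 𝓘(ℝ, E) 𝓘(ℝ, E) φ (g t) : E → E) v)⟩ : TangentBundle 𝓘(ℝ, E) M) = ⟨g t, m • v⟩ := by
    rintro x rfl
    have e1 : (mfderiv 𝓘(ℝ, E) 𝓘(ℝ, E) φ.symm (φ (g t)) : E → E)
        (m • (mfderiv 𝓘(ℝ, E) 𝓘(ℝ, E) φ (g t) : E → E) v) = m • (v : E) :=
      (map_smul (mfderiv 𝓘(ℝ, E) 𝓘(ℝ, E) φ.symm (φ (g t)) : E →L[ℝ] E) m _).trans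
        (congrArg (fun f : E →L[ℝ] E => m • f v) h5)
    exact (congrArg (fun w : E => (⟨φ.symm (φ (g t)), w⟩ : TangentBundle 𝓘(ℝ, E) M)) e1).trans
      (congrArg (fun p => (⟨p, (m • (v : E) : E)⟩ : TangentBundle 𝓘(ℝ, E) M)) (φ.left_inv hq))
  exact h6 _ hAq

end Fields

end Localization

/-! ### Equivalence with the unconstrained problem on the submanifold -/

section Unconstrained
open Filter

variable {n : ℕ} {Q : Type u} [TopologicalSpace Q] [ChartedSpace (EuclideanSpace ℝ (Fin n)) Q]
  {k : ℕ} {P : Type v} [TopologicalSpace P] [ChartedSpace (EuclideanSpace ℝ (Fin k)) P]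
  [IsManifold (𝓡 n) ∞ Q] [IsManifold (𝓡 k) ∞ P] {D : ∀ q : Q, Submodule ℝ (TangentSpace (𝓡 n) q)}
  {ι : P → Q} {a b δ : ℝ} {c : ℝ → P}

omit [IsManifold (𝓡 n) ∞ Q] [IsManifold (𝓡 k) ∞ P] in
theorem IsVariation.comp (hι : ContMDiff (𝓡 k) (𝓡 n) ∞ ι) {Γ : ℝ × ℝ → P}
    (hΓ : IsVariation (E := EuclideanSpace ℝ (Fin k)) a b c δ Γ) :
    IsVariation (E := EuclideanSpace ℝ (Fin n)) a b (ι ∘ c) δ (ι ∘ Γ) where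
  pos := hΓ.pos
  contMDiffOn := (hι.of_le two_le_infty).comp_contMDiffOn hΓ.contMDiffOn
  left ε hε := congrArg ι (hΓ.left ε hε)
  right ε hε := congrArg ι (hΓ.right ε hε)
  zero t ht := congrArg ι (hΓ.zero t ht)

omit [IsManifold (𝓡 n) ∞ Q] [IsManifold (𝓡 k) ∞ P] in
theorem IsVariation.isFieldOf_comp (hι : ContMDiff (𝓡 k) (𝓡 n) ∞ ι) {Γ : ℝ × ℝ → P}
    (hΓ : IsVariation (E := EuclideanSpace ℝ (Fin k)) a b c δ Γ)
    {u : ∀ t, TangentSpace (𝓡 k) (c t)} (hu : IsFieldOf a b c δ Γ u) :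
    IsFieldOf a b (ι ∘ c) δ (ι ∘ Γ) (fun t => mfderiv (𝓡 k) (𝓡 n) ι (c t) (u t)) := fun t ht => by
  have hδ := hΓ.pos
  have h0 : (0 : ℝ) ∈ Ioo (-δ) δ := ⟨by linarith, hδ⟩
  have hΓt : ContMDiffOn 𝓘(ℝ, ℝ) (𝓡 k) 2 (fun ε => Γ (ε, t)) (Ioo (-δ) δ) :=
    hΓ.contMDiffOn.comp
      (contDiff_id.prodMk (contDiff_const (c := t))).contMDiff.contMDiffOn fun ε hε => ⟨hε, ht⟩
  have h1 : velocity (𝓡 n) (Ioo (-δ) δ) (ι ∘ fun ε => Γ (ε, t)) 0 =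
      tangentMap (𝓡 k) (𝓡 n) ι (velocity (𝓡 k) (Ioo (-δ) δ) (fun ε => Γ (ε, t)) 0) :=
    velocity_comp (hι.mdifferentiable (by simp) _)
      ((hΓt 0 h0).mdifferentiableWithinAt (by simp)) (uniqueDiffOn_Ioo _ _ 0 h0)
  rw [hu t ht] at h1
  exact h1

omit [IsManifold (𝓡 n) ∞ Q] [IsManifold (𝓡 k) ∞ P] in
theorem action_comp (hι : ContMDiff (𝓡 k) (𝓡 n) ∞ ι) (L : TangentBundle (𝓡 n) Q → ℝ) (hab : a < b)
    (hc : ContMDiffOn 𝓘(ℝ, ℝ) (𝓡 k) 2 c (Icc a b)) :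
    action L a b (ι ∘ c) = action (L ∘ tangentMap (𝓡 k) (𝓡 n) ι) a b c := by
  refine intervalIntegral.integral_congr fun t ht => ?_
  rw [uIcc_of_le hab.le] at ht
  exact congrArg L (velocity_comp (hι.mdifferentiable (by simp) _)
      ((hc t ht).mdifferentiableWithinAt (by simp)) (uniqueDiffOn_Icc hab t ht))

omit [IsManifold (𝓡 n) ∞ Q] [IsManifold (𝓡 k) ∞ P] in
theorem IsVariation.action_comp_eventuallyEq (hι : ContMDiff (𝓡 k) (𝓡 n) ∞ ι)
    (L : TangentBundle (𝓡 n) Q → ℝ) (hab : a < b) {Γ : ℝ × ℝ → P}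
    (hΓ : IsVariation (E := EuclideanSpace ℝ (Fin k)) a b c δ Γ) :
    (fun ε => action L a b (fun t => (ι ∘ Γ) (ε, t))) =ᶠ[𝓝 0]
      fun ε => action (L ∘ tangentMap (𝓡 k) (𝓡 n) ι) a b (fun t => Γ (ε, t)) := by
  have hδ := hΓ.pos
  filter_upwards [Ioo_mem_nhds (a := -δ) (b := δ) (by linarith) hδ] with ε hε
  exact action_comp (c := fun t => Γ (ε, t)) hι L hab (hΓ.contMDiffOn.comp
      ((contDiff_const (c := ε)).prodMk contDiff_id).contMDiff.contMDiffOn fun τ hτ => ⟨hε, hτ⟩)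

/-- A variation in `Q` of a path in `P` with field tangent to `P` can be replaced, near every time,
by a variation in `P`. -/
theorem IsIntegralSubmanifold.exists_isVariation (hι : IsIntegralSubmanifold k D ι)
    (hD : IsSmoothSubbundle k D) (hc : ContMDiffOn 𝓘(ℝ, ℝ) (𝓡 k) 2 c (Icc a b)) {Γ : ℝ × ℝ → Q}
    (hΓ : IsVariation (E := EuclideanSpace ℝ (Fin n)) a b (ι ∘ c) δ Γ)
    {u : ∀ t, TangentSpace (𝓡 k) (c t)}
    (hu : IsFieldOf a b (ι ∘ c) δ Γ (fun t => mfderiv (𝓡 k) (𝓡 n) ι (c t) (u t)))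
    {t₀ : ℝ} (ht₀ : t₀ ∈ Icc a b) : ∃ J : Set ℝ, IsOpen J ∧ t₀ ∈ J ∧ ∀ ρ : ℝ → ℝ, ContDiff ℝ ∞ ρ →
      (∀ t, 0 ≤ ρ t) → (∀ t, ρ t ≤ 1) → tsupport ρ ⊆ J → ∃ (δ' : ℝ) (Γ' : ℝ × ℝ → P),
        IsVariation (E := EuclideanSpace ℝ (Fin k)) a b c δ' Γ' ∧
          IsFieldOf a b c δ' Γ' (fun t => ρ t • u t) := by
  have hsm := hι.isImmersion.contMDiff
  have hδ := hΓ.pos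
  have h0 : (0 : ℝ) ∈ Ioo (-δ) δ := ⟨by linarith, hδ⟩
  obtain ⟨B, hB⟩ := hι.exists_plaque hD (c t₀)
  have h1 : Γ ⁻¹' B.N ∈ 𝓝[Ioo (-δ) δ ×ˢ Icc a b] ((0, t₀) : ℝ × ℝ) :=
    (hΓ.contMDiffOn.continuousOn (0, t₀) ⟨h0, ht₀⟩).preimage_mem_nhdsWithin
      (B.isOpen.mem_nhds (by rw [hΓ.zero t₀ ht₀]; exact B.mapsTo_ι hB))
  rw [nhdsWithin_prod_eq, isOpen_Ioo.nhdsWithin_eq h0] at h1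
  obtain ⟨U, hU, V, hV, hUV⟩ := mem_prod_iff.1 h1
  obtain ⟨η, hη, hηU⟩ := Metric.mem_nhds_iff.1 hU
  obtain ⟨J, hJ, ht₀J, hJV⟩ := mem_nhdsWithin.1 (inter_mem hV
    ((hc.continuousOn t₀ ht₀).preimage_mem_nhdsWithin (B.φ.open_source.mem_nhds hB)))
  set δ' := min δ η with hδ'
  have hδ'0 : 0 < δ' := lt_min hδ hη
  have h0' : (0 : ℝ) ∈ Ioo (-δ') δ' := ⟨by linarith, hδ'0⟩
  have hsub : Ioo (-δ') δ' ⊆ Ioo (-δ) δ := fun ε hε =>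
    ⟨by linarith [hε.1, min_le_left δ η], by linarith [hε.2, min_le_left δ η]⟩
  have hN : ∀ ε ∈ Ioo (-δ') δ', ∀ t ∈ J, t ∈ Icc a b → Γ (ε, t) ∈ B.N := fun ε hε t ht htI =>
    hUV (mk_mem_prod (hηU (by
      rw [Metric.mem_ball, Real.dist_0_eq_abs, abs_lt]
      exact ⟨by linarith [hε.1, min_le_right δ η], by linarith [hε.2, min_le_right δ η]⟩))
      (hJV ⟨ht, htI⟩).1)
  have hcB : ∀ t ∈ J, t ∈ Icc a b → c t ∈ B.φ.source := fun t ht htI => (hJV ⟨ht, htI⟩).2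
  refine ⟨J, hJ, ht₀J, fun ρ hρ hρ0 hρ1 hρJ => ?_⟩
  -- Retract `Γ` to `P` by `r` and interpolate in the convex chart between `c` (where `ρ = 0`) and
  -- `r ∘ Γ` (where `ρ = 1`). The field of `r ∘ Γ` is `Tr(Tι u) = u`, so that of `G` is `ρ u`.
  -- Building on `Γ` keeps the variation `C²`, although `u` is only guaranteed to be `C¹`.
  set G : ℝ × ℝ → P := fun x =>
    B.φ.symm (B.φ (c x.2) + ρ x.2 • (B.φ (B.r (Γ x)) - B.φ (c x.2))) with hG
  have hGc : ∀ x, x.2 ∈ J → x.2 ∈ Icc a b → Γ x = ι (c x.2) → G x = c x.2 := fun x h2 h3 h4 => by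
    have h5 := hcB x.2 h2 h3
    simp only [hG, h4, B.left_inv _ h5, sub_self, smul_zero, add_zero, B.φ.left_inv h5]
  have hGρ : ∀ x, x.2 ∈ J → x.2 ∈ Icc a b → ρ x.2 = 0 → G x = c x.2 := fun x h2 h3 h4 => by
    have h5 := hcB x.2 h2 h3
    simp only [hG, h4, zero_smul, add_zero, B.φ.left_inv h5]
  -- `G` is meaningful only for times in `J`. It equals `c` off the support of `ρ`, so the two
  -- branches fit together.
  set Γ' : ℝ × ℝ → P := fun x => by classical exact if x.2 ∈ J then G x else c x.2 with hΓ'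
  have hΓ'J : ∀ x, x.2 ∈ J → Γ' x = G x := fun x hx => if_pos hx
  have hΓ'nJ : ∀ x, x.2 ∉ J → Γ' x = c x.2 := fun x hx => if_neg hx
  have hΓ'c : ∀ x, x.2 ∈ Icc a b → Γ x = ι (c x.2) → Γ' x = c x.2 := fun x h3 h4 => by
    by_cases h2 : x.2 ∈ J
    · rw [hΓ'J x h2, hGc x h2 h3 h4]
    · exact hΓ'nJ x h2
  have hcsnd : ContMDiffOn 𝓘(ℝ, ℝ × ℝ) (𝓡 k) 2 (fun x : ℝ × ℝ => c x.2) (Ioo (-δ') δ' ×ˢ Icc a b) :=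
    hc.comp contDiff_snd.contMDiff.contMDiffOn fun x hx => hx.2
  refine ⟨δ', Γ', ⟨hδ'0, ?_, ?_, ?_, ?_⟩, ?_⟩
  · intro x hx
    by_cases h2 : x.2 ∈ J
    · have hcx := hcB x.2 h2 hx.2
      have hNx := hN x.1 hx.1 x.2 h2 hx.2
      have hrx := B.mapsTo_r hNx
      have hφ : ∀ p ∈ B.φ.source, ContMDiffAt (𝓡 k) (𝓡 k) 2 B.φ p := fun p hp =>
        ((contMDiffOn_of_mem_maximalAtlas B.φ_mem).contMDiffAt
          (B.φ.open_source.mem_nhds hp)).of_le two_le_infty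
      have e1 : ContMDiffWithinAt 𝓘(ℝ, ℝ × ℝ) (𝓡 k) 2 (fun x : ℝ × ℝ => B.φ (c x.2))
          (Ioo (-δ') δ' ×ˢ Icc a b) x := (hφ _ hcx).comp_contMDiffWithinAt x (hcsnd x hx)
      have e2 : ContMDiffWithinAt 𝓘(ℝ, ℝ × ℝ) (𝓡 k) 2 (fun x : ℝ × ℝ => B.φ (B.r (Γ x)))
          (Ioo (-δ') δ' ×ˢ Icc a b) x :=
        (hφ _ hrx).comp_contMDiffWithinAt x
          (((B.contMDiffOn_r.contMDiffAt (B.isOpen.mem_nhds hNx)).of_le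
            two_le_infty).comp_contMDiffWithinAt x
            ((hΓ.contMDiffOn x ⟨hsub hx.1, hx.2⟩).mono (prod_mono hsub subset_rfl)))
      have e3 : ContMDiffWithinAt 𝓘(ℝ, ℝ × ℝ) 𝓘(ℝ, ℝ) 2 (fun x : ℝ × ℝ => ρ x.2)
          (Ioo (-δ') δ' ×ˢ Icc a b) x :=
        ((hρ.of_le two_le_infty).comp contDiff_snd).contMDiff.contMDiffAt.contMDiffWithinAt
      have e4 := e1.add (e3.smul (e2.sub e1))
      have htgt : B.φ (c x.2) + ρ x.2 • (B.φ (B.r (Γ x)) - B.φ (c x.2)) ∈ B.φ.target :=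
        B.convex.add_smul_sub_mem (B.φ.map_source hcx) (B.φ.map_source hrx) ⟨hρ0 _, hρ1 _⟩
      have e5 : ContMDiffWithinAt 𝓘(ℝ, ℝ × ℝ) (𝓡 k) 2 G (Ioo (-δ') δ' ×ˢ Icc a b) x :=
        (((contMDiffOn_symm_of_mem_maximalAtlas B.φ_mem).contMDiffAt
          (B.φ.open_target.mem_nhds htgt)).of_le two_le_infty).comp_contMDiffWithinAt x e4
      refine e5.congr_of_eventuallyEq_of_mem ?_ hx
      filter_upwards [nhdsWithin_le_nhds (continuous_snd.continuousAt.preimage_mem_nhds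
        (hJ.mem_nhds h2))] with y hy using hΓ'J y hy
    · refine (hcsnd x hx).congr_of_eventuallyEq_of_mem ?_ hx
      filter_upwards [self_mem_nhdsWithin, nhdsWithin_le_nhds
        (continuous_snd.continuousAt.preimage_mem_nhds ((isClosed_tsupport ρ).isOpen_compl.mem_nhds
          fun h => h2 (hρJ h)))] with y hy hyρ
      by_cases h3 : y.2 ∈ J
      · rw [hΓ'J y h3, hGρ y h3 hy.2 (image_eq_zero_of_notMem_tsupport hyρ)]
      · exact hΓ'nJ y h3
  · have ha : a ∈ Icc a b := ⟨le_rfl, ht₀.1.trans ht₀.2⟩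
    exact fun ε hε => hΓ'c (ε, a) ha (hΓ.left ε (hsub hε))
  · have hb : b ∈ Icc a b := ⟨ht₀.1.trans ht₀.2, le_rfl⟩
    exact fun ε hε => hΓ'c (ε, b) hb (hΓ.right ε (hsub hε))
  · exact fun t ht => hΓ'c (0, t) ht (hΓ.zero t ht)
  · intro t ht
    have hud := uniqueDiffOn_Ioo (-δ') δ' 0 h0'
    by_cases h2 : t ∈ J
    · have h3 : (fun ε => Γ' (ε, t)) = fun ε =>
          B.φ.symm (B.φ (c t) + ρ t • (B.φ (B.r (Γ (ε, t))) - B.φ (c t))) :=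
        funext fun ε => hΓ'J (ε, t) h2
      have h4 : ContMDiffWithinAt 𝓘(ℝ, ℝ) (𝓡 n) 2 (fun ε => Γ (ε, t)) (Ioo (-δ') δ') 0 :=
        ((hΓ.contMDiffOn.mono (prod_mono hsub subset_rfl)).comp (contDiff_id.prodMk
          (contDiff_const (c := t))).contMDiff.contMDiffOn fun ε hε => ⟨hε, ht⟩) 0 h0'
      have hrd := B.mdifferentiableAt_r (hN 0 h0' t h2 ht)
      have h5 : velocity (𝓡 k) (Ioo (-δ') δ') (B.r ∘ fun ε => Γ (ε, t)) 0 = ⟨c t, u t⟩ := by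
        rw [velocity_comp (J := 𝓡 n) hrd (h4.mdifferentiableWithinAt (by simp)) hud,
          velocity_of_mem_nhds (Ioo_mem_nhds h0'.1 h0'.2) (Ioo_mem_nhds h0.1 h0.2), hu t ht]
        exact B.tangentMap_r hsm (ξ := ⟨c t, u t⟩) (hcB t h2 ht)
      rw [h3]
      exact velocity_chart_homothety B.φ_mem (hcB t h2 ht) hud
        (hrd.comp_mdifferentiableWithinAt (f := fun ε => Γ (ε, t)) (0 : ℝ)
          (h4.mdifferentiableWithinAt (by simp))) h5 (ρ t)
    · have h3 : (fun ε => Γ' (ε, t)) = fun _ => c t := funext fun ε => hΓ'nJ (ε, t) h2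
      have h4 : ρ t = 0 := image_eq_zero_of_notMem_tsupport fun h => h2 (hρJ h)
      rw [h3]
      beta_reduce
      rw [h4]
      unfold velocity
      rw [mfderivWithin_const]
      exact congrArg (fun v : EuclideanSpace ℝ (Fin k) => (⟨c t, v⟩ : TangentBundle (𝓡 k) P))
        (zero_smul ℝ (u t : EuclideanSpace ℝ (Fin k))).symm

/-- Composition with `ι` turns variations in `P` into variations in `Q`. In the other direction a
variation in `Q` need not lie in `P`, and its first variation is recovered from those of local
variations in `P`, whose fields add up to `w`. -/
theorem holonomic_isCritical_iff [T2Space Q] (hι : IsIntegralSubmanifold k D ι)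
    (hD : IsSmoothSubbundle k D) {L : TangentBundle (𝓡 n) Q → ℝ}
    (hL : ContMDiff (𝓡 n).tangent 𝓘(ℝ, ℝ) 1 L) (hab : a < b)
    (hc : (unconstrained (L ∘ tangentMap (𝓡 k) (𝓡 n) ι)).IsAdmissible a b c) :
    (holonomic (EuclideanSpace ℝ (Fin k)) L ι).IsCritical a b (ι ∘ c) ↔
      (unconstrained (L ∘ tangentMap (𝓡 k) (𝓡 n) ι)).IsCritical a b c := by
  have hsm := hι.isImmersion.contMDiff
  have hιc := (hsm.of_le two_le_infty).comp_contMDiffOn hc.1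
  have hmaps : MapsTo (ι ∘ c) (Icc a b) (range ι) := fun t _ => ⟨c t, rfl⟩
  constructor
  · refine fun h => ⟨hc, fun δ Γ u hΓ hu huW => ?_⟩
    refine (h.2 δ (ι ∘ Γ) _ (hΓ.comp hsm) (hΓ.isFieldOf_comp hsm hu)
      ⟨isVariationField_of_mfderiv hsm hab huW fun _ _ => rfl, fun t _ => ⟨⟨c t, u t⟩, rfl⟩⟩).congr_of_eventuallyEq
        (hΓ.action_comp_eventuallyEq hsm L hab).symm
  · refine fun h => ⟨(holonomic_isAdmissible_iff L hι hD hab).2 ⟨hιc, hmaps⟩, fun δ Γ w hΓ hw hwW => ?_⟩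
    obtain ⟨hwv, hwD⟩ := (mem_holonomic_W_iff L hι hmaps).1 hwW
    obtain ⟨u, hu, huw⟩ := hι.exists_isVariationField hab hc.1.continuousOn hwv hwD
    have hw' : IsFieldOf a b (ι ∘ c) δ Γ (fun t => mfderiv (𝓡 k) (𝓡 n) ι (c t) (u t)) :=
      fun t ht => (hw t ht).trans (congrArg (fun v : EuclideanSpace ℝ (Fin n) =>
        (⟨ι (c t), v⟩ : TangentBundle (𝓡 n) Q)) (huw t ht))
    choose J hJ hJmem hJΓ using fun t₀ : Icc a b => hι.exists_isVariation hD hc.1 hΓ hw' t₀.2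
    obtain ⟨s, hs⟩ := isCompact_Icc.elim_finite_subcover J hJ fun t ht =>
      mem_iUnion.2 ⟨⟨t, ht⟩, hJmem ⟨t, ht⟩⟩
    obtain ⟨f, hf⟩ := SmoothPartitionOfUnity.exists_isSubordinate 𝓘(ℝ, ℝ)
      (isClosed_Icc (a := a) (b := b)) (fun i : s => J i) (fun i => hJ i) fun t ht => by
        obtain ⟨i, hi, hti⟩ := mem_iUnion₂.1 (hs ht)
        exact mem_iUnion.2 ⟨⟨i, hi⟩, hti⟩
    have hfs : ∀ i, ContDiff ℝ ∞ (f i) := fun i => (f i).contMDiff.contDiff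
    choose δ' Γ' hΓ' hu' using fun i : s => hJΓ i (f i) (hfs i) (f.nonneg i) (f.le_one i) (hf i)
    let w' : s → ∀ t, TangentSpace (𝓡 n) ((ι ∘ c) t) := fun i t =>
      mfderiv (𝓡 k) (𝓡 n) ι (c t) (f i t • u t)
    have hvar : ∀ i, IsVariationField a b (ι ∘ c) (w' i) := fun i =>
      isVariationField_of_mfderiv hsm hab (hu.smul (hfs i)) fun _ _ => rfl
    have hsum : ∀ t ∈ Icc a b, w t = ∑ i, w' i t := fun t ht => by
      have h1 : ∑ i, f i t = 1 := by
        rw [← finsum_eq_sum_of_fintype]; exact f.sum_eq_one ht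
      have h2 : ∀ i, w' i t = f i t • w t := fun i => by
        rw [huw t ht]; exact map_smul _ _ _
      simp only [h2]
      rw [← Finset.sum_smul, h1, one_smul]
    have hact := fun i => ((hΓ' i).comp hsm).hasDerivAt_action hab
      ((hΓ' i).isFieldOf_comp hsm (hu' i)) hL
    -- Each `Γ' i` is an unconstrained variation in `P`, hence stationary; composed with `ι`, it has
    -- the field `w' i`.
    have hzero : ∀ i, ∫ t in a..b, firstVariation L a b (ι ∘ c) (w' i) t = 0 := fun i =>
      (hact i).2.unique ((h.2 (δ' i) (Γ' i) _ (hΓ' i) (hu' i)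
        (hu.smul (hfs i))).congr_of_eventuallyEq ((hΓ' i).action_comp_eventuallyEq hsm L hab))
    refine (hΓ.hasDerivAt_action hab hw hL).2.congr_deriv ?_
    rw [intervalIntegral.integral_congr (g := fun t => ∑ i, firstVariation L a b (ι ∘ c) (w' i) t)
      fun t ht => firstVariation_eq_sum L hab hvar hsum (uIcc_of_le hab.le ▸ ht),
      intervalIntegral.integral_finsetSum fun i _ => (hact i).1]
    exact Finset.sum_eq_zero fun i _ => hzero i

end Unconstrained

/-! ### Gluing plaques along a path -/

section Gluing
open Filter

variable {n : ℕ} {Q : Type u} [TopologicalSpace Q] [ChartedSpace (EuclideanSpace ℝ (Fin n)) Q]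
  [IsManifold (𝓡 n) ∞ Q] {k : ℕ} {D : ∀ q : Q, Submodule ℝ (TangentSpace (𝓡 n) q)}

/-- Two integral submanifolds through a point coincide near that point. -/
theorem IsIntegralSubmanifold.eventually_mem_image [T2Space Q] {P₁ P₂ : Type v} [TopologicalSpace P₁]
    [ChartedSpace (EuclideanSpace ℝ (Fin k)) P₁] [IsManifold (𝓡 k) ∞ P₁] [TopologicalSpace P₂]
    [ChartedSpace (EuclideanSpace ℝ (Fin k)) P₂] [IsManifold (𝓡 k) ∞ P₂] {ι₁ : P₁ → Q} {ι₂ : P₂ → Q}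
    (hι₁ : IsIntegralSubmanifold k D ι₁) (hι₂ : IsIntegralSubmanifold k D ι₂)
    (hD : IsSmoothSubbundle k D) {p₁ : P₁} {p₂ : P₂} (h : ι₁ p₁ = ι₂ p₂) {U : Set P₁}
    (hU : IsOpen U) (hp : p₁ ∈ U) : ∀ᶠ q in 𝓝 p₂, ι₂ q ∈ ι₁ '' U := by
  have hsm₂ := hι₂.isImmersion.contMDiff
  obtain ⟨B₁, hB₁⟩ := hι₁.exists_plaque hD p₁
  obtain ⟨B₂, hB₂⟩ := exists_slice hι₂.isImmersion p₂
  obtain ⟨B, hB, hN, -, -, hconv⟩ := B₂.exists_restrict hsm₂.continuous hB₂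
    (B₁.contMDiffOn_r.continuousOn.isOpen_inter_preimage B₁.isOpen hU)
    (by rw [← h]; exact ⟨B₁.mapsTo_ι hB₁, by rwa [mem_preimage, B₁.left_inv p₁ hB₁]⟩)
  filter_upwards [B.φ.open_source.mem_nhds hB] with q hq
  -- A segment in the convex chart joins `p₂` to `q` in the second submanifold. Its image is a path
  -- tangent to `D` that starts in the plaque `B₁`, so it stays there; its endpoint is retracted
  -- into `U` by the choice of `B`.
  set σ : ℝ → EuclideanSpace ℝ (Fin k) := fun s => B.φ p₂ + s • (B.φ q - B.φ p₂) with hσ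
  have hσt : ∀ s ∈ Icc (0 : ℝ) 1, σ s ∈ B.φ.target := fun s hs =>
    hconv.add_smul_sub_mem (B.φ.map_source hB) (B.φ.map_source hq) hs
  have hσs : ContDiff ℝ 2 σ := contDiff_const.add (contDiff_id.smul contDiff_const)
  have hγ : ContMDiffOn 𝓘(ℝ, ℝ) (𝓡 n) 2 (fun s => ι₂ (B.φ.symm (σ s))) (Icc 0 1) :=
    (hsm₂.of_le two_le_infty).comp_contMDiffOn
      (((contMDiffOn_symm_of_mem_maximalAtlas B.φ_mem).of_le two_le_infty).comp
        hσs.contMDiff.contMDiffOn hσt)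
  have hmaps : ∀ s ∈ Icc (0 : ℝ) 1, ι₂ (B.φ.symm (σ s)) ∈ B₁.N ∩ B₁.r ⁻¹' U := fun s hs =>
    (hN (B.mapsTo_ι (B.φ.map_target (hσt s hs)))).1
  have hσ0 : B.φ.symm (σ 0) = p₂ := by simp only [hσ, zero_smul, add_zero, B.φ.left_inv hB]
  have hσ1 : B.φ.symm (σ 1) = q := by
    simp only [hσ, one_smul, add_sub_cancel, B.φ.left_inv hq]
  have h1 := B₁.path 0 1 0 1 _ 0 one_pos hγ subset_rfl
    (hι₂.velocity_mem_totalSet hD one_pos hγ fun s _ => ⟨_, rfl⟩) (fun s hs => (hmaps s hs).1)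
    ⟨le_rfl, zero_le_one⟩ (by rw [hσ0, ← h, B₁.left_inv p₁ hB₁]) 1 ⟨zero_le_one, le_rfl⟩
  have h2 := (hmaps 1 ⟨zero_le_one, le_rfl⟩).2
  rw [hσ1] at h1 h2
  exact ⟨_, h2, h1⟩

/-- `S` is an open piece, with compact closure, of a plaque of an integral submanifold. -/
def IsPlaquePiece (k : ℕ) (D : ∀ q : Q, Submodule ℝ (TangentSpace (𝓡 n) q)) (S : Set Q) : Prop :=
  ∃ (P : Type u) (_ : TopologicalSpace P) (_ : ChartedSpace (EuclideanSpace ℝ (Fin k)) P)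
    (_ : IsManifold (𝓡 k) ∞ P) (ι : P → Q) (B : Plaque k D ι) (U K : Set P),
    IsIntegralSubmanifold k D ι ∧ IsOpen U ∧ IsCompact K ∧ U ⊆ K ∧ K ⊆ B.φ.source ∧ S = ι '' U

/-- Near each of its points, `S` is a slice of an integral submanifold, closed in an open set. -/
def IsUnionOfSlices (k : ℕ) (D : ∀ q : Q, Submodule ℝ (TangentSpace (𝓡 n) q)) (S : Set Q) : Prop :=
  ∀ x ∈ S, ∃ (P : Type u) (_ : TopologicalSpace P) (_ : ChartedSpace (EuclideanSpace ℝ (Fin k)) P)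
    (_ : IsManifold (𝓡 k) ∞ P) (ι : P → Q) (B : Slice n k ι),
    IsIntegralSubmanifold k D ι ∧ x ∈ B.N ∧ S ∩ B.N = ι '' B.φ.source

theorem exists_isPlaquePiece (hD : IsSmoothSubbundle k D) (hint : IsIntegrable k D)
    {a b : ℝ} (hab : a < b) {γ : ℝ → Q} (hγ : ContMDiffOn 𝓘(ℝ, ℝ) (𝓡 n) 2 γ (Icc a b))
    (hγD : ∀ t ∈ Icc a b, velocity (𝓡 n) (Icc a b) γ t ∈ totalSet D) {t₀ : ℝ} (ht₀ : t₀ ∈ Icc a b) :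
    ∃ S, IsPlaquePiece k D S ∧ ∀ᶠ t in 𝓝[Icc a b] t₀, γ t ∈ S := by
  obtain ⟨P, _, _, _, ι, hι, p, hp⟩ := hint (γ t₀)
  have : LocallyCompactSpace P := ChartedSpace.locallyCompactSpace (EuclideanSpace ℝ (Fin k)) P
  obtain ⟨B, hB⟩ := hι.exists_plaque hD p
  obtain ⟨K, hK, hKB, hKc⟩ := local_compact_nhds (B.φ.open_source.mem_nhds hB)
  have hpN : γ t₀ ∈ B.N := hp ▸ B.mapsTo_ι hB
  refine ⟨_, ⟨P, _, _, _, ι, B, interior K, K, hι, isOpen_interior, hKc, interior_subset, hKB, rfl⟩, ?_⟩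
  have hrp : B.r (γ t₀) = p := by rw [← hp, B.left_inv p hB]
  have hopen : IsOpen (B.N ∩ B.r ⁻¹' interior K) :=
    B.contMDiffOn_r.continuousOn.isOpen_inter_preimage B.isOpen isOpen_interior
  obtain ⟨α, β, ht₀', hS, hsub, hnhds⟩ := exists_Icc_subset_mem_nhdsWithin ht₀
    ((hγ.continuousOn t₀ ht₀).preimage_mem_nhdsWithin (hopen.mem_nhds ⟨hpN, by
      rw [mem_preimage, hrp]; exact mem_interior_iff_mem_nhds.2 hK⟩))
  filter_upwards [hnhds] with t ht
  exact ⟨_, (hS ht).2, B.path a b α β γ t₀ hab hγ hsub (fun t ht => hγD t (hsub ht))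
    (fun t ht => (hS ht).1) ht₀' (by rw [hrp, hp]) t ht⟩

/-- If `x` is in the compact set `ι' '' K'`, the two submanifolds coincide near `x`. Otherwise the
complement of this closed set is a neighbourhood of `x` missed by `S'`; this is where the compact
closure of the pieces is needed. -/
theorem IsPlaquePiece.exists_isOpen_inter_subset [T2Space Q] (hD : IsSmoothSubbundle k D)
    {S S' : Set Q} (hS : IsPlaquePiece k D S) (hS' : IsPlaquePiece k D S') {x : Q} (hx : x ∈ S) :
    ∃ V, IsOpen V ∧ x ∈ V ∧ S' ∩ V ⊆ S := by
  obtain ⟨P, _, _, _, ι, B, U, K, hι, hU, hK, hUK, hKB, rfl⟩ := hS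
  obtain ⟨P', _, _, _, ι', B', U', K', hι', hU', hK', hUK', hKB', rfl⟩ := hS'
  obtain ⟨p, hp, rfl⟩ := hx
  by_cases h : ι p ∈ ι' '' K'
  · obtain ⟨q, hq, hqp⟩ := h
    obtain ⟨A, hAι, hA, hqA⟩ := mem_nhds_iff.1 (hι.eventually_mem_image hι' hD hqp.symm hU hp)
    refine ⟨B'.N ∩ B'.r ⁻¹' A, B'.contMDiffOn_r.continuousOn.isOpen_inter_preimage B'.isOpen hA,
      ?_, ?_⟩
    · rw [← hqp]
      exact ⟨B'.mapsTo_ι (hKB' hq), by rwa [mem_preimage, B'.left_inv q (hKB' hq)]⟩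
    · rintro _ ⟨⟨q', hq', rfl⟩, -, hq'A⟩
      rw [mem_preimage, B'.left_inv q' (hKB' (hUK' hq'))] at hq'A
      exact hAι hq'A
  · refine ⟨(ι' '' K')ᶜ, (hK'.image hι'.isImmersion.contMDiff.continuous).isClosed.isOpen_compl, h, ?_⟩
    rintro _ ⟨⟨q', hq', rfl⟩, hn⟩
    exact absurd ⟨q', hUK' hq', rfl⟩ hn

/-- Near a point of one piece every other piece is contained in it. By finiteness one neighbourhood
serves for all of them, and there the union is that single piece. -/
theorem isUnionOfSlices_iUnion [T2Space Q] (hD : IsSmoothSubbundle k D) {J : Type*} [Finite J]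
    {S : J → Set Q} (hS : ∀ j, IsPlaquePiece k D (S j)) : IsUnionOfSlices k D (⋃ j, S j) := by
  intro x hx
  obtain ⟨i, hi⟩ := mem_iUnion.1 hx
  choose V hV hxV hVS using fun j => (hS i).exists_isOpen_inter_subset hD (hS j) hi
  obtain ⟨P, _, _, _, ι, B, U, K, hι, hU, hK, hUK, hKB, hSi⟩ := hS i
  rw [hSi] at hi
  obtain ⟨p, hp, rfl⟩ := hi
  have hUB := hUK.trans hKB
  obtain ⟨B', hB', hN, hr, hφ, -⟩ := B.exists_restrict hι.isImmersion.contMDiff.continuous (hUB hp)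
    ((isOpen_iInter_of_finite hV).inter
      (B.contMDiffOn_r.continuousOn.isOpen_inter_preimage B.isOpen hU))
    ⟨mem_iInter.2 hxV, B.mapsTo_ι (hUB hp), by rwa [mem_preimage, B.left_inv p (hUB hp)]⟩
  refine ⟨P, _, _, _, ι, B', hι, B'.mapsTo_ι hB', Subset.antisymm ?_ ?_⟩
  · rintro y ⟨hyS, hyN⟩
    obtain ⟨j, hj⟩ := mem_iUnion.1 hyS
    have h1 := hVS j ⟨hj, mem_iInter.1 (hN hyN).1.1 j⟩
    rw [hSi] at h1
    obtain ⟨q, hq, rfl⟩ := h1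
    have h2 := B'.mapsTo_r hyN
    rw [hr, B.left_inv q (hUB hq)] at h2
    exact ⟨q, h2, rfl⟩
  · rintro _ ⟨q, hq, rfl⟩
    have h1 := B'.mapsTo_ι hq
    refine ⟨mem_iUnion.2 ⟨i, ?_⟩, h1⟩
    rw [hSi]
    have h2 := (hN h1).1.2.2
    rw [mem_preimage, B.left_inv q (hφ hq)] at h2
    exact ⟨q, h2, rfl⟩

theorem exists_isUnionOfSlices [T2Space Q] (hD : IsSmoothSubbundle k D) (hint : IsIntegrable k D)
    {a b : ℝ} (hab : a < b) {γ : ℝ → Q} (hγ : ContMDiffOn 𝓘(ℝ, ℝ) (𝓡 n) 2 γ (Icc a b))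
    (hγD : ∀ t ∈ Icc a b, velocity (𝓡 n) (Icc a b) γ t ∈ totalSet D) :
    ∃ S, IsUnionOfSlices k D S ∧ MapsTo γ (Icc a b) S := by
  choose S hS hγS using fun t : Icc a b => exists_isPlaquePiece hD hint hab hγ hγD t.2
  obtain ⟨s, hs⟩ := isCompact_Icc.elim_nhdsWithin_subcover' (fun t ht => γ ⁻¹' S ⟨t, ht⟩)
    fun t ht => hγS ⟨t, ht⟩
  refine ⟨⋃ t : s, S t, isUnionOfSlices_iUnion hD fun t => hS t, fun t ht => ?_⟩
  obtain ⟨i, hi, hti⟩ := mem_iUnion₂.1 (hs ht)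
  exact mem_iUnion.2 ⟨⟨i, hi⟩, hti⟩

end Gluing

/-! ### The embedded integral submanifold -/

section Embedded
open Filter

variable {n : ℕ} {Q : Type u} [TopologicalSpace Q] [ChartedSpace (EuclideanSpace ℝ (Fin n)) Q]
  {k : ℕ} {P : Type v} [TopologicalSpace P] [ChartedSpace (EuclideanSpace ℝ (Fin k)) P]
  {D : ∀ q : Q, Submodule ℝ (TangentSpace (𝓡 n) q)} {S : Set Q} {ι : P → Q}

/-- The chart `χ` of the subset `S` of `Q` is the one induced by a slice of an integral
submanifold. -/
structure IsSliceChart (S : Set Q) (χ : OpenPartialHomeomorph S (EuclideanSpace ℝ (Fin k)))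
    (B : Slice n k ι) : Prop where
  source_eq : χ.source = Subtype.val ⁻¹' B.N
  target_eq : χ.target = B.φ.target
  apply_eq : ∀ y : S, χ y = B.φ (B.r y)
  symm_apply_eq : ∀ z ∈ χ.target, (χ.symm z : Q) = ι (B.φ.symm z)

/-- The chart is `φ ∘ r`. It is a homeomorphism for the subspace topology because `r` is continuous
on `N` and `S ∩ N` consists of the slice alone. -/
theorem Slice.exists_isSliceChart (hι : Continuous ι) (B : Slice n k ι) (x : S)
    (hS : S ∩ B.N = ι '' B.φ.source) :
    ∃ χ : OpenPartialHomeomorph S (EuclideanSpace ℝ (Fin k)), IsSliceChart S χ B := by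
  classical
  have hmem : ∀ z ∈ B.φ.target, ι (B.φ.symm z) ∈ S ∩ B.N := fun z hz => by
    rw [hS]; exact mem_image_of_mem ι (B.φ.map_target hz)
  -- The point `x` is only a default value outside the target.
  let g : EuclideanSpace ℝ (Fin k) → S := fun z =>
    if hz : z ∈ B.φ.target then ⟨ι (B.φ.symm z), (hmem z hz).1⟩ else x
  have hg : ∀ z ∈ B.φ.target, (g z : Q) = ι (B.φ.symm z) := fun z hz => by
    simp only [g, dif_pos hz]
  have hιr : ∀ y : S, (y : Q) ∈ B.N → ι (B.r y) = y := fun y hy => by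
    obtain ⟨p, hp, hpy⟩ : (y : Q) ∈ ι '' B.φ.source := hS ▸ ⟨y.2, hy⟩
    rw [← hpy, B.left_inv p hp]
  refine ⟨⟨⟨⟨fun y => B.φ (B.r y), g, Subtype.val ⁻¹' B.N, B.φ.target,
    fun y hy => B.φ.map_source (B.mapsTo_r hy), fun z hz => ?_, fun y hy => ?_, fun z hz => ?_⟩,
    ?_, ?_⟩, B.isOpen.preimage continuous_subtype_val, B.φ.open_target⟩, rfl, rfl, fun _ => rfl, hg⟩
  · rw [mem_preimage, hg z hz]; exact (hmem z hz).2
  · refine Subtype.ext ?_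
    rw [hg _ (B.φ.map_source (B.mapsTo_r hy)), B.φ.left_inv (B.mapsTo_r hy), hιr y hy]
  · rw [hg z hz, B.left_inv _ (B.φ.map_target hz), B.φ.right_inv hz]
  · exact B.φ.continuousOn.comp (B.contMDiffOn_r.continuousOn.comp
      continuous_subtype_val.continuousOn fun y hy => hy) fun y hy => B.mapsTo_r hy
  · rw [IsInducing.subtypeVal.continuousOn_iff]
    exact (hι.comp_continuousOn B.φ.symm.continuousOn).congr hg

/-- The change of charts is `φ' ∘ r' ∘ ι ∘ φ⁻¹`, which passes through the ambient manifold, so the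
two slices may come from different submanifolds. -/
theorem IsSliceChart.contDiffOn_symm_trans {P' : Type v} [TopologicalSpace P']
    [ChartedSpace (EuclideanSpace ℝ (Fin k)) P'] {ι' : P' → Q} {B : Slice n k ι} {B' : Slice n k ι'}
    {χ χ' : OpenPartialHomeomorph S (EuclideanSpace ℝ (Fin k))} (hι : ContMDiff (𝓡 k) (𝓡 n) ∞ ι)
    (hχ : IsSliceChart S χ B) (hχ' : IsSliceChart S χ' B') :
    ContDiffOn ℝ ∞ (χ.symm ≫ₕ χ') (χ.symm ≫ₕ χ').source := by
  have h1 : ContMDiffOn (𝓡 k) (𝓡 n) ∞ (fun z => ι (B.φ.symm z)) χ.target :=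
    hι.comp_contMDiffOn (hχ.target_eq ▸ contMDiffOn_symm_of_mem_maximalAtlas B.φ_mem)
  have h2 : ContMDiffOn (𝓡 n) (𝓡 k) ∞ (fun y => B'.φ (B'.r y)) B'.N :=
    (contMDiffOn_of_mem_maximalAtlas B'.φ_mem).comp B'.contMDiffOn_r B'.mapsTo_r
  have hsub : (χ.symm ≫ₕ χ').source ⊆ χ.target := fun z hz => hz.1
  have h3 : ContMDiffOn (𝓡 k) (𝓡 k) ∞ (fun z => B'.φ (B'.r (ι (B.φ.symm z)))) (χ.symm ≫ₕ χ').source := by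
    refine h2.comp (h1.mono hsub) fun z hz => ?_
    have h4 : χ.symm z ∈ χ'.source := hz.2
    rw [hχ'.source_eq, mem_preimage, hχ.symm_apply_eq z (hsub hz)] at h4
    exact h4
  refine (contMDiffOn_iff_contDiffOn.1 h3).congr fun z hz => ?_
  change χ' (χ.symm z) = _
  rw [hχ'.apply_eq, hχ.symm_apply_eq z (hsub hz)]

theorem range_mfderiv_comp_symm {E F : Type*} [NormedAddCommGroup E] [NormedSpace ℝ E]
    [NormedAddCommGroup F] [NormedSpace ℝ F] {M N : Type*} [TopologicalSpace M] [ChartedSpace E M]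
    [TopologicalSpace N] [ChartedSpace F N] {f : M → N} {e : OpenPartialHomeomorph M E}
    (he : e ∈ IsManifold.maximalAtlas 𝓘(ℝ, E) ∞ M) {z : E} (hz : z ∈ e.target)
    (hf : MDifferentiableAt 𝓘(ℝ, E) 𝓘(ℝ, F) f (e.symm z)) :
    range (mfderiv 𝓘(ℝ, E) 𝓘(ℝ, F) (f ∘ e.symm) z : E → F) =
      range (mfderiv 𝓘(ℝ, E) 𝓘(ℝ, F) f (e.symm z) : E → F) := by
  have hd : e.MDifferentiable 𝓘(ℝ, E) 𝓘(ℝ, E) :=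
    ⟨(contMDiffOn_of_mem_maximalAtlas he).mdifferentiableOn (by simp),
      (contMDiffOn_symm_of_mem_maximalAtlas he).mdifferentiableOn (by simp)⟩
  rw [mfderiv_comp z hf (hd.mdifferentiableAt_symm hz)]
  exact (hd.symm.mfderiv_surjective hz).range_comp
    (mfderiv 𝓘(ℝ, E) 𝓘(ℝ, F) f (e.symm z) : E → F)

/-- The complement in the normal form of a slice varies with the slice. A dimension count replaces
it by a fixed space, as required for a single immersion built from many slices. -/
theorem Slice.exists_equiv_euclideanSpace (B : Slice n k ι) :
    ∃ equiv : (EuclideanSpace ℝ (Fin k) × EuclideanSpace ℝ (Fin (n - k))) ≃L[ℝ]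
      EuclideanSpace ℝ (Fin n), ∀ p ∈ B.φ.source, B.ψ (ι p) = equiv (B.φ p, 0) := by
  obtain ⟨F, _, _, f, hf⟩ := B.exists_equiv
  have h1 : FiniteDimensional ℝ (EuclideanSpace ℝ (Fin k) × F) :=
    LinearEquiv.finiteDimensional f.symm.toLinearEquiv
  have h2 : FiniteDimensional ℝ F :=
    Module.Finite.of_surjective (LinearMap.snd ℝ (EuclideanSpace ℝ (Fin k)) F) LinearMap.snd_surjective
  have h3 := f.toLinearEquiv.finrank_eq
  rw [Module.finrank_prod, finrank_euclideanSpace_fin, finrank_euclideanSpace_fin] at h3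
  have g : F ≃L[ℝ] EuclideanSpace ℝ (Fin (n - k)) := ContinuousLinearEquiv.ofFinrankEq (by
    rw [finrank_euclideanSpace_fin]; omega)
  refine ⟨((ContinuousLinearEquiv.refl ℝ _).prodCongr g.symm).trans f, fun p hp => ?_⟩
  rw [hf p hp]
  simp

variable [IsManifold (𝓡 n) ∞ Q]

omit [IsManifold (𝓡 n) ∞ Q] in
theorem IsUnionOfSlices.exists_isIntegralSubmanifold [T2Space Q] [SecondCountableTopology Q]
    (hS : IsUnionOfSlices k D S) : ∃ (P : Type u) (_ : TopologicalSpace P)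
        (_ : ChartedSpace (EuclideanSpace ℝ (Fin k)) P) (_ : IsManifold (𝓡 k) ∞ P)
        (ι : P → Q), IsIntegralSubmanifold k D ι ∧ IsEmbedding ι ∧ range ι = S := by
  have hχ : ∀ x : S, ∃ χ : OpenPartialHomeomorph S (EuclideanSpace ℝ (Fin k)), x ∈ χ.source ∧
      ∃ (P : Type u) (_ : TopologicalSpace P) (_ : ChartedSpace (EuclideanSpace ℝ (Fin k)) P)
        (_ : IsManifold (𝓡 k) ∞ P) (ι : P → Q) (B : Slice n k ι),
        IsIntegralSubmanifold k D ι ∧ IsSliceChart S χ B := fun x => by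
    obtain ⟨P, i1, i2, i3, ι, B, hι, hxN, hSB⟩ := hS x x.2
    obtain ⟨χ, hχ⟩ := B.exists_isSliceChart hι.isImmersion.contMDiff.continuous x hSB
    exact ⟨χ, by rw [hχ.source_eq]; exact hxN, P, i1, i2, i3, ι, B, hι, hχ⟩
  choose χ hxχ hdata using hχ
  let _ : ChartedSpace (EuclideanSpace ℝ (Fin k)) S :=
    { atlas := range χ
      chartAt := χ
      mem_chart_source := hxχ
      chart_mem_atlas := fun x => mem_range_self x }
  have : IsManifold (𝓡 k) ∞ S := by
    refine isManifold_of_contDiffOn (𝓡 k) ∞ S ?_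
    rintro _ _ ⟨x, rfl⟩ ⟨y, rfl⟩
    obtain ⟨P, _, _, _, ι, B, hι, hB⟩ := hdata x
    obtain ⟨P', _, _, _, ι', B', hι', hB'⟩ := hdata y
    simpa using hB.contDiffOn_symm_trans hι.isImmersion.contMDiff hB'
  have hatlas : ∀ x, χ x ∈ IsManifold.maximalAtlas (𝓡 k) ∞ S := fun x =>
    IsManifold.subset_maximalAtlas (mem_range_self x)
  have himm : Manifold.IsImmersionOfComplement (EuclideanSpace ℝ (Fin (n - k))) (𝓡 k) (𝓡 n) ∞
      (Subtype.val : S → Q) := fun x => by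
    obtain ⟨P, _, _, _, ι, B, hι, hB⟩ := hdata x
    obtain ⟨f, hf⟩ := B.exists_equiv_euclideanSpace
    have hval : ∀ y ∈ (χ x).source, B.r y ∈ B.φ.source ∧ (y : Q) = ι (B.r y) := fun y hy => by
      have h1 : (y : Q) ∈ B.N := by rwa [hB.source_eq] at hy
      have h2 := hB.symm_apply_eq _ ((χ x).map_source hy)
      rw [(χ x).left_inv hy, hB.apply_eq, B.φ.left_inv (B.mapsTo_r h1)] at h2
      exact ⟨B.mapsTo_r h1, h2⟩
    have hψ : ∀ y ∈ (χ x).source, (y : Q) ∈ B.ψ.source := fun y hy => by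
      rw [(hval y hy).2]; exact B.mapsTo_ψ (hval y hy).1
    refine Manifold.IsImmersionAtOfComplement.mk_of_charts f (χ x) B.ψ (hxχ x) (hψ x (hxχ x))
      (hatlas x) B.ψ_mem hψ fun z hz => ?_
    have hz' : z ∈ (χ x).target := by simpa using hz
    have hz'' : z ∈ B.φ.target := hB.target_eq ▸ hz'
    change B.ψ ((χ x).symm z) = f (z, 0)
    rw [hB.symm_apply_eq z hz', hf _ (B.φ.map_target hz''), B.φ.right_inv hz'']
  refine ⟨S, inferInstance, inferInstance, inferInstance, Subtype.val,
    ⟨inferInstance, inferInstance, Subtype.val_injective, himm.isImmersion, fun x => ?_⟩,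
    IsEmbedding.subtypeVal, Subtype.range_coe⟩
  obtain ⟨P, _, _, _, ι, B, hι, hB⟩ := hdata x
  have hxz := (χ x).map_source (hxχ x)
  set z := χ x x with hz
  have hzx : (χ x).symm z = x := (χ x).left_inv (hxχ x)
  have hzφ : z ∈ B.φ.target := hB.target_eq ▸ hxz
  have hev : (Subtype.val : S → Q) ∘ (χ x).symm =ᶠ[𝓝 z] ι ∘ B.φ.symm := by
    filter_upwards [(χ x).open_target.mem_nhds hxz] with y hy using hB.symm_apply_eq y hy
  have hsmS : MDifferentiable (𝓡 k) (𝓡 n) (Subtype.val : S → Q) :=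
    himm.isImmersion.contMDiff.mdifferentiable (by simp)
  have h1 := range_mfderiv_comp_symm (hatlas x) hxz (hsmS _)
  have h2 := range_mfderiv_comp_symm B.φ_mem hzφ
    (hι.isImmersion.contMDiff.mdifferentiable (by simp) _)
  have h3 := hι.range_mfderiv (B.φ.symm z)
  have h4 : (x : Q) = ι (B.φ.symm z) := by
    rw [← hB.symm_apply_eq z hxz, hzx]
  have h5 := hev.mfderiv_eq (I := 𝓡 k) (I' := 𝓡 n)
  have h6 := congrArg (fun y : S => range (mfderiv (𝓡 k) (𝓡 n) (Subtype.val : S → Q) y :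
    EuclideanSpace ℝ (Fin k) → EuclideanSpace ℝ (Fin n))) hzx
  have h7 := congrArg (fun f : EuclideanSpace ℝ (Fin k) →L[ℝ] EuclideanSpace ℝ (Fin n) => range f) h5
  have h8 := congrArg (fun q => (show Set (EuclideanSpace ℝ (Fin n)) from (D q : Set (TangentSpace (𝓡 n) q)))) h4
  exact h6.symm.trans (h1.symm.trans (h7.trans (h2.trans (h3.trans h8.symm))))

theorem exists_isEmbedding_integralSubmanifold [T2Space Q] [SecondCountableTopology Q]
    (hD : IsSmoothSubbundle k D) (hint : IsIntegrable k D)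
    {a b : ℝ} (hab : a < b) {γ : ℝ → Q} (hγ : ContMDiffOn 𝓘(ℝ, ℝ) (𝓡 n) 2 γ (Icc a b))
    (hγD : ∀ t ∈ Icc a b, velocity (𝓡 n) (Icc a b) γ t ∈ totalSet D) :
    ∃ (P : Type u) (_ : TopologicalSpace P)
      (_ : ChartedSpace (EuclideanSpace ℝ (Fin k)) P) (_ : IsManifold (𝓡 k) ∞ P)
      (ι : P → Q), IsIntegralSubmanifold k D ι ∧ IsEmbedding ι ∧ MapsTo γ (Icc a b) (range ι) := by
  obtain ⟨S, hS, hγS⟩ := exists_isUnionOfSlices hD hint hab hγ hγD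
  obtain ⟨P, i1, i2, i3, ι, hι, hemb, rfl⟩ := hS.exists_isIntegralSubmanifold
  exact ⟨P, i1, i2, i3, ι, hι, hemb, hγS⟩

end Embedded

end VarMech

end

/-! ### The main theorem -/

theorem mainTheorem2 {n k : ℕ} {Q : Type u} [TopologicalSpace Q] [T2Space Q]
    [SecondCountableTopology Q] [ChartedSpace (EuclideanSpace ℝ (Fin n)) Q]
    [IsManifold (𝓡 n) ∞ Q]
    (L : TangentBundle (𝓡 n) Q → ℝ) (hL : ContMDiff (𝓡 n).tangent 𝓘(ℝ, ℝ) 1 L)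
    (D : ∀ q : Q, Submodule ℝ (TangentSpace (𝓡 n) q))
    (hD : IsSmoothSubbundle k D) (hint : IsIntegrable k D)
    {a b : ℝ} (hab : a < b) :
    -- vakonomic and nonholonomic mechanics coincide
    (∀ γ : ℝ → Q,
      ((vakonomic L (totalSet D)).IsAdmissible a b γ ↔
        (nonholonomic L (totalSet D)).IsAdmissible a b γ) ∧
      ((vakonomic L (totalSet D)).IsAdmissible a b γ →
        (vakonomic L (totalSet D)).W a b γ = (nonholonomic L (totalSet D)).W a b γ) ∧
      ((vakonomic L (totalSet D)).IsCritical a b γ ↔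
        (nonholonomic L (totalSet D)).IsCritical a b γ)) ∧
    -- every admissible path is contained in an (even embedded) integral submanifold
    (∀ γ : ℝ → Q, (nonholonomic L (totalSet D)).IsAdmissible a b γ →
      ∃ (P : Type u) (_ : TopologicalSpace P)
        (_ : ChartedSpace (EuclideanSpace ℝ (Fin k)) P) (_ : IsManifold (𝓡 k) ∞ P)
        (ι : P → Q),
        IsIntegralSubmanifold k D ι ∧ IsEmbedding ι ∧ MapsTo γ (Icc a b) (range ι)) ∧
    -- on each integral submanifold
    (∀ (P : Type v) [TopologicalSpace P] [ChartedSpace (EuclideanSpace ℝ (Fin k)) P]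
      [IsManifold (𝓡 k) ∞ P] (ι : P → Q),
      IsIntegralSubmanifold k D ι →
      -- the admissible paths of the holonomic problem are the `C²` paths contained in `P`
      (∀ γ : ℝ → Q, (holonomic (EuclideanSpace ℝ (Fin k)) L ι).IsAdmissible a b γ ↔
        ContMDiffOn 𝓘(ℝ, ℝ) (𝓡 n) 2 γ (Icc a b) ∧ MapsTo γ (Icc a b) (range ι)) ∧
      -- both mechanics are equivalent to the holonomic problem
      (∀ γ : ℝ → Q, MapsTo γ (Icc a b) (range ι) →
        ((nonholonomic L (totalSet D)).IsAdmissible a b γ ↔ (holonomic (EuclideanSpace ℝ (Fin k)) L ι).IsAdmissible a b γ) ∧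
        ((holonomic (EuclideanSpace ℝ (Fin k)) L ι).IsAdmissible a b γ →
          (vakonomic L (totalSet D)).W a b γ = (holonomic (EuclideanSpace ℝ (Fin k)) L ι).W a b γ ∧
          (nonholonomic L (totalSet D)).W a b γ = (holonomic (EuclideanSpace ℝ (Fin k)) L ι).W a b γ) ∧
        ((vakonomic L (totalSet D)).IsCritical a b γ ↔ (holonomic (EuclideanSpace ℝ (Fin k)) L ι).IsCritical a b γ) ∧
        ((nonholonomic L (totalSet D)).IsCritical a b γ ↔ (holonomic (EuclideanSpace ℝ (Fin k)) L ι).IsCritical a b γ)) ∧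
      -- and hence to the unconstrained problem on `P` for the restriction of `L` to `TP`
      (∀ γ : ℝ → Q, (holonomic (EuclideanSpace ℝ (Fin k)) L ι).IsAdmissible a b γ ↔
        ∃ c : ℝ → P, (unconstrained (L ∘ tangentMap (𝓡 k) (𝓡 n) ι)).IsAdmissible a b c ∧
          EqOn γ (ι ∘ c) (Icc a b)) ∧
      (∀ c : ℝ → P, (unconstrained (L ∘ tangentMap (𝓡 k) (𝓡 n) ι)).IsAdmissible a b c →
        (∀ w : ∀ t, TangentSpace (𝓡 n) ((ι ∘ c) t), w ∈ (holonomic (EuclideanSpace ℝ (Fin k)) L ι).W a b (ι ∘ c) ↔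
          ∃ u ∈ (unconstrained (L ∘ tangentMap (𝓡 k) (𝓡 n) ι)).W a b c,
            ∀ t ∈ Icc a b, w t = mfderiv (𝓡 k) (𝓡 n) ι (c t) (u t)) ∧
        ((holonomic (EuclideanSpace ℝ (Fin k)) L ι).IsCritical a b (ι ∘ c) ↔
          (unconstrained (L ∘ tangentMap (𝓡 k) (𝓡 n) ι)).IsCritical a b c))) := by
  have key : ∀ γ : ℝ → Q, (vakonomic L (totalSet D)).IsAdmissible a b γ →
      (vakonomic L (totalSet D)).W a b γ = (nonholonomic L (totalSet D)).W a b γ := fun γ h =>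
    Set.ext fun w => (mem_vakonomic_W_iff L hD hint hab h.1 h.2).trans
      (mem_nonholonomic_W_iff L hD h.2).symm
  have hadm : ∀ γ : ℝ → Q, (vakonomic L (totalSet D)).IsAdmissible a b γ ↔
      (nonholonomic L (totalSet D)).IsAdmissible a b γ := fun γ =>
    ⟨fun h => ⟨h.1, h.2⟩, fun h => ⟨h.1, h.2⟩⟩
  have hcrit : ∀ γ : ℝ → Q, (vakonomic L (totalSet D)).IsCritical a b γ ↔
      (nonholonomic L (totalSet D)).IsCritical a b γ := fun γ =>
    VariationalProblem.isCritical_congr rfl (hadm γ) (key γ)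
  refine ⟨fun γ => ⟨hadm γ, key γ, hcrit γ⟩,
    fun γ h => exists_isEmbedding_integralSubmanifold hD hint hab h.1 h.2, ?_⟩
  intro P _ _ _ ι hι
  have hsm := hι.isImmersion.contMDiff
  have hhol : ∀ γ : ℝ → Q, MapsTo γ (Icc a b) (range ι) →
      ((nonholonomic L (totalSet D)).IsAdmissible a b γ ↔
        (holonomic (EuclideanSpace ℝ (Fin k)) L ι).IsAdmissible a b γ) := fun γ hγ =>
    ⟨fun h => (holonomic_isAdmissible_iff L hι hD hab).2 ⟨h.1, hγ⟩,
      fun h => ⟨h.1, hι.velocity_mem_totalSet hD hab h.1 hγ⟩⟩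
  have hW : ∀ γ : ℝ → Q, MapsTo γ (Icc a b) (range ι) →
      (nonholonomic L (totalSet D)).IsAdmissible a b γ →
      (nonholonomic L (totalSet D)).W a b γ =
        (holonomic (EuclideanSpace ℝ (Fin k)) L ι).W a b γ := fun γ hγ h =>
    Set.ext fun w => (mem_nonholonomic_W_iff L hD h.2).trans (mem_holonomic_W_iff L hι hγ).symm
  have hcrit' : ∀ γ : ℝ → Q, MapsTo γ (Icc a b) (range ι) →
      ((nonholonomic L (totalSet D)).IsCritical a b γ ↔
        (holonomic (EuclideanSpace ℝ (Fin k)) L ι).IsCritical a b γ) := fun γ hγ =>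
    VariationalProblem.isCritical_congr rfl (hhol γ hγ) (hW γ hγ)
  refine ⟨fun γ => holonomic_isAdmissible_iff L hι hD hab, fun γ hγ => ⟨hhol γ hγ, fun h => ?_,
    (hcrit γ).trans (hcrit' γ hγ), hcrit' γ hγ⟩, fun γ => ?_, fun c hc => ⟨fun w => ?_,
    holonomic_isCritical_iff hι hD hL hab hc⟩⟩
  · have h' := (hhol γ hγ).2 h
    exact ⟨(key γ ((hadm γ).2 h')).trans (hW γ hγ h'), hW γ hγ h'⟩
  · rw [holonomic_isAdmissible_iff L hι hD hab]
    constructor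
    · rintro ⟨hγ, hmaps⟩
      have : Nonempty P := ⟨(hmaps (left_mem_Icc.2 hab.le)).choose⟩
      -- The lift is the pointwise inverse of `ι`, with arbitrary values where the path is not in
      -- its range; its regularity on `[a, b]` is `IsIntegralSubmanifold.contMDiffOn_lift`.
      have hinv : ∀ t ∈ Icc a b, ι (Function.invFun ι (γ t)) = γ t := fun t ht =>
        Function.invFun_eq (hmaps ht)
      exact ⟨fun t => Function.invFun ι (γ t), ⟨hι.contMDiffOn_lift hD hab (hγ.congr hinv),
        fun _ _ => mem_univ _⟩, fun t ht => (hinv t ht).symm⟩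
    · rintro ⟨c, hc, hγ⟩
      exact ⟨((hsm.of_le two_le_infty).comp_contMDiffOn hc.1).congr hγ,
        fun t ht => ⟨c t, (hγ ht).symm⟩⟩
  · refine (mem_holonomic_W_iff (γ := ι ∘ c) L hι fun t _ => ⟨c t, rfl⟩).trans ?_
    exact ⟨fun h => hι.exists_isVariationField hab hc.1.continuousOn h.1 h.2,
      fun ⟨u, hu, huw⟩ => ⟨isVariationField_of_mfderiv hsm hab hu huw, fun t ht => by
        rw [huw t ht, ← SetLike.mem_coe]
        exact hι.range_mfderiv (c t) ▸ mem_range_self (u t)⟩⟩
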